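/- Let $d\ge 1$, $s\in(1/2,1)$, $\sigma\in(0,1]$, $r_0>0$ and $\varepsilon>0$. For an open set $\Omega\subsetneq\mathbb R^d$ write $d_\Omega(x)=\inf\{|x-y| : y\in\mathbb R^d\setminus\Omega\}$ and $$\mathcal L_{\Omega,\sigma}u(x)=\lim_{\delta\searrow0}\int_{\Omega\setminus B_\delta(x)}(u(x)-u(y))\,\mathcal K_{\Omega,\sigma}(x,y)\,dy,\qquad \mathcal K_{\Omega,\sigma}(x,y)=|x-y|^{-d-2s}\,\frac{\mathbf 1_{\{|x-y|<\sigma d_\Omega(x)\}}+\mathbf 1_{\{|x-y|<\sigma d_\Omega(y)\}}}{2},$$ where $B_r(x)$ is the open ball of radius $r$ about $x$ and $B_r=B_r(0)$. Then there exist constants $C>1$ and $\eta>0$, depending only on $r_0,d,s,\sigma,\varepsilon$, with the following property. Let $\Omega\subsetneq\mathbb R^d$ be a (possibly unbounded) $C^{1,1}$ domain such that for every $z\in\partial\Omega\cap B_1$ there are two balls of radius $r_0$, one contained in $\Omega$ and one contained in $\mathbb R^d\setminus\Omega$, which both touch $\partial\Omega$ at $z$. Then there is a function $\tilde\varphi\in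 H^s_{loc}(\mathbb R^d)$ (that is, $\tilde\varphi\psi\in H^s(\mathbb R^d)$ for every $\psi\in C_c^\infty(\mathbb R^d)$) such that 1. for every $x\in B_{4/5}$ with $0<d_\Omega(x)<\eta$, the value $\mathcal L_{\Omega,\sigma}\tilde\varphi(x)$ exists (the integrals converge absolutely and the limit exists and is finite) and $\mathcal L_{\Omega,\sigma}\tilde\varphi(x)\ge d_\Omega(x)^{-1+\varepsilon}$; 2. $d_\Omega(x)^{2s-1}\le\tilde\varphi(x)\le C\,d_\Omega(x)^{2s-1}$ for every $x\in B_1$; 3. $\tilde\varphi(x)=0$ for every $x\in\mathbb R^d\setminus B_2$. -/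

import Mathlib

open Set Filter Topology MeasureTheory
open scoped ContDiff

noncomputable section

/-- Euclidean space of dimension `d`. -/
abbrev Eucl (d : ℕ) : Type := EuclideanSpace ℝ (Fin d)

/-- A real function on `ℝ^d` of class `C^{1,1}`: continuously differentiable with
Lipschitz continuous derivative. -/
def IsC11 {d : ℕ} (γ : Eucl d → ℝ) : Prop :=
  ContDiff ℝ 1 γ ∧ ∃ K : NNReal, LipschitzWith K (fderiv ℝ γ)

/-- A `C^{1,1}` domain, not necessarily bounded: an open connected nonempty set which, near each of
its boundary points, is the part lying on one side of the graph of a `C^{1,1}` function.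
Here `n` is the unit vector giving the vertical direction, `inner ℝ n x` is the vertical coordinate
of `x`, and `x - inner ℝ n x • n` is its projection to the hyperplane orthogonal to `n`; only the
values of `γ` on that hyperplane matter. -/
def IsC11Domain {d : ℕ} (Ω : Set (Eucl d)) : Prop :=
  IsOpen Ω ∧ IsConnected Ω ∧
    ∀ z ∈ frontier Ω, ∃ r : ℝ, 0 < r ∧ ∃ n : Eucl d, ‖n‖ = 1 ∧ ∃ γ : Eucl d → ℝ, IsC11 γ ∧
      Ω ∩ Metric.ball z r =
        {x | γ (x - (inner ℝ n x : ℝ) • n) < (inner ℝ n x : ℝ)} ∩ Metric.ball z r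

/-- Every boundary point in the unit ball is touched by a ball of radius `r₀` contained in `Ω`
and by a ball of radius `r₀` contained in the complement of `Ω`. -/
def TwoSidedBallCondition {d : ℕ} (Ω : Set (Eucl d)) (r₀ : ℝ) : Prop :=
  ∀ z ∈ frontier Ω ∩ Metric.ball 0 1,
    (∃ c : Eucl d, dist c z = r₀ ∧ Metric.ball c r₀ ⊆ Ω) ∧
    (∃ c : Eucl d, dist c z = r₀ ∧ Metric.ball c r₀ ⊆ Ωᶜ)

/-- The distance `d_Ω(x)` from `x` to the complement of `Ω`. -/
def distCompl {d : ℕ} (Ω : Set (Eucl d)) (x : Eucl d) : ℝ := Metric.infDist x Ωᶜ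

open Classical in
/-- The symmetric kernel with vanishing horizon
`|x-y|^{-d-2s} (1_{y ∈ B_{σ d_Ω(x)}(x)} + 1_{x ∈ B_{σ d_Ω(y)}(y)}) / 2`. -/
def horizonKernel {d : ℕ} (Ω : Set (Eucl d)) (s σ : ℝ) (x y : Eucl d) : ℝ :=
  ‖x - y‖ ^ (-(d : ℝ) - 2 * s) *
    (((if y ∈ Metric.ball x (σ * distCompl Ω x) then 1 else 0) +
      (if x ∈ Metric.ball y (σ * distCompl Ω y) then 1 else 0)) / 2)

/-- `L_{Ω,σ} u (x)` exists, as a principal value of convergent integrals, and equals `v`. -/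
def HasOperatorValue {d : ℕ} (Ω : Set (Eucl d)) (s σ : ℝ) (u : Eucl d → ℝ) (x : Eucl d) (v : ℝ) :
    Prop :=
  (∀ δ : ℝ, 0 < δ →
    IntegrableOn (fun y => (u x - u y) * horizonKernel Ω s σ x y) (Ω \ Metric.ball x δ)) ∧
  Tendsto (fun δ : ℝ => ∫ y in Ω \ Metric.ball x δ, (u x - u y) * horizonKernel Ω s σ x y)
    (𝓝[>] 0) (𝓝 v)

/-- The fractional Sobolev space `H^s(U)`: functions in `L²(U)` with finite Gagliardo seminorm. -/
def MemHs {d : ℕ} (U : Set (Eucl d)) (s : ℝ) (u : Eucl d → ℝ) : Prop :=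
  MemLp u 2 (volume.restrict U) ∧
  ∫⁻ x in U, ∫⁻ y in U, ENNReal.ofReal ((u x - u y) ^ 2 / ‖x - y‖ ^ ((d : ℝ) + 2 * s)) < ⊤

/-- The local space `H^s_loc(U)`: `u ψ ∈ H^s(U)` for all `ψ ∈ C_c^∞(U)`. -/
def MemHsLoc {d : ℕ} (U : Set (Eucl d)) (s : ℝ) (u : Eucl d → ℝ) : Prop :=
  ∀ ψ : Eucl d → ℝ, ContDiff ℝ ∞ ψ → HasCompactSupport ψ → tsupport ψ ⊆ U →
    MemHs U s (fun x => u x * ψ x)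

end

/-!
Write `p = 2s - 1`, `δ = d_Ω(x)` and let `φ = 2 ρ ^ p - ρ ^ (p + e)` for a small exponent `e > 0`,
where `ρ` is the distance to the complement, truncated so that it is unchanged in the unit ball and
vanishes outside the ball of radius `2` (`cutDist`; `barrierProfile` modifies the profile for
`ρ > 1`).

*Lower bound for the operator.* The profile is a strictly concave function of `t ^ p`. Subtracting
its tangent at `δ ^ p` (`barrierProfile_sub`) bounds the operator applied to `φ` from below by a
bounded nonnegative multiple of the operator applied to `d_Ω ^ p` plus a nonnegative gap. By
scaling, the gap contributes at least `c δ ^ (e - 1)`: it is of order `δ ^ (p + e)` on a ball of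
radius comparable to `δ` on the inner side of `x` (`exists_le_integral_gapTerm`). It remains to see
that the operator applied to `d_Ω ^ p` is at least `-K δ ^ (2e - 1)`, which is of lower order
(`exists_le_integral_powTerm`).

The touching balls pinch `d_Ω` at `x` around an affine function `δ + ⟨n, h⟩` up to a quadratic
error (`exists_normal_distCompl_pinched`). In polar coordinates around `x` the question becomes
one-dimensional. For the affine function the integrand on a ray has the explicit primitive
`((δ + aρ) ^ (2s) - δ ^ (2s)) ρ ^ (-2s) / (2sδ)` with `a = ⟨n, θ⟩`, where `θ` is the direction of
the ray. By convexity of the power `2s`, its value at the endpoint of the second indicator in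
direction `a` is at least minus its value at the endpoint `σδ` of the first indicator in direction
`-a` (`neg_rayPrimitive_le`). So, up to a term vanishing with the truncation radius, the integral
over the ray is bounded below by an odd function of the direction, which cancels between `θ` and
`-θ` (`le_integral_rayTerm_model`). Replacing the
affine function by `d_Ω` costs an error of lower order (`rayTerm_sub_rayError_le`); the delicate
part is the set where the indicator `ρ < σ d_Ω` differs from that of the affine function. This set
is thin: for `ρ < δ ^ (1/2)` it confines `1/ρ` to an interval of length comparable to
`δ ^ (-1/2)`, and `ρ ^ (-2) dρ` is Lebesgue measure in the variable `1/ρ`.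

*Existence of the principal value.* By the pinching, the symmetric second difference of `φ` at `x`
is quadratic, so that the symmetrized integrand is dominated by `‖h‖ ^ (2 - d - 2s)`
(`exists_hasOperatorValue`).

*Sobolev regularity.* If `ρ(y) ≤ ρ(x)` then `|φ(x) - φ(y)|` is at most a constant times
`ρ(x) ^ (p - 1) min(|x - y|, ρ(x))`. Integrating in `y` reduces the Gagliardo seminorm to the
integral of `ρ ^ (2s - 2)` (`gagliardo_lt_top`). That integral is finite since `2 - 2s < 1` and since
`d_Ω` grows at least linearly in the graph direction at the boundary
(`exists_lintegral_distCompl_rpow_lt_top`).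
-/

/-! ### Elementary inequalities for real powers -/

theorem abs_rpow_sub_rpow_le {p a b : ℝ} (hp0 : 0 < p) (hp1 : p ≤ 1) (ha : 0 ≤ a) (hb : 0 ≤ b) :
    |a ^ p - b ^ p| ≤ |a - b| ^ p := by
  wlog h : b ≤ a generalizing a b
  · rw [abs_sub_comm, abs_sub_comm a b]
    exact this hb ha (le_of_not_ge h)
  have h1 : b ^ p ≤ a ^ p := Real.rpow_le_rpow hb h hp0.le
  rw [abs_of_nonneg (by linarith), abs_of_nonneg (by linarith)]
  have := Real.rpow_add_le_add_rpow (sub_nonneg.2 h) hb hp0.le hp1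
  rw [sub_add_cancel] at this
  linarith

/-- Concave powers have slope at most `a ^ (p - 1)` below `a`. -/
theorem rpow_sub_rpow_le_mul_sub {p a b : ℝ} (hp0 : 0 ≤ p) (hp1 : p ≤ 1) (hb : 0 ≤ b)
    (ha : 0 < a) (hab : b ≤ a) : a ^ p - b ^ p ≤ a ^ (p - 1) * (a - b) := by
  have h1 : b / a ≤ (b / a) ^ p := by
    conv_lhs => rw [← Real.rpow_one (b / a)]
    exact Real.rpow_le_rpow_of_exponent_ge' (by positivity) ((div_le_one ha).2 hab) hp0 hp1
  rw [Real.div_rpow hb ha.le, div_le_div_iff₀ ha (Real.rpow_pos_of_pos ha p)] at h1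
  have h3 : a ^ (p - 1) * a = a ^ p := by
    rw [Real.rpow_sub_one ha.ne']; field_simp
  have h4 : 0 < a ^ p := Real.rpow_pos_of_pos ha p
  have h5 : a ^ (p - 1) * b ≤ b ^ p := by
    rw [Real.rpow_sub_one ha.ne', div_mul_eq_mul_div, div_le_iff₀ ha]
    linarith
  linarith [mul_sub (a ^ (p - 1)) a b]

theorem abs_rpow_sub_rpow_le_mul_abs {p a b m : ℝ} (hp0 : 0 ≤ p) (hp1 : p ≤ 1) (hm : 0 < m)
    (hma : m ≤ a) (hmb : m ≤ b) : |a ^ p - b ^ p| ≤ m ^ (p - 1) * |a - b| := by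
  wlog h : b ≤ a generalizing a b
  · rw [abs_sub_comm, abs_sub_comm a b]
    exact this hmb hma (le_of_not_ge h)
  have h1 : b ^ p ≤ a ^ p := Real.rpow_le_rpow (hm.le.trans hmb) h hp0
  rw [abs_of_nonneg (by linarith), abs_of_nonneg (by linarith : 0 ≤ a - b)]
  refine (rpow_sub_rpow_le_mul_sub hp0 hp1 (hm.le.trans hmb) (hm.trans_le hma) h).trans ?_
  exact mul_le_mul_of_nonneg_right (Real.rpow_le_rpow_of_nonpos hm hma (by linarith))
    (by linarith)

/-- Second order Taylor estimate for a concave power, obtained from Bernoulli's inequality applied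
to `(1 + z) ^ p` and to `(1 + z) ^ (p - 1)`. -/
theorem abs_one_add_rpow_sub_le {p z : ℝ} (hp0 : 0 ≤ p) (hp1 : p ≤ 1) (hz : -1 < z) :
    |(1 + z) ^ p - 1 - p * z| ≤ z ^ 2 := by
  have h1 := rpow_one_add_le_one_add_mul_self hz.le hp0 hp1
  have h0 : 0 < 1 + z := by linarith
  -- `(1 + z) ^ (1 - p) ≤ 1 + (1 - p) z`, hence `(1 + z) ^ (p - 1) ≥ 1 - (1 - p) z`
  have h2 := rpow_one_add_le_one_add_mul_self hz.le (sub_nonneg.2 hp1) (by linarith : 1 - p ≤ 1)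
  have h3 : 0 < (1 + z) ^ (1 - p) := Real.rpow_pos_of_pos h0 _
  have h4 : (1 + z) ^ p * (1 + z) ^ (1 - p) = 1 + z := by
    rw [← Real.rpow_add h0]; simp
  have h5 : 1 + p * z - z ^ 2 ≤ (1 + z) ^ p := by
    by_contra! h
    have h6 : 0 < (1 + z) ^ p := Real.rpow_pos_of_pos h0 _
    have h7 : (1 + z) ^ p * (1 + z) ^ (1 - p) < (1 + p * z - z ^ 2) * (1 + (1 - p) * z) :=
      mul_lt_mul h h2 h3 (h6.trans h).le
    have h8 : (1 + p * z - z ^ 2) * (1 + (1 - p) * z)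
        = 1 + z - z ^ 2 * (1 - p * (1 - p) + (1 - p) * z) := by ring
    have h9 : 0 ≤ 1 - p * (1 - p) + (1 - p) * z := by nlinarith
    nlinarith [mul_nonneg (sq_nonneg z) h9]
  rw [abs_le]
  constructor <;> nlinarith [sq_nonneg z]

theorem abs_rpow_sub_taylor_le {p a b : ℝ} (hp0 : 0 ≤ p) (hp1 : p ≤ 1) (ha : 0 < a) (hb : 0 < b) :
    |b ^ p - a ^ p - p * a ^ (p - 1) * (b - a)| ≤ a ^ (p - 2) * (b - a) ^ 2 := by
  have hz : -1 < (b - a) / a := by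
    rw [lt_div_iff₀ ha]; linarith
  have h := abs_one_add_rpow_sub_le hp0 hp1 hz
  have h1 : 1 + (b - a) / a = b / a := by field_simp; ring
  have hpos : 0 < a ^ p := Real.rpow_pos_of_pos ha p
  rw [h1, Real.div_rpow hb.le ha.le] at h
  have h2 : b ^ p - a ^ p - p * a ^ (p - 1) * (b - a)
      = a ^ p * (b ^ p / a ^ p - 1 - p * ((b - a) / a)) := by
    rw [Real.rpow_sub_one ha.ne']; field_simp
  have h3 : a ^ (p - 2) * (b - a) ^ 2 = a ^ p * ((b - a) / a) ^ 2 := by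
    rw [Real.rpow_sub ha, Real.rpow_two]; field_simp
  rw [h2, h3, abs_mul, abs_of_pos hpos]
  gcongr

/-- Increments of a convex power grow with the starting point. -/
theorem rpow_increment_mono {q b u v : ℝ} (hq : 1 ≤ q) (hb : 0 ≤ b) (hu : 0 ≤ u) (huv : u ≤ v) :
    (u + b) ^ q - u ^ q ≤ (v + b) ^ q - v ^ q := by
  have hmono : MonotoneOn (fun x : ℝ => (x + b) ^ q - x ^ q) (Ici 0) := by
    refine monotoneOn_of_deriv_nonneg (convex_Ici 0) ?_ ?_ ?_
    · refine ContinuousOn.sub ?_ ?_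
      · exact (by fun_prop : ContinuousOn (fun x : ℝ => x + b) (Ici 0)).rpow_const
          fun x _ => Or.inr (by linarith)
      · exact continuousOn_id.rpow_const fun x _ => Or.inr (by linarith)
    · intro x hx
      exact (((((hasDerivAt_id x).add_const b).rpow_const (Or.inr hq)).sub
        ((hasDerivAt_id x).rpow_const (Or.inr hq))).differentiableAt).differentiableWithinAt
    · intro x hx
      rw [interior_Ici] at hx
      have hx : 0 < x := hx
      have := ((((hasDerivAt_id x).add_const b).rpow_const (p := q) (Or.inr hq)).sub
        ((hasDerivAt_id x).rpow_const (p := q) (Or.inr hq))).deriv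
      simp only [id_eq] at this
      refine le_of_le_of_eq ?_ this.symm
      have : x ^ (q - 1) ≤ (x + b) ^ (q - 1) :=
        Real.rpow_le_rpow hx.le (by linarith) (by linarith)
      nlinarith
  exact hmono hu (hu.trans huv) huv

/-- The gap between a convex power `w ^ κ` and its tangent at `1` increases to the right of `1`. -/
theorem rpow_tangent_gap_mono {κ w₀ w : ℝ} (hκ : 1 ≤ κ) (hw₀ : 1 ≤ w₀) (hw : w₀ ≤ w) :
    w₀ ^ κ - 1 - κ * (w₀ - 1) ≤ w ^ κ - 1 - κ * (w - 1) := by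
  have hpos : 0 < w₀ := by linarith
  have hz : -1 ≤ (w - w₀) / w₀ := le_trans (by norm_num) (div_nonneg (by linarith) hpos.le)
  have h1 := one_add_mul_self_le_rpow_one_add hz hκ
  have h2 : 1 + (w - w₀) / w₀ = w / w₀ := by field_simp; ring
  rw [h2, Real.div_rpow (by linarith) hpos.le, le_div_iff₀ (Real.rpow_pos_of_pos hpos κ)] at h1
  have h3 : 1 ≤ w₀ ^ (κ - 1) := Real.one_le_rpow hw₀ (by linarith)
  have h4 : w₀ ^ κ = w₀ ^ (κ - 1) * w₀ := by
    rw [Real.rpow_sub_one hpos.ne']; field_simp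
  have h5 : (1 + κ * ((w - w₀) / w₀)) * w₀ ^ κ = w₀ ^ κ + κ * (w - w₀) * w₀ ^ (κ - 1) := by
    rw [h4]; field_simp
  have h6 : κ * (w - w₀) * 1 ≤ κ * (w - w₀) * w₀ ^ (κ - 1) := by
    gcongr
  linarith

theorem rpow_tangent_gap_nonneg {κ w : ℝ} (hκ : 1 ≤ κ) (hw : 0 ≤ w) :
    0 ≤ w ^ κ - 1 - κ * (w - 1) := by
  have h1 := one_add_mul_self_le_rpow_one_add (by linarith : -1 ≤ w - 1) hκ
  rw [add_sub_cancel] at h1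
  linarith

theorem rpow_tangent_gap_pos {κ w : ℝ} (hκ : 1 < κ) (hw : 1 < w) :
    0 < w ^ κ - 1 - κ * (w - 1) := by
  have h1 := one_add_mul_self_lt_rpow_one_add (by linarith : -1 ≤ w - 1) (by linarith) hκ
  rw [add_sub_cancel] at h1
  linarith

/-! ### The operator on a ray -/

noncomputable section

/-- The integrand of the operator applied to `d_Ω ^ (2s-1)` in polar coordinates around `x`, at
distance `ρ` from `x`, where `δ` and `D` are the values of `d_Ω` at `x` and at the other point. -/
def rayTerm (s σ δ D ρ : ℝ) : ℝ :=
  (δ ^ (2 * s - 1) - D ^ (2 * s - 1)) *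
    (((if ρ < σ * δ then 1 else 0) + (if ρ < σ * D then 1 else 0)) / 2) * ρ ^ (-1 - 2 * s)

/-- An explicit primitive in `ρ` of `(δ ^ (2s-1) - (δ + aρ) ^ (2s-1)) ρ ^ (-1-2s)`. -/
def rayPrimitive (s δ a ρ : ℝ) : ℝ :=
  ((δ + a * ρ) ^ (2 * s) - δ ^ (2 * s)) * ρ ^ (-(2 * s)) / (2 * s * δ)

end

theorem hasDerivAt_rayPrimitive {s δ a ρ : ℝ} (hs : 1 / 2 < s) (hδ : 0 < δ) (hρ : 0 < ρ)
    (ht : 0 ≤ δ + a * ρ) :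
    HasDerivAt (rayPrimitive s δ a)
      ((δ ^ (2 * s - 1) - (δ + a * ρ) ^ (2 * s - 1)) * ρ ^ (-1 - 2 * s)) ρ := by
  have h1 : HasDerivAt (fun ρ : ℝ => δ + a * ρ) a ρ := by
    simpa using ((hasDerivAt_id ρ).const_mul a).const_add δ
  have h2 := (h1.rpow_const (p := 2 * s) (Or.inr (by linarith))).sub_const (δ ^ (2 * s))
  have h3 := (hasDerivAt_id ρ).rpow_const (p := -(2 * s)) (Or.inl hρ.ne')
  have h4 := (h2.mul h3).div_const (2 * s * δ)
  refine h4.congr_deriv ?_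
  have e1 : (δ + a * ρ) ^ (2 * s) = (δ + a * ρ) ^ (2 * s - 1) * (δ + a * ρ) := by
    conv_rhs => rw [← Real.rpow_add_one' ht (by linarith)]
    ring_nf
  have e2 : δ ^ (2 * s) = δ ^ (2 * s - 1) * δ := by
    conv_rhs => rw [← Real.rpow_add_one hδ.ne']
    ring_nf
  have e3 : ρ ^ (-(2 * s)) = ρ ^ (-1 - 2 * s) * ρ := by
    conv_rhs => rw [← Real.rpow_add_one hρ.ne']
    ring_nf
  have e4 : (-(2 * s) - 1 : ℝ) = -1 - 2 * s := by ring
  simp only [id_eq, e4]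
  rw [e1, e2, e3]
  have : s ≠ 0 := by linarith
  field_simp
  ring

theorem continuousOn_rayModel {s δ a : ℝ} (hs : 1 / 2 < s) :
    ContinuousOn (fun ρ => (δ ^ (2 * s - 1) - (δ + a * ρ) ^ (2 * s - 1)) * ρ ^ (-1 - 2 * s))
      (Ioi 0) := by
  refine ContinuousOn.mul (ContinuousOn.sub continuousOn_const ?_) ?_
  · exact (by fun_prop : ContinuousOn (fun ρ : ℝ => δ + a * ρ) (Ioi 0)).rpow_const
      fun x _ => Or.inr (by linarith)
  · exact continuousOn_id.rpow_const fun x hx => Or.inl (ne_of_gt hx)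

theorem integral_rayModel {s δ a r R : ℝ} (hs : 1 / 2 < s) (hδ : 0 < δ) (hr : 0 < r) (hrR : r ≤ R)
    (ht : 0 ≤ δ + a * R) :
    ∫ ρ in Ioo r R, (δ ^ (2 * s - 1) - (δ + a * ρ) ^ (2 * s - 1)) * ρ ^ (-1 - 2 * s)
      = rayPrimitive s δ a R - rayPrimitive s δ a r := by
  rw [← integral_Ioc_eq_integral_Ioo, ← intervalIntegral.integral_of_le hrR]
  refine intervalIntegral.integral_eq_sub_of_hasDerivAt (fun ρ hρ => ?_) ?_
  · rw [uIcc_of_le hrR] at hρ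
    have hρ0 : 0 < ρ := hr.trans_le hρ.1
    refine hasDerivAt_rayPrimitive hs hδ hρ0 ?_
    rcases le_or_gt 0 a with ha | ha
    · positivity
    · nlinarith [hρ.2]
  · refine ContinuousOn.intervalIntegrable ((continuousOn_rayModel hs).mono fun ρ hρ => ?_)
    rw [uIcc_of_le hrR] at hρ
    exact hr.trans_le hρ.1

theorem rayPrimitive_eq {s δ a ρ : ℝ} (hδ : 0 < δ) (hρ : 0 < ρ) (ht : 0 ≤ δ + a * ρ) :
    rayPrimitive s δ a ρ = ((δ / ρ + a) ^ (2 * s) - (δ / ρ) ^ (2 * s)) / (2 * s * δ) := by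
  have h1 : δ / ρ + a = (δ + a * ρ) / ρ := by field_simp
  rw [rayPrimitive, h1, Real.div_rpow ht hρ.le, Real.div_rpow hδ.le hρ.le, Real.rpow_neg hρ.le]
  ring

/-- At the far cutoff `R` of the second indicator in direction `a`, the primitive dominates minus
the primitive at the cutoff of the first indicator in direction `-a`; this is where the reflection
symmetry of the half-line operator enters. -/
theorem neg_rayPrimitive_le {s σ δ a R : ℝ} (hs : 1 / 2 < s) (hσ : 0 < σ) (hσ1 : σ ≤ 1)
    (hδ : 0 < δ) (ha : |a| ≤ 1) (hR : 0 < R) (hRa : (1 - σ * a) * R ≤ σ * δ)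
    (hneg : a < 0 → (1 - σ * a) * R = σ * δ) :
    -rayPrimitive s δ (-a) (σ * δ) ≤ rayPrimitive s δ a R := by
  obtain ⟨ha1, ha2⟩ := abs_le.1 ha
  have hRt : 0 ≤ δ + a * R := by
    by_contra! h
    nlinarith
  have hσa : σ * a ≤ 1 := by nlinarith
  have hst : 0 ≤ δ + -a * (σ * δ) := by nlinarith
  rw [rayPrimitive_eq hδ hR hRt, rayPrimitive_eq hδ (by positivity) hst, ← neg_div]
  have hd : δ / (σ * δ) = 1 / σ := by field_simp
  rw [hd]
  have hs0 : 0 < s := by linarith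
  gcongr
  have hu : 0 ≤ 1 / σ - a := by
    rw [sub_nonneg, le_div_iff₀ hσ]; linarith
  have huv : 1 / σ - a ≤ δ / R := by
    rw [le_div_iff₀ hR, sub_mul, one_div, ← sub_nonneg]
    have : δ - (σ⁻¹ * R - a * R) = (σ * δ - (1 - σ * a) * R) / σ := by field_simp
    rw [this]
    exact div_nonneg (by linarith) hσ.le
  rcases le_or_gt 0 a with h | h
  · have := rpow_increment_mono (by linarith : 1 ≤ 2 * s) h hu huv
    rw [sub_add_cancel] at this
    rw [← sub_eq_add_neg]
    linarith
  · have : δ / R = 1 / σ - a := by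
      rw [div_eq_iff hR.ne', sub_mul]
      have := hneg h
      field_simp
      linarith
    rw [this, sub_add_cancel, ← sub_eq_add_neg]
    linarith

/-- At the truncation radius `r` the primitive has a singular part that is odd in `a`; the
remainder vanishes with `r`. -/
theorem rayPrimitive_le {s δ a r : ℝ} (hs : 1 / 2 < s) (hs1 : s < 1) (hδ : 0 < δ) (hr : 0 < r)
    (hrδ : r ≤ δ) (ha : |a| ≤ 1) :
    rayPrimitive s δ a r ≤ a * (r ^ (1 - 2 * s) * δ ^ (2 * s - 2))
      + r ^ (2 - 2 * s) * δ ^ (2 * s - 3) := by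
  obtain ⟨ha1, ha2⟩ := abs_le.1 ha
  set z := a * r / δ with hz
  have hz1 : 0 ≤ 1 + z := by
    have : 1 + z = (δ + a * r) / δ := by rw [hz]; field_simp
    rw [this]
    exact div_nonneg (by nlinarith) hδ.le
  have h1 : (1 + z) ^ (2 * s) ≤ 1 + s * (2 * z + z ^ 2) := by
    rw [Real.rpow_mul hz1, Real.rpow_two]
    have := rpow_one_add_le_one_add_mul_self (s := 2 * z + z ^ 2) (by nlinarith)
      (by linarith : 0 ≤ s) hs1.le
    convert this using 2
    ring
  have h2 : (δ + a * r) ^ (2 * s) = δ ^ (2 * s) * (1 + z) ^ (2 * s) := by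
    rw [← Real.mul_rpow hδ.le hz1, hz]
    congr 1
    field_simp
  have hs0 : 0 < s := by linarith
  have h3 : rayPrimitive s δ a r ≤ δ ^ (2 * s) * r ^ (-(2 * s)) / δ * (z + z ^ 2 / 2) := by
    rw [rayPrimitive, h2]
    have e : δ ^ (2 * s) * r ^ (-(2 * s)) / δ * (z + z ^ 2 / 2)
        = (δ ^ (2 * s) * (1 + s * (2 * z + z ^ 2)) - δ ^ (2 * s)) * r ^ (-(2 * s)) / (2 * s * δ) := by
      field_simp; ring
    rw [e]
    gcongr
  refine h3.trans ?_
  have e1 : r ^ (1 - 2 * s) = r ^ (-(2 * s)) * r := by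
    rw [← Real.rpow_add_one hr.ne']; ring_nf
  have e2 : r ^ (2 - 2 * s) = r ^ (-(2 * s)) * r ^ 2 := by
    rw [← Real.rpow_two, ← Real.rpow_add hr]; ring_nf
  have e3 : δ ^ (2 * s - 2) = δ ^ (2 * s) / δ ^ 2 := by
    rw [Real.rpow_sub hδ, Real.rpow_two]
  have e4 : δ ^ (2 * s - 3) = δ ^ (2 * s) / δ ^ 3 := by
    rw [Real.rpow_sub hδ, ← Real.rpow_natCast δ 3]; norm_num
  rw [e1, e2, e3, e4]
  have hA : 0 < δ ^ (2 * s) := Real.rpow_pos_of_pos hδ _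
  have hB : 0 < r ^ (-(2 * s)) := Real.rpow_pos_of_pos hr _
  have ha3 : a ^ 2 ≤ 1 := by nlinarith
  have e5 : δ ^ (2 * s) * r ^ (-(2 * s)) / δ * (z + z ^ 2 / 2)
      = a * (r ^ (-(2 * s)) * r * (δ ^ (2 * s) / δ ^ 2))
        + (r ^ (-(2 * s)) * r ^ 2 * (δ ^ (2 * s) / δ ^ 3)) * (a ^ 2 / 2) := by
    rw [hz]; field_simp
  rw [e5]
  have : 0 < r ^ (-(2 * s)) * r ^ 2 * (δ ^ (2 * s) / δ ^ 3) := by positivity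
  nlinarith

/-- The part of the lower bound for the half-space model that is odd in the direction `a`. -/
noncomputable def rayOdd (s σ δ r a : ℝ) : ℝ :=
  (rayPrimitive s δ a (σ * δ) - rayPrimitive s δ (-a) (σ * δ)) / 2
    - a * (r ^ (1 - 2 * s) * δ ^ (2 * s - 2))

theorem rayOdd_neg (s σ δ r a : ℝ) : rayOdd s σ δ r (-a) = -rayOdd s σ δ r a := by
  simp only [rayOdd, neg_neg]; ring

theorem integrableOn_rayModel {s δ a r R : ℝ} (hs : 1 / 2 < s) (hr : 0 < r) :
    IntegrableOn (fun ρ => (δ ^ (2 * s - 1) - (δ + a * ρ) ^ (2 * s - 1)) * ρ ^ (-1 - 2 * s))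
      (Ioo r R) :=
  (((continuousOn_rayModel hs).mono fun _ hρ => hr.trans_le hρ.1).integrableOn_Icc).mono_set
    Ioo_subset_Icc_self

theorem rayTerm_eq_indicator (s σ δ a ρ : ℝ) :
    rayTerm s σ δ (δ + a * ρ) ρ
      = (indicator {ρ | ρ < σ * δ} (fun ρ => (δ ^ (2 * s - 1) - (δ + a * ρ) ^ (2 * s - 1)) *
            ρ ^ (-1 - 2 * s)) ρ
        + indicator {ρ | ρ < σ * (δ + a * ρ)} (fun ρ => (δ ^ (2 * s - 1) -
            (δ + a * ρ) ^ (2 * s - 1)) * ρ ^ (-1 - 2 * s)) ρ) / 2 := by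
  simp only [rayTerm, indicator, mem_ofPred_eq]
  split_ifs <;> ring

/-- Lower bound for the half-space model on a ray: up to an odd part and a term vanishing with the
truncation radius `r`, the truncated operator applied to `t ^ (2s-1)` is nonnegative. -/
theorem le_integral_rayTerm_model {s σ δ a r r₁ : ℝ} (hs : 1 / 2 < s) (hs1 : s < 1) (hσ : 0 < σ)
    (hσ1 : σ ≤ 1) (hδ : 0 < δ) (ha : |a| ≤ 1) (hr : 0 < r) (hrδ : r < σ * δ / 2)
    (hr₁ : σ * δ < r₁) :
    IntegrableOn (fun ρ => rayTerm s σ δ (δ + a * ρ) ρ) (Ioo r r₁) ∧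
    rayOdd s σ δ r a - r ^ (2 - 2 * s) * δ ^ (2 * s - 3)
      ≤ ∫ ρ in Ioo r r₁, rayTerm s σ δ (δ + a * ρ) ρ := by
  obtain ⟨ha1, ha2⟩ := abs_le.1 ha
  have hσδ : 0 < σ * δ := by positivity
  have hσa : 0 ≤ 1 - σ * a := by nlinarith
  set k : ℝ → ℝ := fun ρ => (δ ^ (2 * s - 1) - (δ + a * ρ) ^ (2 * s - 1)) * ρ ^ (-1 - 2 * s)
    with hk
  have hki : IntegrableOn k (Ioo r r₁) := integrableOn_rayModel hs hr
  have hm1 : MeasurableSet {ρ : ℝ | ρ < σ * δ} := measurableSet_Iio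
  have hm2 : MeasurableSet {ρ : ℝ | ρ < σ * (δ + a * ρ)} :=
    measurableSet_lt measurable_id (by fun_prop)
  obtain ⟨R, hrR, hRr, hRa, hneg, hset⟩ : ∃ R, r ≤ R ∧ R ≤ r₁ ∧ (1 - σ * a) * R ≤ σ * δ ∧
      (a < 0 → (1 - σ * a) * R = σ * δ) ∧
      Ioo r r₁ ∩ {ρ | ρ < σ * (δ + a * ρ)} = Ioo r R := by
    rcases le_or_gt ((1 - σ * a) * r₁) (σ * δ) with h | h
    · refine ⟨r₁, by linarith, le_rfl, h, fun h' => absurd h (not_le.2 ?_), ?_⟩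
      · nlinarith [mul_pos (mul_pos hσ (neg_pos.2 h')) (by linarith : 0 < r₁)]
      refine inter_eq_left.2 fun ρ hρ => ?_
      have h0 : 0 < ρ := hr.trans hρ.1
      change ρ < σ * (δ + a * ρ)
      rcases hσa.eq_or_lt with h1 | h1
      · nlinarith
      · nlinarith [hρ.2]
    · have hpos : 0 < 1 - σ * a := by
        by_contra! h'
        nlinarith
      refine ⟨σ * δ / (1 - σ * a), ?_, ?_, le_of_eq (by field_simp), fun _ => by field_simp, ?_⟩
      · have h2 : 1 - σ * a ≤ 2 := by nlinarith
        rw [le_div_iff₀ hpos]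
        nlinarith [mul_le_mul_of_nonneg_left h2 hr.le]
      · rw [div_le_iff₀ hpos]; nlinarith
      · ext ρ
        simp only [mem_inter_iff, mem_Ioo, mem_ofPred_eq, lt_div_iff₀ hpos]
        constructor
        · rintro ⟨⟨h1, -⟩, h2⟩
          exact ⟨h1, by nlinarith⟩
        · rintro ⟨h1, h2⟩
          refine ⟨⟨h1, ?_⟩, by nlinarith⟩
          by_contra! h3
          nlinarith
  have hset1 : Ioo r r₁ ∩ {ρ | ρ < σ * δ} = Ioo r (σ * δ) := by
    ext ρ
    simp only [mem_inter_iff, mem_Ioo, mem_ofPred_eq]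
    constructor
    · rintro ⟨⟨h1, -⟩, h2⟩; exact ⟨h1, h2⟩
    · rintro ⟨h1, h2⟩; exact ⟨⟨h1, by linarith⟩, h2⟩
  have heq : (fun ρ => rayTerm s σ δ (δ + a * ρ) ρ) = fun ρ =>
      (indicator {ρ | ρ < σ * δ} k ρ + indicator {ρ | ρ < σ * (δ + a * ρ)} k ρ) / 2 :=
    funext fun ρ => rayTerm_eq_indicator s σ δ a ρ
  have hi1 := hki.indicator hm1
  have hi2 := hki.indicator hm2
  rw [heq]
  refine ⟨(hi1.add hi2).div_const 2, ?_⟩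
  have hRpos : 0 < R := hr.trans_le hrR
  have hRt : 0 ≤ δ + a * R := by
    by_contra! h
    nlinarith
  rw [integral_div, integral_add hi1 hi2, setIntegral_indicator hm1, setIntegral_indicator hm2,
    hset, hset1, hk, integral_rayModel hs hδ hr (by linarith) (by nlinarith),
    integral_rayModel hs hδ hr hrR hRt]
  have h1 := neg_rayPrimitive_le hs hσ hσ1 hδ ha hRpos hRa hneg
  have h2 := rayPrimitive_le hs hs1 hδ hr (by nlinarith) ha
  rw [rayOdd]
  linarith

/-! ### Comparison of the distance with its linearization on a ray -/

/-- In the variable `1/ρ` the measure `ρ ^ (-2) dρ` is Lebesgue measure, so that the set where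
`1/ρ` lies in an interval of length `2b` contributes at most `2b`. -/
theorem integral_rpow_neg_two_inv_window {A b : ℝ} (hA : 0 ≤ A) (hb : 0 < b) :
    IntegrableOn (fun ρ : ℝ => indicator {ρ | |1 / ρ - A| ≤ b} (fun ρ => ρ ^ (-2 : ℝ)) ρ) (Ioi 0) ∧
    ∫ ρ in Ioi (0 : ℝ), indicator {ρ | |1 / ρ - A| ≤ b} (fun ρ => ρ ^ (-2 : ℝ)) ρ ≤ 2 * b := by
  have hu : 0 < A + b := by linarith
  have hm : MeasurableSet {ρ : ℝ | |1 / ρ - A| ≤ b} :=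
    measurableSet_le (by fun_prop) measurable_const
  have hsub : Ioi 0 ∩ {ρ : ℝ | |1 / ρ - A| ≤ b} ⊆ Ici (1 / (A + b)) := by
    rintro ρ ⟨h0, h1⟩
    have h0 : 0 < ρ := h0
    have h2 := (abs_le.1 (show |1 / ρ - A| ≤ b from h1)).2
    have h3 : 1 / ρ ≤ A + b := by linarith
    rw [div_le_iff₀ h0] at h3
    rw [mem_Ici, div_le_iff₀ hu]; linarith
  have hint : ∀ c : ℝ, 0 < c → IntegrableOn (fun ρ : ℝ => ρ ^ (-2 : ℝ)) (Ioi c) :=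
    fun c hc => integrableOn_Ioi_rpow_of_lt (by norm_num) hc
  have hval : ∀ c : ℝ, 0 < c → ∫ ρ in Ioi (1 / c), ρ ^ (-2 : ℝ) = c := fun c hc => by
    rw [integral_Ioi_rpow_of_lt (by norm_num) (by positivity)]
    norm_num [Real.rpow_neg_one]
  have hI : IntegrableOn (fun ρ : ℝ => ρ ^ (-2 : ℝ)) (Ici (1 / (A + b))) :=
    (integrableOn_Ici_iff_integrableOn_Ioi enorm_ne_top).2 (hint _ (by positivity))
  constructor
  · rw [IntegrableOn, integrable_indicator_iff hm, IntegrableOn, Measure.restrict_restrict hm,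
      inter_comm]
    exact hI.mono_set hsub
  rw [setIntegral_indicator hm]
  have hnn : 0 ≤ᵐ[volume.restrict (Ici (1 / (A + b)))] fun ρ : ℝ => ρ ^ (-2 : ℝ) := by
    filter_upwards [ae_restrict_mem measurableSet_Ici] with ρ hρ
    exact Real.rpow_nonneg (le_trans (by positivity) hρ) _
  rcases le_or_gt A b with h | h
  · calc _ ≤ ∫ ρ in Ici (1 / (A + b)), ρ ^ (-2 : ℝ) :=
          setIntegral_mono_set hI hnn hsub.eventuallyLE
      _ = A + b := by rw [integral_Ici_eq_integral_Ioi, hval _ hu]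
      _ ≤ 2 * b := by linarith
  · have hl : 0 < A - b := by linarith
    have hle : 1 / (A + b) ≤ 1 / (A - b) := by
      apply one_div_le_one_div_of_le hl; linarith
    have hsub2 : Ioi 0 ∩ {ρ : ℝ | |1 / ρ - A| ≤ b} ⊆ Icc (1 / (A + b)) (1 / (A - b)) := by
      rintro ρ ⟨h0, h1⟩
      refine ⟨hsub ⟨h0, h1⟩, ?_⟩
      have h0 : 0 < ρ := h0
      have h2 := (abs_le.1 (show |1 / ρ - A| ≤ b from h1)).1
      have h3 : A - b ≤ 1 / ρ := by linarith
      rw [le_div_iff₀ h0] at h3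
      rw [le_div_iff₀ hl]; linarith
    have hIcc : Icc (1 / (A + b)) (1 / (A - b)) ⊆ Ici (1 / (A + b)) := Icc_subset_Ici_self
    have hsplit : ∫ ρ in Ioi (1 / (A + b)), ρ ^ (-2 : ℝ)
        = (∫ ρ in Ioc (1 / (A + b)) (1 / (A - b)), ρ ^ (-2 : ℝ))
          + ∫ ρ in Ioi (1 / (A - b)), ρ ^ (-2 : ℝ) := by
      rw [← setIntegral_union Ioc_disjoint_Ioi_same measurableSet_Ioi
        ((hint _ (by positivity)).mono_set Ioc_subset_Ioi_self) (hint _ (by positivity)),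
        Ioc_union_Ioi_eq_Ioi hle]
    rw [hval _ hu, hval _ hl] at hsplit
    calc _ ≤ ∫ ρ in Icc (1 / (A + b)) (1 / (A - b)), ρ ^ (-2 : ℝ) :=
          setIntegral_mono_set (hI.mono_set hIcc) (ae_restrict_of_ae_restrict_of_subset hIcc hnn)
            hsub2.eventuallyLE
      _ ≤ 2 * b := by rw [integral_Icc_eq_integral_Ioc]; linarith

noncomputable section

/-- A pointwise bound for the difference between `rayTerm` at `d_Ω` and at its linearization: the
Lipschitz regime near `x`, the Hölder regime away from `x`, and the distances `ρ` at which only one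
of the two exceeds `ρ/σ`, so that the second indicators differ. -/
def rayError (s σ δ a C₀ ρ : ℝ) : ℝ :=
  C₀ * (δ / 2) ^ (2 * s - 2) * indicator (Iio (σ * δ / 2)) (fun ρ => ρ ^ (1 - 2 * s)) ρ
  + C₀ ^ (2 * s - 1) * indicator (Ici (σ * δ / 2)) (fun ρ => ρ ^ (2 * s - 3)) ρ
  + (3 / σ) ^ (2 * s - 1) * (indicator (Ici (Real.sqrt δ)) (fun ρ => ρ ^ (-2 : ℝ)) ρ
    + indicator {ρ | |1 / ρ - (1 / σ - a) / δ| ≤ C₀ / Real.sqrt δ} (fun ρ => ρ ^ (-2 : ℝ)) ρ)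

end

theorem integral_rayError_le {s σ δ a C₀ : ℝ} (hs : 1 / 2 < s) (hs1 : s < 1) (hσ : 0 < σ)
    (hσ1 : σ ≤ 1) (hδ : 0 < δ) (ha : a ≤ 1) (hC₀ : 0 < C₀) :
    IntegrableOn (rayError s σ δ a C₀) (Ioi 0) ∧
    ∫ ρ in Ioi (0 : ℝ), rayError s σ δ a C₀ ρ
      ≤ C₀ * (δ / 2) ^ (2 * s - 2) * ((σ * δ / 2) ^ (2 - 2 * s) / (2 - 2 * s))
        + C₀ ^ (2 * s - 1) * ((σ * δ / 2) ^ (2 * s - 2) / (2 - 2 * s))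
        + (3 / σ) ^ (2 * s - 1) * (1 / Real.sqrt δ + 2 * (C₀ / Real.sqrt δ)) := by
  have hc : 0 < σ * δ / 2 := by positivity
  have hq : 0 < Real.sqrt δ := Real.sqrt_pos.2 hδ
  have hA : 0 ≤ (1 / σ - a) / δ := by
    refine div_nonneg ?_ hδ.le
    rw [sub_nonneg, le_div_iff₀ hσ]; nlinarith
  obtain ⟨i4, v4⟩ := integral_rpow_neg_two_inv_window hA (div_pos hC₀ hq)
  have hsub : ∀ c : ℝ, 0 < c → Ioi (0 : ℝ) ∩ Ici c = Ici c := fun c hc =>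
    inter_eq_right.2 fun x hx => hc.trans_le hx
  have hpow : ∀ c e : ℝ, 0 < c → e < -1 →
      IntegrableOn (indicator (Ici c) fun ρ : ℝ => ρ ^ e) (Ioi 0) ∧
      ∫ ρ in Ioi (0 : ℝ), indicator (Ici c) (fun ρ => ρ ^ e) ρ = -c ^ (e + 1) / (e + 1) := by
    intro c e hc he
    constructor
    · rw [IntegrableOn, integrable_indicator_iff measurableSet_Ici, IntegrableOn,
        Measure.restrict_restrict measurableSet_Ici, inter_comm, hsub c hc]
      exact (integrableOn_Ici_iff_integrableOn_Ioi enorm_ne_top).2 (integrableOn_Ioi_rpow_of_lt he hc)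
    · rw [setIntegral_indicator measurableSet_Ici, hsub c hc, integral_Ici_eq_integral_Ioi,
        integral_Ioi_rpow_of_lt he hc]
  obtain ⟨i2, v2⟩ := hpow (σ * δ / 2) (2 * s - 3) hc (by linarith)
  obtain ⟨i3, v3⟩ := hpow (Real.sqrt δ) (-2) hq (by norm_num)
  have hset : Ioi (0 : ℝ) ∩ Iio (σ * δ / 2) = Ioo 0 (σ * δ / 2) := rfl
  have i1 : IntegrableOn (indicator (Iio (σ * δ / 2)) fun ρ : ℝ => ρ ^ (1 - 2 * s)) (Ioi 0) := by
    rw [IntegrableOn, integrable_indicator_iff measurableSet_Iio, IntegrableOn,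
      Measure.restrict_restrict measurableSet_Iio, inter_comm, hset]
    have := (intervalIntegral.intervalIntegrable_rpow' (a := 0) (b := σ * δ / 2)
      (by linarith : -1 < 1 - 2 * s)).1
    exact this.mono_set Ioo_subset_Ioc_self
  have v1 : ∫ ρ in Ioi (0 : ℝ), indicator (Iio (σ * δ / 2)) (fun ρ => ρ ^ (1 - 2 * s)) ρ
      = (σ * δ / 2) ^ (2 - 2 * s) / (2 - 2 * s) := by
    rw [setIntegral_indicator measurableSet_Iio, hset, ← integral_Ioc_eq_integral_Ioo,
      ← intervalIntegral.integral_of_le hc.le, integral_rpow (Or.inl (by linarith)),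
      Real.zero_rpow (by linarith)]
    ring_nf
  have j1 := i1.const_mul (C₀ * (δ / 2) ^ (2 * s - 2))
  have j2 := i2.const_mul (C₀ ^ (2 * s - 1))
  have j3 := (i3.add i4).const_mul ((3 / σ) ^ (2 * s - 1))
  refine ⟨(j1.add j2).add j3, ?_⟩
  have e : ∫ ρ in Ioi (0 : ℝ), rayError s σ δ a C₀ ρ = _ :=
    (integral_add (j1.add j2) j3).trans (congrArg₂ _ ((integral_add j1 j2).trans
      (congrArg₂ _ (integral_const_mul _ _) (integral_const_mul _ _)))
      ((integral_const_mul _ _).trans (congrArg _ (integral_add i3 i4))))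
  rw [e, v1, v2, v3]
  have e2 : -(σ * δ / 2) ^ (2 * s - 3 + 1) / (2 * s - 3 + 1)
      = (σ * δ / 2) ^ (2 * s - 2) / (2 - 2 * s) := by
    rw [show 2 * s - 3 + 1 = 2 * s - 2 by ring, neg_div, ← div_neg, neg_sub]
  have e3 : -Real.sqrt δ ^ (-2 + 1 : ℝ) / (-2 + 1) = 1 / Real.sqrt δ := by
    norm_num [Real.rpow_neg_one]
  rw [e2, e3]
  gcongr

/-- The thin set: where exactly one of `D` and its linearization exceeds `ρ/σ`, the number `1/ρ`
is confined to a short interval unless `ρ` is large compared with `√δ`. -/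
theorem rpow_neg_two_le_thin {σ δ a C₀ ρ : ℝ} (hδ : 0 < δ) (hC₀ : 0 < C₀) (hρ : 0 < ρ)
    (hthin : |δ + a * ρ - ρ / σ| ≤ C₀ * ρ ^ 2) :
    ρ ^ (-2 : ℝ) ≤ indicator (Ici (Real.sqrt δ)) (fun ρ => ρ ^ (-2 : ℝ)) ρ
      + indicator {ρ | |1 / ρ - (1 / σ - a) / δ| ≤ C₀ / Real.sqrt δ} (fun ρ => ρ ^ (-2 : ℝ)) ρ := by
  have hnn : 0 ≤ ρ ^ (-2 : ℝ) := Real.rpow_nonneg hρ.le _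
  have hq : 0 < Real.sqrt δ := Real.sqrt_pos.2 hδ
  rcases le_or_gt (Real.sqrt δ) ρ with h | h
  · rw [indicator_of_mem (show ρ ∈ Ici (Real.sqrt δ) from h)]
    exact le_add_of_nonneg_right (indicator_apply_nonneg fun _ => hnn)
  · have hmem : ρ ∈ {ρ | |1 / ρ - (1 / σ - a) / δ| ≤ C₀ / Real.sqrt δ} := by
      have e : 1 / ρ - (1 / σ - a) / δ = (δ + a * ρ - ρ / σ) / (ρ * δ) := by
        field_simp; ring
      change |1 / ρ - (1 / σ - a) / δ| ≤ C₀ / Real.sqrt δ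
      rw [e, abs_div, abs_of_pos (by positivity : 0 < ρ * δ), div_le_iff₀ (by positivity)]
      refine hthin.trans ?_
      have e2 : C₀ / Real.sqrt δ * (ρ * δ) = C₀ * ρ * Real.sqrt δ := by
        have e3 : δ / Real.sqrt δ = Real.sqrt δ := Real.div_sqrt
        calc _ = C₀ * ρ * (δ / Real.sqrt δ) := by ring
          _ = _ := by rw [e3]
      rw [e2, pow_two, ← mul_assoc]
      gcongr
    rw [indicator_of_mem hmem]
    exact le_add_of_nonneg_left (indicator_apply_nonneg fun _ => hnn)

/-- Near the centre both indicators equal `1`, and both functions are at least `δ / 2`. -/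
theorem rayTerm_sub_rayError_le_near {s σ δ a C₀ ρ D : ℝ} (hs : 1 / 2 < s) (hs1 : s < 1)
    (hσ : 0 < σ) (hσ1 : σ ≤ 1) (hδ : 0 < δ) (ha : |a| ≤ 1) (hρ : 0 < ρ)
    (hDδ : |D - δ| ≤ ρ) (hE1 : δ + a * ρ - C₀ * ρ ^ 2 ≤ D)
    (hE2 : 0 < D → D ≤ δ + a * ρ + C₀ * ρ ^ 2) (hlt : ρ < σ * δ / 2) :
    rayTerm s σ δ (δ + a * ρ) ρ - rayError s σ δ a C₀ ρ ≤ rayTerm s σ δ D ρ := by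
  obtain ⟨ha1, ha2⟩ := abs_le.1 ha
  obtain ⟨hD1, hD2⟩ := abs_le.1 hDδ
  have ht1 : δ - ρ ≤ δ + a * ρ := by nlinarith
  set t := δ + a * ρ with ht
  have hw : 0 < ρ ^ (-1 - 2 * s) := Real.rpow_pos_of_pos hρ _
  have hn2 : 0 ≤ ρ ^ (-2 : ℝ) := Real.rpow_nonneg hρ.le _
  have hthird : 0 ≤ (3 / σ) ^ (2 * s - 1) *
      (indicator (Ici (Real.sqrt δ)) (fun ρ => ρ ^ (-2 : ℝ)) ρ
      + indicator {ρ | |1 / ρ - (1 / σ - a) / δ| ≤ C₀ / Real.sqrt δ}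
        (fun ρ => ρ ^ (-2 : ℝ)) ρ) := by
    refine mul_nonneg (by positivity) (add_nonneg ?_ ?_) <;>
    exact indicator_apply_nonneg fun _ => hn2
  have hρδ : ρ ≤ δ / 2 := by nlinarith
  have hDt : |D - t| ≤ C₀ * ρ ^ 2 := by
    have := hE2 (by linarith)
    rw [abs_le]; constructor <;> linarith
  have c1 : ρ < σ * δ := by linarith [mul_pos hσ hδ]
  have hm : σ * (δ / 2) ≤ σ * D := mul_le_mul_of_nonneg_left (by linarith) hσ.le
  have hm' : σ * (δ / 2) ≤ σ * t := mul_le_mul_of_nonneg_left (by linarith) hσ.le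
  have c2 : ρ < σ * D := by linarith
  have c3 : ρ < σ * t := by linarith
  have hlip := abs_rpow_sub_rpow_le_mul_abs (by linarith : 0 ≤ 2 * s - 1) (by linarith)
    (by positivity : 0 < δ / 2) (by linarith : δ / 2 ≤ D) (by linarith : δ / 2 ≤ t)
  have hexp : 2 * s - 1 - 1 = 2 * s - 2 := by ring
  rw [hexp] at hlip
  have hpos : 0 < (δ / 2) ^ (2 * s - 2) := by positivity
  have h1 : D ^ (2 * s - 1) - t ^ (2 * s - 1) ≤ (δ / 2) ^ (2 * s - 2) * (C₀ * ρ ^ 2) :=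
    (le_abs_self _).trans (hlip.trans (by gcongr))
  have e2 : ρ ^ 2 * ρ ^ (-1 - 2 * s) = ρ ^ (1 - 2 * s) := by
    rw [← Real.rpow_two, ← Real.rpow_add hρ]; ring_nf
  have herr : C₀ * (δ / 2) ^ (2 * s - 2) * ρ ^ (1 - 2 * s) ≤ rayError s σ δ a C₀ ρ := by
    rw [rayError, indicator_of_mem (show ρ ∈ Iio (σ * δ / 2) from hlt),
      indicator_of_notMem (show ρ ∉ Ici (σ * δ / 2) from not_le.2 hlt)]
    linarith
  have h2 := mul_le_mul_of_nonneg_right h1 hw.le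
  simp only [rayTerm, if_pos c1, if_pos c2, if_pos c3]
  rw [← e2] at herr
  linarith

theorem abs_rpow_sub_rpow_le_of_ge {p σ δ ρ u : ℝ} (hp0 : 0 ≤ p) (hσ : 0 < σ) (hσ1 : σ ≤ 1)
    (hδ : 0 < δ) (hρ : 0 < ρ) (hge : σ * δ / 2 ≤ ρ) (hu : 0 ≤ u) (hu2 : u ≤ δ + ρ) :
    |δ ^ p - u ^ p| ≤ (3 / σ) ^ p * ρ ^ p := by
  have hδρ : δ ≤ 2 * ρ / σ := by rw [le_div_iff₀ hσ]; linarith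
  have hσi : 1 ≤ 1 / σ := by rw [le_div_iff₀ hσ]; linarith
  have h3 : δ + ρ ≤ 3 / σ * ρ := by
    have : 2 * ρ / σ + ρ * (1 / σ) = 3 / σ * ρ := by field_simp; ring
    nlinarith
  have a1 : δ ^ p ≤ (3 / σ * ρ) ^ p := by gcongr; linarith
  have a2 : u ^ p ≤ (3 / σ * ρ) ^ p := by gcongr; linarith
  rw [Real.mul_rpow (by positivity) hρ.le] at a1 a2
  have a3 : 0 ≤ δ ^ p := by positivity
  have a4 : 0 ≤ u ^ p := by positivity
  rw [abs_le]; constructor <;> linarith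

/-- Away from the centre the Hölder continuity of `t ^ (2s-1)` suffices, except where the two
indicators differ; there the thin set estimate applies. -/
theorem rayTerm_sub_rayError_le_far {s σ δ a C₀ ρ D : ℝ} (hs : 1 / 2 < s) (hs1 : s < 1)
    (hσ : 0 < σ) (hσ1 : σ ≤ 1) (hδ : 0 < δ) (ha : |a| ≤ 1) (hC₀ : 0 < C₀) (hρ : 0 < ρ)
    (hD : 0 ≤ D) (hDδ : |D - δ| ≤ ρ) (hE1 : δ + a * ρ - C₀ * ρ ^ 2 ≤ D)
    (hE2 : 0 < D → D ≤ δ + a * ρ + C₀ * ρ ^ 2) (hge : σ * δ / 2 ≤ ρ) :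
    rayTerm s σ δ (δ + a * ρ) ρ - rayError s σ δ a C₀ ρ ≤ rayTerm s σ δ D ρ := by
  obtain ⟨ha1, ha2⟩ := abs_le.1 ha
  obtain ⟨hD1, hD2⟩ := abs_le.1 hDδ
  rw [rayError, indicator_of_notMem (show ρ ∉ Iio (σ * δ / 2) from not_lt.2 hge),
    indicator_of_mem (show ρ ∈ Ici (σ * δ / 2) from hge)]
  have ht1 : δ - ρ ≤ δ + a * ρ := by nlinarith
  have ht2 : δ + a * ρ ≤ δ + ρ := by nlinarith
  have hthin' := rpow_neg_two_le_thin (σ := σ) (a := a) hδ hC₀ hρ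
  set I := indicator (Ici (Real.sqrt δ)) (fun ρ => ρ ^ (-2 : ℝ)) ρ
    + indicator {ρ | |1 / ρ - (1 / σ - a) / δ| ≤ C₀ / Real.sqrt δ} (fun ρ => ρ ^ (-2 : ℝ)) ρ
  have hI : 0 ≤ I := by
    have hn2 : 0 ≤ ρ ^ (-2 : ℝ) := Real.rpow_nonneg hρ.le _
    exact add_nonneg (indicator_apply_nonneg fun _ => hn2) (indicator_apply_nonneg fun _ => hn2)
  generalize δ + a * ρ = t at *
  have e2 : ρ ^ (2 * (2 * s - 1)) * ρ ^ (-1 - 2 * s) = ρ ^ (2 * s - 3) := by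
    rw [← Real.rpow_add hρ]; ring_nf
  have e3 : ρ ^ (2 * s - 1) * ρ ^ (-1 - 2 * s) = ρ ^ (-2 : ℝ) := by
    rw [← Real.rpow_add hρ]; ring_nf
  simp only [rayTerm]
  rw [← e2, ← mul_assoc (C₀ ^ (2 * s - 1))]
  have hp0 : 0 < 2 * s - 1 := by linarith
  have hp1 : 2 * s - 1 ≤ 1 := by linarith
  generalize 2 * s - 1 = p at *
  have hw : 0 < ρ ^ (-1 - 2 * s) := Real.rpow_pos_of_pos hρ _
  generalize ρ ^ (-1 - 2 * s) = w at *
  have hH : 0 ≤ t → |D ^ p - t ^ p| ≤ C₀ ^ p * ρ ^ (2 * p) := fun ht0 => by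
    have hDt : |D - t| ≤ C₀ * ρ ^ 2 := by
      rcases hD.eq_or_lt with h0 | h0
      · rw [← h0] at hE1 ⊢
        rw [abs_le]; constructor <;> linarith [mul_nonneg hC₀.le (sq_nonneg ρ)]
      · have := hE2 h0
        rw [abs_le]; constructor <;> linarith
    calc _ ≤ |D - t| ^ p := abs_rpow_sub_rpow_le hp0 hp1 hD ht0
      _ ≤ (C₀ * ρ ^ 2) ^ p := by gcongr
      _ = C₀ ^ p * ρ ^ (2 * p) := by
        rw [Real.mul_rpow hC₀.le (by positivity), Real.rpow_mul hρ.le, Real.rpow_two]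
  have hC : 0 ≤ C₀ ^ p * ρ ^ (2 * p) := by positivity
  generalize C₀ ^ p * ρ ^ (2 * p) = H at *
  -- the first half of the kernel
  have hX : (δ ^ p - t ^ p) * (if ρ < σ * δ then 1 else 0)
      - (δ ^ p - D ^ p) * (if ρ < σ * δ then 1 else 0) ≤ H := by
    split_ifs with h
    · linarith [le_abs_self (D ^ p - t ^ p), hH (by nlinarith)]
    · linarith
  have hthin : |t - ρ / σ| ≤ C₀ * ρ ^ 2 → (3 / σ) ^ p * ρ ^ p * w ≤ (3 / σ) ^ p * I := by
    intro h
    rw [mul_assoc, e3]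
    exact mul_le_mul_of_nonneg_left (hthin' h) (by positivity)
  -- the second half of the kernel
  have hY : ((δ ^ p - t ^ p) * (if ρ < σ * t then 1 else 0)
      - (δ ^ p - D ^ p) * (if ρ < σ * D then 1 else 0)) * w ≤ H * w + (3 / σ) ^ p * I := by
    have hHw : 0 ≤ H * w := mul_nonneg hC hw.le
    have hσI : 0 ≤ (3 / σ) ^ p * I := mul_nonneg (by positivity) hI
    have hpos : ∀ u, ρ < σ * u → 0 ≤ u := fun u h =>
      (pos_of_mul_pos_right (hρ.trans h) hσ.le).le
    by_cases h1 : ρ < σ * t <;> by_cases h2 : ρ < σ * D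
    · rw [if_pos h1, if_pos h2]
      have : (δ ^ p - t ^ p) * 1 - (δ ^ p - D ^ p) * 1 ≤ H := by
        linarith [le_abs_self (D ^ p - t ^ p), hH (hpos t h1)]
      linarith [mul_le_mul_of_nonneg_right this hw.le]
    · rw [if_pos h1, if_neg h2]
      have h4 : ρ / σ < t := by rw [div_lt_iff₀ hσ]; linarith
      have h5 : D ≤ ρ / σ := by rw [le_div_iff₀ hσ]; linarith
      have := hthin (by rw [abs_le]; constructor <;> linarith)
      have h6 := mul_le_mul_of_nonneg_right ((le_abs_self _).trans
        (abs_rpow_sub_rpow_le_of_ge hp0.le hσ hσ1 hδ hρ hge (hpos t h1) ht2)) hw.le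
      linarith
    · rw [if_neg h1, if_pos h2]
      have h4 : ρ / σ < D := by rw [div_lt_iff₀ hσ]; linarith
      have h5 : t ≤ ρ / σ := by rw [le_div_iff₀ hσ]; linarith
      have h7 := hE2 ((div_pos hρ hσ).trans h4)
      have := hthin (by rw [abs_le]; constructor <;> linarith)
      have h6 := mul_le_mul_of_nonneg_right ((neg_abs_le (δ ^ p - D ^ p)).trans' (neg_le_neg
        (abs_rpow_sub_rpow_le_of_ge hp0.le hσ hσ1 hδ hρ hge hD (by linarith)))) hw.le
      linarith
    · rw [if_neg h1, if_neg h2]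
      simp only [mul_zero, sub_zero, zero_mul]
      linarith
  have hXw := mul_le_mul_of_nonneg_right hX hw.le
  have hσI : 0 ≤ (3 / σ) ^ p * I := mul_nonneg (by positivity) hI
  linarith

theorem rayTerm_sub_rayError_le {s σ δ a C₀ ρ D : ℝ} (hs : 1 / 2 < s) (hs1 : s < 1) (hσ : 0 < σ)
    (hσ1 : σ ≤ 1) (hδ : 0 < δ) (ha : |a| ≤ 1) (hC₀ : 0 < C₀) (hρ : 0 < ρ) (hD : 0 ≤ D)
    (hDδ : |D - δ| ≤ ρ) (hE1 : δ + a * ρ - C₀ * ρ ^ 2 ≤ D)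
    (hE2 : 0 < D → D ≤ δ + a * ρ + C₀ * ρ ^ 2) :
    rayTerm s σ δ (δ + a * ρ) ρ - rayError s σ δ a C₀ ρ ≤ rayTerm s σ δ D ρ := by
  rcases lt_or_ge ρ (σ * δ / 2) with h | h
  · exact rayTerm_sub_rayError_le_near hs hs1 hσ hσ1 hδ ha hρ hDδ hE1 hE2 h
  · exact rayTerm_sub_rayError_le_far hs hs1 hσ hσ1 hδ ha hC₀ hρ hD hDδ hE1 hE2 h

theorem measurable_rayTerm {s σ δ : ℝ} {D : ℝ → ℝ} (hD : Measurable D) :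
    Measurable fun ρ => rayTerm s σ δ (D ρ) ρ := by
  unfold rayTerm
  refine ((measurable_const.sub (hD.pow_const _)).mul (Measurable.div_const (Measurable.add ?_ ?_)
    2)).mul (measurable_id.pow_const _)
  · exact Measurable.ite (measurableSet_lt measurable_id measurable_const) measurable_const
      measurable_const
  · exact Measurable.ite (measurableSet_lt measurable_id (hD.const_mul σ)) measurable_const
      measurable_const

/-- On every ray the truncated operator applied to `d_Ω ^ (2s-1)` is bounded below by an odd
function of the direction up to the error `δ ^ (γ-1)`, which is of lower order than `δ ^ (-1)`. -/
theorem exists_rayOdd_sub_le_integral_rayTerm {s σ C₀ γ : ℝ} (hs : 1 / 2 < s) (hs1 : s < 1)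
    (hσ : 0 < σ) (hσ1 : σ ≤ 1) (hC₀ : 0 < C₀) (hγ : γ ≤ 2 * s - 1) (hγ2 : γ ≤ 1 / 2) :
    ∃ K : ℝ, 0 ≤ K ∧ ∀ δ r r₁ a : ℝ, ∀ D : ℝ → ℝ, 0 < δ → δ ≤ 1 → |a| ≤ 1 → 0 < r →
      r < σ * δ / 2 → σ * δ < r₁ → Measurable D →
      (∀ ρ, 0 < ρ → 0 ≤ D ρ ∧ |D ρ - δ| ≤ ρ ∧ δ + a * ρ - C₀ * ρ ^ 2 ≤ D ρ ∧
        (0 < D ρ → D ρ ≤ δ + a * ρ + C₀ * ρ ^ 2)) →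
      IntegrableOn (fun ρ => rayTerm s σ δ (D ρ) ρ) (Ioo r r₁) ∧
      rayOdd s σ δ r a - r ^ (2 - 2 * s) * δ ^ (2 * s - 3) - K * δ ^ (γ - 1)
        ≤ ∫ ρ in Ioo r r₁, rayTerm s σ δ (D ρ) ρ := by
  have hs2 : 0 < 2 - 2 * s := by linarith
  refine ⟨C₀ * (1 / 2) ^ (2 * s - 2) * ((σ / 2) ^ (2 - 2 * s) / (2 - 2 * s))
        + C₀ ^ (2 * s - 1) * ((σ / 2) ^ (2 * s - 2) / (2 - 2 * s))
        + (3 / σ) ^ (2 * s - 1) * (1 + 2 * C₀), by positivity, ?_⟩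
  intro δ r r₁ a D hδ hδ1 ha hr hrδ hr₁ hDm hD
  obtain ⟨i1, h1⟩ := le_integral_rayTerm_model hs hs1 hσ hσ1 hδ ha hr hrδ hr₁
  obtain ⟨i2, h2⟩ := integral_rayError_le (σ := σ) hs hs1 hσ hσ1 hδ (abs_le.1 ha).2 hC₀
  have hsub : Ioo r r₁ ⊆ Ioi 0 := fun ρ hρ => hr.trans hρ.1
  have hnn : ∀ ρ ∈ Ioi (0 : ℝ), 0 ≤ rayError s σ δ a C₀ ρ := by
    intro ρ hρ
    have h : ∀ e : ℝ, 0 ≤ ρ ^ e := fun e => Real.rpow_nonneg (le_of_lt hρ) e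
    refine add_nonneg (add_nonneg (mul_nonneg (by positivity) (indicator_apply_nonneg fun _ => h _))
      (mul_nonneg (by positivity) (indicator_apply_nonneg fun _ => h _)))
      (mul_nonneg (by positivity) (add_nonneg (indicator_apply_nonneg fun _ => h _)
        (indicator_apply_nonneg fun _ => h _)))
  have hint : IntegrableOn (fun ρ => rayTerm s σ δ (D ρ) ρ) (Ioo r r₁) := by
    refine Measure.integrableOn_of_bounded (M := (δ ^ (2 * s - 1) + (δ + r₁) ^ (2 * s - 1)) *
      r ^ (-1 - 2 * s)) (by simp) (measurable_rayTerm hDm).aestronglyMeasurable ?_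
    filter_upwards [ae_restrict_mem measurableSet_Ioo] with ρ hρ
    have hρ0 : 0 < ρ := hr.trans hρ.1
    obtain ⟨d1, d2, -⟩ := hD ρ hρ0
    have d3 := (abs_le.1 d2).2
    have d4 : D ρ ^ (2 * s - 1) ≤ (δ + r₁) ^ (2 * s - 1) :=
      Real.rpow_le_rpow d1 (by linarith [hρ.2]) (by linarith)
    have d5 : 0 ≤ D ρ ^ (2 * s - 1) := Real.rpow_nonneg d1 _
    have d6 : 0 ≤ δ ^ (2 * s - 1) := by positivity
    have d7 : |δ ^ (2 * s - 1) - D ρ ^ (2 * s - 1)|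
        ≤ δ ^ (2 * s - 1) + (δ + r₁) ^ (2 * s - 1) := by
      rw [abs_le]; constructor <;> linarith
    have d8 : ρ ^ (-1 - 2 * s) ≤ r ^ (-1 - 2 * s) :=
      Real.rpow_le_rpow_of_nonpos hr hρ.1.le (by linarith)
    have d9 : |((if ρ < σ * δ then 1 else 0) + (if ρ < σ * D ρ then 1 else 0)) / 2| ≤ (1 : ℝ) := by
      split_ifs <;> norm_num
    rw [rayTerm, Real.norm_eq_abs, abs_mul, abs_mul,
      abs_of_nonneg (Real.rpow_nonneg hρ0.le _ : 0 ≤ ρ ^ (-1 - 2 * s))]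
    have d10 : 0 ≤ δ ^ (2 * s - 1) + (δ + r₁) ^ (2 * s - 1) := (abs_nonneg _).trans d7
    have d11 := mul_le_mul d7 d9 (abs_nonneg _) d10
    rw [mul_one] at d11
    exact mul_le_mul d11 d8 (Real.rpow_nonneg hρ0.le _) d10
  refine ⟨hint, ?_⟩
  have h3 : ∫ ρ in Ioo r r₁, (rayTerm s σ δ (δ + a * ρ) ρ - rayError s σ δ a C₀ ρ)
      ≤ ∫ ρ in Ioo r r₁, rayTerm s σ δ (D ρ) ρ := by
    refine setIntegral_mono_on (i1.sub (i2.mono_set hsub)) hint measurableSet_Ioo fun ρ hρ => ?_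
    obtain ⟨d1, d2, d3, d4⟩ := hD ρ (hsub hρ)
    exact rayTerm_sub_rayError_le hs hs1 hσ hσ1 hδ ha hC₀ (hsub hρ) d1 d2 d3 d4
  rw [integral_sub i1 (i2.mono_set hsub)] at h3
  have h4 : ∫ ρ in Ioo r r₁, rayError s σ δ a C₀ ρ ≤ ∫ ρ in Ioi 0, rayError s σ δ a C₀ ρ :=
    setIntegral_mono_set i2 ((ae_restrict_mem measurableSet_Ioi).mono hnn) hsub.eventuallyLE
  have pw : ∀ e : ℝ, γ - 1 ≤ e → δ ^ e ≤ δ ^ (γ - 1) := fun e he =>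
    Real.rpow_le_rpow_of_exponent_ge hδ hδ1 he
  have e1 : C₀ * (δ / 2) ^ (2 * s - 2) * ((σ * δ / 2) ^ (2 - 2 * s) / (2 - 2 * s))
      ≤ C₀ * (1 / 2) ^ (2 * s - 2) * ((σ / 2) ^ (2 - 2 * s) / (2 - 2 * s)) * δ ^ (γ - 1) := by
    have a1 : (δ / 2) ^ (2 * s - 2) = (1 / 2) ^ (2 * s - 2) * δ ^ (2 * s - 2) := by
      rw [← Real.mul_rpow (by norm_num) hδ.le]; ring_nf
    have a2 : (σ * δ / 2) ^ (2 - 2 * s) = (σ / 2) ^ (2 - 2 * s) * δ ^ (2 - 2 * s) := by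
      rw [← Real.mul_rpow (by positivity) hδ.le]; ring_nf
    have a3 : δ ^ (2 * s - 2) * δ ^ (2 - 2 * s) = δ ^ (0 : ℝ) := by
      rw [← Real.rpow_add hδ]; ring_nf
    rw [a1, a2]
    calc _ = C₀ * (1 / 2) ^ (2 * s - 2) * ((σ / 2) ^ (2 - 2 * s) / (2 - 2 * s))
          * (δ ^ (2 * s - 2) * δ ^ (2 - 2 * s)) := by ring
      _ ≤ _ := by
        rw [a3]
        exact mul_le_mul_of_nonneg_left (pw 0 (by linarith)) (by positivity)
  have e2 : C₀ ^ (2 * s - 1) * ((σ * δ / 2) ^ (2 * s - 2) / (2 - 2 * s))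
      ≤ C₀ ^ (2 * s - 1) * ((σ / 2) ^ (2 * s - 2) / (2 - 2 * s)) * δ ^ (γ - 1) := by
    have a2 : (σ * δ / 2) ^ (2 * s - 2) = (σ / 2) ^ (2 * s - 2) * δ ^ (2 * s - 2) := by
      rw [← Real.mul_rpow (by positivity) hδ.le]; ring_nf
    rw [a2]
    calc _ = C₀ ^ (2 * s - 1) * ((σ / 2) ^ (2 * s - 2) / (2 - 2 * s)) * δ ^ (2 * s - 2) := by ring
      _ ≤ _ := mul_le_mul_of_nonneg_left (pw _ (by linarith)) (by positivity)
  have e3 : (3 / σ) ^ (2 * s - 1) * (1 / Real.sqrt δ + 2 * (C₀ / Real.sqrt δ))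
      ≤ (3 / σ) ^ (2 * s - 1) * (1 + 2 * C₀) * δ ^ (γ - 1) := by
    have a1 : 1 / Real.sqrt δ = δ ^ (-(1 / 2) : ℝ) := by
      rw [Real.sqrt_eq_rpow, Real.rpow_neg hδ.le, one_div]
    calc _ = (3 / σ) ^ (2 * s - 1) * (1 + 2 * C₀) * (1 / Real.sqrt δ) := by ring
      _ ≤ _ := by
        rw [a1]
        exact mul_le_mul_of_nonneg_left (pw _ (by linarith)) (by positivity)
  linarith

/-! ### Integration in polar coordinates -/

/-- A lower bound for the integral of `f` on every ray gives a lower bound for the integral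
of `f`. -/
theorem neg_mul_le_integral_of_ray {d : ℕ} (hd : 1 ≤ d) {f : Eucl d → ℝ} {m : ℝ}
    (hf : Integrable f) (hm : ∀ e : Eucl d, ‖e‖ = 1 →
      -m ≤ ∫ ρ in Ioi (0 : ℝ), ρ ^ (d - 1) * f (ρ • e)) :
    -(m * (volume : Measure (Eucl d)).toSphere.real univ) ≤ ∫ h, f h := by
  have : Nonempty (Fin d) := ⟨⟨0, hd⟩⟩
  have hdim : Module.finrank ℝ (Eucl d) = d := by simp
  set μ : Measure (Eucl d) := volume
  have hmp := μ.measurePreserving_homeomorphUnitSphereProd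
  rw [hdim] at hmp
  set g : Metric.sphere (0 : Eucl d) 1 × Ioi (0 : ℝ) → ℝ := fun q => f ((q.2 : ℝ) • (q.1 : Eucl d))
    with hg
  have hcomp : (fun h : ({0}ᶜ : Set (Eucl d)) => g (homeomorphUnitSphereProd (Eucl d) h))
      = fun h : ({0}ᶜ : Set (Eucl d)) => f h := by
    funext h
    have h0 : ‖(h : Eucl d)‖ ≠ 0 := norm_ne_zero_iff.2 h.2
    simp [hg, smul_smul, h0]
  have e1 : ∫ h, f h = ∫ q, g q ∂(μ.toSphere.prod (.volumeIoiPow (d - 1))) := by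
    rw [← hmp.integral_comp (Homeomorph.measurableEmbedding _), hcomp,
      integral_subtype_comap (measurableSet_singleton _).compl f, restrict_compl_singleton]
  have hgi : Integrable g (μ.toSphere.prod (.volumeIoiPow (d - 1))) := by
    rw [← hmp.integrable_comp_emb (Homeomorph.measurableEmbedding _)]
    have : IntegrableOn f ({0}ᶜ : Set (Eucl d)) μ := hf.integrableOn
    rw [integrableOn_iff_comap_subtypeVal (measurableSet_singleton _).compl] at this
    change Integrable (fun h => g (homeomorphUnitSphereProd (Eucl d) h)) _
    rw [hcomp]
    exact this
  rw [e1, integral_prod _ hgi]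
  have e2 : ∀ e : Metric.sphere (0 : Eucl d) 1,
      -m ≤ ∫ ρ, g (e, ρ) ∂(Measure.volumeIoiPow (d - 1)) := by
    intro e
    have := hm e (by simp)
    simp only [Measure.volumeIoiPow, ENNReal.ofReal]
    rw [integral_withDensity_eq_integral_smul (by fun_prop),
      integral_subtype_comap measurableSet_Ioi
        fun a : ℝ => Real.toNNReal (a ^ (d - 1)) • f (a • (e : Eucl d))]
    refine this.trans_eq (setIntegral_congr_fun measurableSet_Ioi fun ρ hρ => ?_)
    rw [NNReal.smul_def, Real.coe_toNNReal _ (pow_nonneg (le_of_lt hρ) _), smul_eq_mul]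
  calc _ = ∫ _e : Metric.sphere (0 : Eucl d) 1, -m ∂μ.toSphere := by
        rw [integral_const, smul_eq_mul]; ring
    _ ≤ _ := integral_mono (integrable_const _) hgi.integral_prod_left e2

/-! ### The distance function near a boundary point with touching balls -/

theorem distCompl_nonneg {d : ℕ} (Ω : Set (Eucl d)) (x : Eucl d) : 0 ≤ distCompl Ω x :=
  Metric.infDist_nonneg

theorem abs_distCompl_sub_le {d : ℕ} (Ω : Set (Eucl d)) (x y : Eucl d) :
    |distCompl Ω x - distCompl Ω y| ≤ ‖x - y‖ := by
  have := (Metric.lipschitz_infDist_pt Ωᶜ).dist_le_mul x y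
  rwa [Real.dist_eq, dist_eq_norm, NNReal.coe_one, one_mul] at this

theorem continuous_distCompl {d : ℕ} (Ω : Set (Eucl d)) : Continuous (distCompl Ω) :=
  Metric.continuous_infDist_pt _

theorem distCompl_eq_zero {d : ℕ} {Ω : Set (Eucl d)} {x : Eucl d} (hx : x ∉ Ω) :
    distCompl Ω x = 0 := Metric.infDist_zero_of_mem hx

theorem distCompl_pos_iff {d : ℕ} {Ω : Set (Eucl d)} (hΩ : IsOpen Ω) (hne : Ω ≠ univ)
    {x : Eucl d} : 0 < distCompl Ω x ↔ x ∈ Ω := by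
  have h := hΩ.isClosed_compl.notMem_iff_infDist_pos (nonempty_compl.2 hne) (x := x)
  rw [distCompl, ← h, notMem_compl_iff]

theorem distCompl_add_le_of_ball_subset_compl {d : ℕ} {Ω : Set (Eucl d)} (hΩ : IsOpen Ω)
    {c y : Eucl d} {r : ℝ} (hr : 0 < r) (hball : Metric.ball c r ⊆ Ωᶜ) (hy : r ≤ dist y c) :
    distCompl Ω y + r ≤ dist y c := by
  have hcl : Metric.closedBall c r ⊆ Ωᶜ := by
    rw [← closure_ball c hr.ne']
    exact closure_minimal hball hΩ.isClosed_compl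
  rcases (Metric.infDist_nonneg (x := y) (s := Ωᶜ)).eq_or_lt with h | h
  · change Metric.infDist y Ωᶜ + r ≤ _
    linarith
  · have hdisj : Disjoint (Metric.ball y (distCompl Ω y)) (Metric.ball c r) :=
      disjoint_left.2 fun w hw hw' => (Metric.disjoint_ball_infDist (x := y) (s := Ωᶜ)).le_bot
        ⟨hw, hball hw'⟩
    exact (disjoint_ball_ball_iff h hr).1 hdisj

theorem sub_le_distCompl_of_ball_subset {d : ℕ} {Ω : Set (Eucl d)} (hne : Ω ≠ univ)
    {c y : Eucl d} {r : ℝ} (hball : Metric.ball c r ⊆ Ω) :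
    r - dist y c ≤ distCompl Ω y := by
  refine (Metric.le_infDist (nonempty_compl.2 hne)).2 fun w hw => ?_
  by_contra! h
  refine hw (hball ?_)
  rw [Metric.mem_ball]
  linarith [dist_triangle w y c, dist_comm w y]

/-- If two consecutive segments realize the distance of their endpoints, they are aligned. -/
theorem eq_smul_of_add_le_norm {E : Type*} [NormedAddCommGroup E] [InnerProductSpace ℝ E]
    {n v : E} {δ r : ℝ} (hδ : 0 < δ) (hn : ‖n‖ = 1) (hv : ‖v‖ = r)
    (h : δ + r ≤ ‖δ • n + v‖) : v = r • n := by
  have h1 : ‖δ • n‖ = δ := by rw [norm_smul, hn, Real.norm_of_nonneg hδ.le, mul_one]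
  have h2 : ‖δ • n + v‖ = ‖δ • n‖ + ‖v‖ :=
    le_antisymm (norm_add_le _ _) (by rw [h1, hv]; exact h)
  have h3 := (sameRay_iff_norm_add.2 h2).norm_smul_eq
  rw [h1, hv, smul_comm] at h3
  exact smul_right_injective E hδ.ne' h3

theorem norm_add_smul_le {E : Type*} [NormedAddCommGroup E] [InnerProductSpace ℝ E]
    {n : E} (hn : ‖n‖ = 1) {A : ℝ} (hA : 0 < A) (h : E) :
    ‖h + A • n‖ ≤ A + inner ℝ n h + ‖h‖ ^ 2 / (2 * A) := by
  have e : ‖h + A • n‖ ^ 2 = A ^ 2 + 2 * A * inner ℝ n h + ‖h‖ ^ 2 := by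
    rw [norm_add_sq_real, inner_smul_right, real_inner_comm, norm_smul, hn, mul_one,
      Real.norm_of_nonneg hA.le]
    ring
  have hsq : ‖h‖ ^ 2 = 2 * A * (‖h‖ ^ 2 / (2 * A)) := by field_simp
  set q := ‖h‖ ^ 2 / (2 * A)
  nlinarith [sq_nonneg (‖h + A • n‖ - A)]

/-- Touching balls of radius `r₀` on both sides pinch the distance function quadratically around
its linearization: it lies below the distance to the exterior ball and above `r₀` minus the
distance to the centre of the interior ball, and both bounds are tangent at `x`.
The upper bound fails in the exterior ball, where the linearization is negative. -/
theorem exists_normal_distCompl_pinched {d : ℕ} {Ω : Set (Eucl d)} (hΩ : IsOpen Ω)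
    (hne : Ω ≠ univ) {r₀ : ℝ} (hr₀ : 0 < r₀) (hball : TwoSidedBallCondition Ω r₀)
    {x : Eucl d} (hx : ‖x‖ < 4 / 5) (hδ : 0 < distCompl Ω x) (hδ1 : distCompl Ω x < 1 / 5)
    (hδr : distCompl Ω x ≤ r₀ / 2) :
    ∃ n : Eucl d, ‖n‖ = 1 ∧ ∀ h : Eucl d,
      distCompl Ω x + inner ℝ n h - 1 / r₀ * ‖h‖ ^ 2 ≤ distCompl Ω (x + h) ∧
      (0 < distCompl Ω (x + h) →
        distCompl Ω (x + h) ≤ distCompl Ω x + inner ℝ n h + 1 / r₀ * ‖h‖ ^ 2) := by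
  set δ := distCompl Ω x with hδdef
  have hcne : (Ωᶜ).Nonempty := nonempty_compl.2 hne
  obtain ⟨z, hz, hzd⟩ := hΩ.isClosed_compl.exists_infDist_eq_dist hcne x
  change δ = dist x z at hzd
  have hxz : ‖x - z‖ = δ := by rw [hzd, dist_eq_norm]
  have hballx : Metric.ball x δ ⊆ Ω := by
    intro w hw
    by_contra h
    exact (Metric.disjoint_ball_infDist (x := x) (s := Ωᶜ)).le_bot ⟨hw, h⟩
  have hzcl : z ∈ closure Ω := by
    have : z ∈ Metric.closedBall x δ := by rw [Metric.mem_closedBall, dist_comm, hzd]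
    rw [← closure_ball x hδ.ne'] at this
    exact closure_mono hballx this
  have hzf : z ∈ frontier Ω := by
    rw [hΩ.frontier_eq]; exact ⟨hzcl, hz⟩
  have hz1 : z ∈ Metric.ball (0 : Eucl d) 1 := by
    rw [mem_ball_zero_iff]
    have := norm_sub_norm_le z x
    rw [norm_sub_rev] at this
    linarith
  obtain ⟨⟨ci, hci, hciΩ⟩, ⟨ce, hce, hceΩ⟩⟩ := hball z ⟨hzf, hz1⟩
  set n : Eucl d := δ⁻¹ • (x - z) with hn
  have hn1 : ‖n‖ = 1 := by
    rw [hn, norm_smul, hxz, Real.norm_of_nonneg (by positivity), inv_mul_cancel₀ hδ.ne']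
  have hxzn : x - z = δ • n := by rw [hn, smul_smul, mul_inv_cancel₀ hδ.ne', one_smul]
  have hce' : z - ce = r₀ • n := by
    refine eq_smul_of_add_le_norm hδ hn1 (by rw [← dist_eq_norm, dist_comm, hce]) ?_
    rw [← hxzn, sub_add_sub_cancel, ← dist_eq_norm]
    refine (disjoint_ball_ball_iff hδ hr₀).1 (disjoint_left.2 fun w hw hw' => ?_)
    exact hceΩ hw' (hballx hw)
  have hci' : ci - z = r₀ • n := by
    refine eq_smul_of_add_le_norm hr₀ hn1 (by rw [← dist_eq_norm, hci]) ?_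
    rw [← hce', add_comm (z - ce), sub_add_sub_cancel, ← dist_eq_norm]
    refine (disjoint_ball_ball_iff hr₀ hr₀).1 (disjoint_left.2 fun w hw hw' => ?_)
    exact hceΩ hw' (hciΩ hw)
  refine ⟨n, hn1, fun h => ?_⟩
  have hsq : 0 ≤ ‖h‖ ^ 2 := by positivity
  have hB : 0 < r₀ - δ := by linarith
  constructor
  · have h1 := sub_le_distCompl_of_ball_subset (y := x + h) hne hciΩ
    have e : x + h - ci = -(-h + (r₀ - δ) • n) := by
      have : x + h - ci = h + (x - z) - (ci - z) := by abel
      rw [this, hxzn, hci', sub_smul]; abel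
    rw [dist_eq_norm, e, norm_neg] at h1
    have h2 := norm_add_smul_le hn1 hB (-h)
    rw [inner_neg_right, norm_neg] at h2
    have h3 : ‖h‖ ^ 2 / (2 * (r₀ - δ)) ≤ 1 / r₀ * ‖h‖ ^ 2 := by
      rw [one_div_mul_eq_div]
      gcongr
      linarith
    linarith
  · intro hpos
    have e : x + h - ce = h + (δ + r₀) • n := by
      have : x + h - ce = h + (x - z) + (z - ce) := by abel
      rw [this, hxzn, hce', add_smul]; abel
    have h2 := norm_add_smul_le hn1 (by linarith : 0 < δ + r₀) h
    have h3 : ‖h‖ ^ 2 / (2 * (δ + r₀)) ≤ 1 / r₀ * ‖h‖ ^ 2 := by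
      rw [one_div_mul_eq_div]
      gcongr
      linarith
    have h4 : distCompl Ω (x + h) + r₀ ≤ dist (x + h) ce := by
      refine distCompl_add_le_of_ball_subset_compl hΩ hr₀ hceΩ ?_
      by_contra! h5
      exact hpos.ne' (distCompl_eq_zero (hceΩ h5))
    rw [dist_eq_norm, e] at h4
    linarith

/-! ### Existence of the principal value -/

theorem integrable_radial {d : ℕ} (hd : 1 ≤ d) {f : ℝ → ℝ}
    (hf : IntegrableOn (fun ρ : ℝ => ρ ^ (d - 1) * f ρ) (Ioi 0)) :
    Integrable fun h : Eucl d => f ‖h‖ := by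
  have : Nonempty (Fin d) := ⟨⟨0, hd⟩⟩
  rw [integrable_fun_norm_addHaar (volume : Measure (Eucl d))]
  simpa using hf

theorem pow_mul_rpow_sub {d : ℕ} (hd : 1 ≤ d) {ρ : ℝ} (hρ : 0 < ρ) (e : ℝ) :
    ρ ^ (d - 1) * ρ ^ (-(d : ℝ) + e) = ρ ^ (e - 1) := by
  rw [← Real.rpow_natCast, ← Real.rpow_add hρ, Nat.cast_sub hd]
  congr 1
  push_cast
  ring

theorem integrable_indicator_norm_rpow_far {d : ℕ} (hd : 1 ≤ d) {s r : ℝ} (hs : 0 < s)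
    (hr : 0 < r) :
    Integrable fun h : Eucl d => indicator (Ici r) (fun ρ => ρ ^ (-(d : ℝ) - 2 * s)) ‖h‖ := by
  refine integrable_radial hd ?_
  have h1 : IntegrableOn (fun ρ : ℝ => ρ ^ (-2 * s - 1)) (Ici r) :=
    (integrableOn_Ici_iff_integrableOn_Ioi enorm_ne_top).2
      (integrableOn_Ioi_rpow_of_lt (by linarith) hr)
  refine ((h1.integrable_indicator measurableSet_Ici).integrableOn (s := Ioi 0)).congr_fun
    (fun ρ hρ => ?_) measurableSet_Ioi
  by_cases h : ρ ∈ Ici r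
  · simp only [indicator_of_mem h]
    rw [← pow_mul_rpow_sub hd hρ (-2 * s)]
    ring_nf
  · simp [indicator_of_notMem h]

theorem integrable_indicator_norm_rpow_near {d : ℕ} (hd : 1 ≤ d) {s : ℝ} (hs1 : s < 1) (r : ℝ) :
    Integrable fun h : Eucl d => indicator (Iio r) (fun ρ => ρ ^ (-(d : ℝ) + (2 - 2 * s))) ‖h‖ := by
  refine integrable_radial hd ?_
  have h1 : IntegrableOn (fun ρ : ℝ => ρ ^ (2 - 2 * s - 1)) (Ioo 0 r) :=
    (intervalIntegral.intervalIntegrable_rpow' (a := 0) (b := r)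
      (by linarith : -1 < 2 - 2 * s - 1)).1.mono_set Ioo_subset_Ioc_self
  refine ((h1.integrable_indicator measurableSet_Ioo).integrableOn (s := Ioi 0)).congr_fun
    (fun ρ hρ => ?_) measurableSet_Ioi
  by_cases h : ρ < r
  · simp only [indicator_of_mem (show ρ ∈ Ioo 0 r from ⟨hρ, h⟩),
      indicator_of_mem (show ρ ∈ Iio r from h)]
    rw [pow_mul_rpow_sub hd hρ]
  · simp [indicator_of_notMem (show ρ ∉ Ioo 0 r from fun h' => h h'.2),
      indicator_of_notMem (show ρ ∉ Iio r from h)]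

theorem integrableOn_of_le_norm_rpow {d : ℕ} (hd : 1 ≤ d) {s r M : ℝ} (hs : 0 < s) (hr : 0 < r)
    {f : Eucl d → ℝ} {A : Set (Eucl d)} (hA : MeasurableSet A) (hAr : ∀ h ∈ A, r ≤ ‖h‖)
    (hf : Measurable f) (hM : ∀ h ∈ A, |f h| ≤ M * ‖h‖ ^ (-(d : ℝ) - 2 * s)) :
    IntegrableOn f A := by
  refine ((integrable_indicator_norm_rpow_far hd hs hr).const_mul M).integrableOn.mono'
    hf.aestronglyMeasurable ?_
  filter_upwards [ae_restrict_mem hA] with h hh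
  rw [indicator_of_mem (show ‖h‖ ∈ Ici r from hAr h hh)]
  exact hM h hh

theorem setIntegral_compl_ball_neg {d : ℕ} (f : Eucl d → ℝ) (r : ℝ) :
    ∫ h in (Metric.ball 0 r)ᶜ, f (-h) = ∫ h in (Metric.ball 0 r)ᶜ, f h := by
  have hm : MeasurableSet (Metric.ball (0 : Eucl d) r)ᶜ := measurableSet_ball.compl
  rw [← integral_indicator hm, ← integral_indicator hm, ← integral_neg_eq_self]
  congr 1
  funext h
  by_cases hh : ‖h‖ < r <;> simp [indicator, hh]

/-- If the even part of `f` is `O(‖h‖ ^ (2-d-2s))` at the origin, the principal value of the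
integral of `f` exists: by symmetry `f` can be replaced by its even part, which is integrable. -/
theorem exists_tendsto_integral_compl_ball {d : ℕ} (hd : 1 ≤ d) {s r₂ M M₁ : ℝ} (hs : 0 < s)
    (hs1 : s < 1) (hr₂ : 0 < r₂) {f : Eucl d → ℝ} (hf : Measurable f)
    (hM : ∀ h, |f h| ≤ M * ‖h‖ ^ (-(d : ℝ) - 2 * s))
    (hM₁ : ∀ h, ‖h‖ < r₂ → |f h + f (-h)| ≤ M₁ * ‖h‖ ^ (-(d : ℝ) + (2 - 2 * s))) :
    ∃ v, Tendsto (fun r => ∫ h in (Metric.ball 0 r)ᶜ, f h) (𝓝[>] 0) (𝓝 v) := by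
  have hmeas : ∀ r, MeasurableSet (Metric.ball (0 : Eucl d) r)ᶜ :=
    fun r => measurableSet_ball.compl
  have hint : ∀ r, 0 < r → IntegrableOn f (Metric.ball 0 r)ᶜ := fun r hr =>
    integrableOn_of_le_norm_rpow hd hs hr (hmeas r) (fun h hh => by simpa using hh) hf
      fun h _ => hM h
  have hfn : Measurable fun h => f (-h) := hf.comp measurable_neg
  have hintn : ∀ r, 0 < r → IntegrableOn (fun h => f (-h)) (Metric.ball 0 r)ᶜ := fun r hr =>
    integrableOn_of_le_norm_rpow hd hs hr (hmeas r) (fun h hh => by simpa using hh) hfn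
      fun h _ => by simpa using hM (-h)
  set S : Eucl d → ℝ := fun h => (f h + f (-h)) / 2 with hS
  have hSm : Measurable S := (hf.add hfn).div_const 2
  have heq : ∀ r, 0 < r → ∫ h in (Metric.ball 0 r)ᶜ, f h = ∫ h in (Metric.ball 0 r)ᶜ, S h := by
    intro r hr
    rw [hS, integral_div, integral_add (hint r hr) (hintn r hr), setIntegral_compl_ball_neg]
    ring
  have hdom := ((integrable_indicator_norm_rpow_near hd hs1 r₂).const_mul M₁).add
    ((integrable_indicator_norm_rpow_far hd hs hr₂).const_mul M)
  refine ⟨∫ h, S h, ?_⟩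
  have hlim : Tendsto (fun r => ∫ h, indicator (Metric.ball 0 r)ᶜ S h) (𝓝[>] (0 : ℝ))
      (𝓝 (∫ h, S h)) := by
    refine tendsto_integral_filter_of_dominated_convergence _
      (Eventually.of_forall fun r => (hSm.indicator (hmeas r)).aestronglyMeasurable)
      (Eventually.of_forall fun r => Eventually.of_forall fun h => ?_) hdom ?_
    · refine (norm_indicator_le_norm_self _ _).trans ?_
      rw [hS, Real.norm_eq_abs, abs_div, abs_two]
      simp only [Pi.add_apply]
      have h0 : 0 ≤ |f h + f (-h)| := abs_nonneg _
      rcases lt_or_ge ‖h‖ r₂ with hh | hh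
      · rw [indicator_of_mem (show ‖h‖ ∈ Iio r₂ from hh),
          indicator_of_notMem (show ‖h‖ ∉ Ici r₂ from not_le.2 hh)]
        linarith [hM₁ h hh]
      · rw [indicator_of_notMem (show ‖h‖ ∉ Iio r₂ from not_lt.2 hh),
          indicator_of_mem (show ‖h‖ ∈ Ici r₂ from hh)]
        have h1 := hM h
        have h2 := hM (-h)
        rw [norm_neg] at h2
        linarith [abs_add_le (f h) (f (-h))]
    · have : ∀ᵐ h : Eucl d, h ≠ 0 := by
        have : Nonempty (Fin d) := ⟨⟨0, hd⟩⟩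
        exact Measure.ae_ne _ 0
      filter_upwards [this] with h hh
      refine tendsto_const_nhds.congr' ?_
      filter_upwards [Ioo_mem_nhdsGT (norm_pos_iff.2 hh)] with r hr
      rw [indicator_of_mem]
      simpa using hr.2.le
  refine hlim.congr' ?_
  filter_upwards [self_mem_nhdsWithin] with r hr
  rw [integral_indicator (hmeas r), heq r hr]

theorem horizonKernel_add {d : ℕ} (Ω : Set (Eucl d)) (s σ : ℝ) (x h : Eucl d) :
    horizonKernel Ω s σ x (x + h) = ‖h‖ ^ (-(d : ℝ) - 2 * s) *
      (((if ‖h‖ < σ * distCompl Ω x then 1 else 0) +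
        (if ‖h‖ < σ * distCompl Ω (x + h) then 1 else 0)) / 2) := by
  simp [horizonKernel, dist_eq_norm]

theorem horizonKernel_add_nonneg {d : ℕ} (Ω : Set (Eucl d)) (s σ : ℝ) (x h : Eucl d) :
    0 ≤ horizonKernel Ω s σ x (x + h) := by
  rw [horizonKernel_add]
  have : 0 ≤ ‖h‖ ^ (-(d : ℝ) - 2 * s) := by positivity
  split_ifs <;> nlinarith

theorem horizonKernel_add_le {d : ℕ} (Ω : Set (Eucl d)) (s σ : ℝ) (x h : Eucl d) :
    horizonKernel Ω s σ x (x + h) ≤ ‖h‖ ^ (-(d : ℝ) - 2 * s) := by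
  rw [horizonKernel_add]
  have : 0 ≤ ‖h‖ ^ (-(d : ℝ) - 2 * s) := by positivity
  split_ifs <;> nlinarith

/-- The horizon of a point of `Ω` is contained in `Ω`. -/
theorem horizonKernel_add_eq_zero {d : ℕ} {Ω : Set (Eucl d)} {s σ : ℝ} (hσ1 : σ ≤ 1)
    {x h : Eucl d} (hx : x + h ∉ Ω) : horizonKernel Ω s σ x (x + h) = 0 := by
  have h0 := distCompl_eq_zero hx
  have h1 := abs_le.1 (abs_distCompl_sub_le Ω x (x + h))
  rw [h0, sub_add_cancel_left, norm_neg, sub_zero] at h1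
  have h2 : ¬ ‖h‖ < σ * distCompl Ω x := by
    nlinarith [distCompl_nonneg Ω x]
  rw [horizonKernel_add, h0, if_neg h2, if_neg (by simp)]
  simp

theorem measurable_horizonKernel_add {d : ℕ} (Ω : Set (Eucl d)) (s σ : ℝ) (x : Eucl d) :
    Measurable fun h => horizonKernel Ω s σ x (x + h) := by
  simp only [horizonKernel_add]
  have hD : Measurable fun h => distCompl Ω (x + h) :=
    ((continuous_distCompl Ω).comp (continuous_const.add continuous_id)).measurable
  refine (measurable_norm.pow_const _).mul (Measurable.div_const (Measurable.add ?_ ?_) 2)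
  · exact Measurable.ite (measurableSet_lt measurable_norm measurable_const) measurable_const
      measurable_const
  · exact Measurable.ite (measurableSet_lt measurable_norm (hD.const_mul σ)) measurable_const
      measurable_const

theorem abs_operatorTerm_le {d : ℕ} {Ω : Set (Eucl d)} {s σ M : ℝ} (hσ1 : σ ≤ 1) (hM0 : 0 ≤ M)
    {u : Eucl d → ℝ} {x : Eucl d} (hM : ∀ y ∈ Ω, |u x - u y| ≤ M) (h : Eucl d) :
    |(u x - u (x + h)) * horizonKernel Ω s σ x (x + h)| ≤ M * ‖h‖ ^ (-(d : ℝ) - 2 * s) := by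
  by_cases hh : x + h ∈ Ω
  · rw [abs_mul, abs_of_nonneg (horizonKernel_add_nonneg Ω s σ x h)]
    exact mul_le_mul (hM _ hh) (horizonKernel_add_le Ω s σ x h)
      (horizonKernel_add_nonneg Ω s σ x h) hM0
  · rw [horizonKernel_add_eq_zero hσ1 hh, mul_zero, abs_zero]
    positivity

/-- Existence of the operator for a bounded function with a second order Taylor bound at `x`,
together with its expression as a limit of integrals over complements of balls. -/
theorem exists_hasOperatorValue {d : ℕ} (hd : 1 ≤ d) {Ω : Set (Eucl d)} {s σ : ℝ}
    (hs : 0 < s) (hs1 : s < 1) (hσ : 0 < σ) (hσ1 : σ ≤ 1) (hΩ : IsOpen Ω) {u : Eucl d → ℝ}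
    (hu : Measurable u) {x : Eucl d} (hδ : 0 < distCompl Ω x) {M M₁ r₂ : ℝ}
    (hM : ∀ y ∈ Ω, |u x - u y| ≤ M)
    (hM0 : 0 ≤ M) (hr₂ : 0 < r₂)
    (hM₁ : ∀ h, ‖h‖ < r₂ → |u (x + h) + u (x - h) - 2 * u x| ≤ M₁ * ‖h‖ ^ 2) :
    ∃ v, HasOperatorValue Ω s σ u x v ∧ Tendsto (fun r => ∫ h in (Metric.ball 0 r)ᶜ,
      (u x - u (x + h)) * horizonKernel Ω s σ x (x + h)) (𝓝[>] 0) (𝓝 v) := by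
  set f : Eucl d → ℝ := fun h => (u x - u (x + h)) * horizonKernel Ω s σ x (x + h) with hf
  have hfm : Measurable f :=
    (measurable_const.sub (hu.comp (measurable_const_add x))).mul
      (measurable_horizonKernel_add Ω s σ x)
  have hfM : ∀ h, |f h| ≤ M * ‖h‖ ^ (-(d : ℝ) - 2 * s) := abs_operatorTerm_le hσ1 hM0 hM
  have hker : ∀ h, ‖h‖ < σ * distCompl Ω x / 2 →
      horizonKernel Ω s σ x (x + h) = ‖h‖ ^ (-(d : ℝ) - 2 * s) := by
    intro h hh
    have h1 := (abs_le.1 (abs_distCompl_sub_le Ω x (x + h))).2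
    rw [sub_add_cancel_left, norm_neg] at h1
    have h2 : ‖h‖ < σ * distCompl Ω x := by linarith [mul_pos hσ hδ]
    have h3 : ‖h‖ < σ * distCompl Ω (x + h) := by nlinarith [norm_nonneg h]
    rw [horizonKernel_add, if_pos h2, if_pos h3]
    ring
  have hsym : ∀ h, ‖h‖ < min r₂ (σ * distCompl Ω x / 2) →
      |f h + f (-h)| ≤ M₁ * ‖h‖ ^ (-(d : ℝ) + (2 - 2 * s)) := by
    intro h hh
    have h1 := hh.trans_le (min_le_left _ _)
    have h2 := hh.trans_le (min_le_right _ _)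
    rcases eq_or_ne h 0 with rfl | h0
    · have hM₁0 : 0 ≤ M₁ := by
        have : Nontrivial (Eucl d) := by
          have : Nonempty (Fin d) := ⟨⟨0, hd⟩⟩
          infer_instance
        obtain ⟨w, hw⟩ := exists_norm_eq (Eucl d) (by positivity : 0 ≤ r₂ / 2)
        have := (abs_nonneg _).trans (hM₁ w (by linarith))
        rw [hw] at this
        by_contra! hneg
        have : 0 < (r₂ / 2) ^ 2 := by positivity
        nlinarith
      simp only [hf, add_zero, sub_self, zero_mul, neg_zero, abs_zero]
      positivity
    · have hpos : 0 < ‖h‖ := norm_pos_iff.2 h0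
      have e : f h + f (-h) = -(u (x + h) + u (x - h) - 2 * u x) * ‖h‖ ^ (-(d : ℝ) - 2 * s) := by
        simp only [hf]
        rw [hker h h2, hker (-h) (by rwa [norm_neg]), norm_neg, ← sub_eq_add_neg]
        ring
      have e2 : ‖h‖ ^ (-(d : ℝ) + (2 - 2 * s)) = ‖h‖ ^ 2 * ‖h‖ ^ (-(d : ℝ) - 2 * s) := by
        rw [← Real.rpow_two, ← Real.rpow_add hpos]; ring_nf
      rw [e, e2, abs_mul, abs_neg, abs_of_nonneg (by positivity : 0 ≤ ‖h‖ ^ (-(d : ℝ) - 2 * s)),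
        ← mul_assoc]
      exact mul_le_mul_of_nonneg_right (hM₁ h h1) (by positivity)
  obtain ⟨v, hv⟩ := exists_tendsto_integral_compl_ball hd hs hs1
    (lt_min hr₂ (by positivity)) hfm hfM hsym
  have hset : ∀ r, MeasurableSet (Ω \ Metric.ball x r) := fun r =>
    hΩ.measurableSet.diff measurableSet_ball
  -- translation by `x`; the kernel vanishes outside `Ω`
  have htrans : ∀ r, (fun h => indicator (Ω \ Metric.ball x r)
      (fun y => (u x - u y) * horizonKernel Ω s σ x y) (x + h))
      = indicator (Metric.ball 0 r)ᶜ f := by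
    intro r
    funext h
    have hb : x + h ∈ Metric.ball x r ↔ h ∈ Metric.ball 0 r := by simp
    by_cases h1 : h ∈ Metric.ball 0 r
    · rw [indicator_of_notMem (fun h' => h'.2 (hb.2 h1)), indicator_of_notMem (not_not.2 h1)]
    · rw [indicator_of_mem (show h ∈ (Metric.ball 0 r)ᶜ from h1)]
      by_cases h2 : x + h ∈ Ω
      · rw [indicator_of_mem (show x + h ∈ Ω \ Metric.ball x r from
          ⟨h2, fun h' => h1 (hb.1 h')⟩)]
      · rw [indicator_of_notMem fun h' => h2 h'.1]
        simp only [hf, horizonKernel_add_eq_zero hσ1 h2, mul_zero]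
  refine ⟨v, ⟨fun r hr => ?_, ?_⟩, hv⟩
  · have h1 : IntegrableOn f (Metric.ball 0 r)ᶜ :=
      integrableOn_of_le_norm_rpow hd hs hr measurableSet_ball.compl
        (fun h hh => by simpa using hh) hfm fun h _ => hfM h
    rw [← integrable_indicator_iff (hset r)]
    rw [← integrable_indicator_iff measurableSet_ball.compl, ← htrans r] at h1
    have h2 := h1.comp_add_left (-x)
    simpa using h2
  · refine hv.congr fun r => ?_
    rw [← integral_indicator measurableSet_ball.compl, ← htrans r, ← integral_indicator (hset r)]
    exact integral_add_left_eq_self (indicator (Ω \ Metric.ball x r)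
      fun y => (u x - u y) * horizonKernel Ω s σ x y) x

/-! ### The operator applied to a power of the distance -/

theorem measurable_distCompl_add_smul {d : ℕ} (Ω : Set (Eucl d)) (x e : Eucl d) :
    Measurable fun ρ : ℝ => distCompl Ω (x + ρ • e) :=
  ((continuous_distCompl Ω).comp
    (continuous_const.add (continuous_id.smul continuous_const))).measurable

theorem setIntegral_annulus_neg {d : ℕ} (f : Eucl d → ℝ) (r r₁ : ℝ) :
    ∫ h in {h | r ≤ ‖h‖ ∧ ‖h‖ < r₁}, f (-h) = ∫ h in {h | r ≤ ‖h‖ ∧ ‖h‖ < r₁}, f h := by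
  have hm : MeasurableSet {h : Eucl d | r ≤ ‖h‖ ∧ ‖h‖ < r₁} :=
    (measurableSet_le measurable_const measurable_norm).inter
      (measurableSet_lt measurable_norm measurable_const)
  rw [← integral_indicator hm, ← integral_indicator hm, ← integral_neg_eq_self]
  congr 1
  funext h
  by_cases hh : r ≤ ‖h‖ ∧ ‖h‖ < r₁ <;> simp [indicator, hh]

/-- The distance to the complement of `Ω` is pinched at `x` up to a quadratic error around the
affine function with slope `n`, from above only inside `Ω`. -/
def DistPinched {d : ℕ} (Ω : Set (Eucl d)) (C₀ : ℝ) (x n : Eucl d) : Prop :=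
  ∀ h : Eucl d, distCompl Ω x + inner ℝ n h - C₀ * ‖h‖ ^ 2 ≤ distCompl Ω (x + h) ∧
    (0 < distCompl Ω (x + h) →
      distCompl Ω (x + h) ≤ distCompl Ω x + inner ℝ n h + C₀ * ‖h‖ ^ 2)

theorem pow_mul_powTerm_eq_rayTerm {d : ℕ} (hd : 1 ≤ d) (Ω : Set (Eucl d)) (s σ : ℝ)
    (x : Eucl d) {e : Eucl d} (he : ‖e‖ = 1) {ρ : ℝ} (hρ : 0 < ρ) :
    ρ ^ (d - 1) * ((distCompl Ω x ^ (2 * s - 1) - distCompl Ω (x + ρ • e) ^ (2 * s - 1)) *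
      horizonKernel Ω s σ x (x + ρ • e))
      = rayTerm s σ (distCompl Ω x) (distCompl Ω (x + ρ • e)) ρ := by
  have hn : ‖ρ • e‖ = ρ := by rw [norm_smul, he, mul_one, Real.norm_of_nonneg hρ.le]
  have h1 := pow_mul_rpow_sub hd hρ (-(2 * s))
  rw [← sub_eq_add_neg, show -(2 * s) - 1 = -1 - 2 * s by ring] at h1
  rw [horizonKernel_add, hn, rayTerm, ← h1]
  ring

/-- The operator applied to `d_Ω ^ (2s-1)`, truncated to an annulus, is bounded below by an error
of lower order than the natural scale `δ ^ (-1)`. -/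
theorem exists_le_integral_powTerm {d : ℕ} (hd : 1 ≤ d) {s σ C₀ γ : ℝ} (hs : 1 / 2 < s)
    (hs1 : s < 1) (hσ : 0 < σ) (hσ1 : σ ≤ 1) (hC₀ : 0 < C₀) (hγ : γ ≤ 2 * s - 1)
    (hγ2 : γ ≤ 1 / 2) :
    ∃ K : ℝ, 0 ≤ K ∧ ∃ S : ℝ, 0 ≤ S ∧ ∀ (Ω : Set (Eucl d)) (x n : Eucl d) (r r₁ : ℝ), ‖n‖ = 1 →
      DistPinched Ω C₀ x n → 0 < distCompl Ω x → distCompl Ω x ≤ 1 → 0 < r →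
      r < σ * distCompl Ω x / 2 → σ * distCompl Ω x < r₁ →
      IntegrableOn (fun h => (distCompl Ω x ^ (2 * s - 1) - distCompl Ω (x + h) ^ (2 * s - 1)) *
        horizonKernel Ω s σ x (x + h)) {h | r ≤ ‖h‖ ∧ ‖h‖ < r₁} ∧
      -((r ^ (2 - 2 * s) * distCompl Ω x ^ (2 * s - 3) + K * distCompl Ω x ^ (γ - 1)) * S)
        ≤ ∫ h in {h | r ≤ ‖h‖ ∧ ‖h‖ < r₁},
          (distCompl Ω x ^ (2 * s - 1) - distCompl Ω (x + h) ^ (2 * s - 1)) *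
            horizonKernel Ω s σ x (x + h) := by
  obtain ⟨K, hK0, hK⟩ := exists_rayOdd_sub_le_integral_rayTerm hs hs1 hσ hσ1 hC₀ hγ hγ2
  refine ⟨K, hK0, (volume : Measure (Eucl d)).toSphere.real univ, measureReal_nonneg, ?_⟩
  intro Ω x n r r₁ hn hpin hδ hδ1 hr hrδ hr₁
  set δ := distCompl Ω x with hδdef
  set A : Set (Eucl d) := {h | r ≤ ‖h‖ ∧ ‖h‖ < r₁} with hA
  have hAm : MeasurableSet A :=
    (measurableSet_le measurable_const measurable_norm).inter
      (measurableSet_lt measurable_norm measurable_const)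
  set g : Eucl d → ℝ := fun h => (δ ^ (2 * s - 1) - distCompl Ω (x + h) ^ (2 * s - 1)) *
    horizonKernel Ω s σ x (x + h) with hg
  have hDm : Measurable fun h => distCompl Ω (x + h) :=
    ((continuous_distCompl Ω).comp (continuous_const.add continuous_id)).measurable
  have hgm : Measurable g :=
    (measurable_const.sub (hDm.pow_const _)).mul (measurable_horizonKernel_add Ω s σ x)
  have hgb : ∀ h ∈ A, |g h|
      ≤ (δ ^ (2 * s - 1) + (δ + r₁) ^ (2 * s - 1)) * ‖h‖ ^ (-(d : ℝ) - 2 * s) := by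
    intro h hh
    have d1 := distCompl_nonneg Ω (x + h)
    have d3 := (abs_le.1 (abs_distCompl_sub_le Ω (x + h) x)).2
    rw [add_sub_cancel_left] at d3
    have d4 : distCompl Ω (x + h) ^ (2 * s - 1) ≤ (δ + r₁) ^ (2 * s - 1) :=
      Real.rpow_le_rpow d1 (by linarith [hh.2]) (by linarith)
    have d5 : 0 ≤ distCompl Ω (x + h) ^ (2 * s - 1) := Real.rpow_nonneg d1 _
    have d6 : 0 ≤ δ ^ (2 * s - 1) := by positivity
    have d7 : |δ ^ (2 * s - 1) - distCompl Ω (x + h) ^ (2 * s - 1)|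
        ≤ δ ^ (2 * s - 1) + (δ + r₁) ^ (2 * s - 1) := by
      rw [abs_le]; constructor <;> linarith
    rw [hg, abs_mul, abs_of_nonneg (horizonKernel_add_nonneg Ω s σ x h)]
    exact mul_le_mul d7 (horizonKernel_add_le Ω s σ x h) (horizonKernel_add_nonneg Ω s σ x h)
      ((abs_nonneg _).trans d7)
  have hs0 : 0 < s := by linarith
  have hgi : IntegrableOn g A :=
    integrableOn_of_le_norm_rpow hd hs0 hr hAm (fun h hh => hh.1) hgm hgb
  have hAneg : ∀ h, h ∈ A → -h ∈ A := fun h hh => by simpa [hA] using hh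
  have hgin : IntegrableOn (fun h => g (-h)) A :=
    integrableOn_of_le_norm_rpow hd hs0 hr hAm (fun h hh => hh.1) (hgm.comp measurable_neg)
      fun h hh => by simpa using hgb (-h) (hAneg h hh)
  refine ⟨hgi, ?_⟩
  -- symmetrizing makes the odd parts on opposite rays cancel
  set G : Eucl d → ℝ := indicator A fun h => (g h + g (-h)) / 2 with hG
  have hGi : Integrable G := (integrable_indicator_iff hAm).2 ((hgi.add hgin).div_const 2)
  have hGint : ∫ h, G h = ∫ h in A, g h := by
    rw [hG, integral_indicator hAm, integral_div, integral_add hgi hgin,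
      setIntegral_annulus_neg g r r₁]
    ring
  rw [← hGint]
  refine neg_mul_le_integral_of_ray hd hGi fun e he => ?_
  set a : ℝ := inner ℝ n e with ha
  have ha1 : |a| ≤ 1 := by simpa [hn, he] using abs_real_inner_le_norm n e
  have hray : ∀ e' : Eucl d, ‖e'‖ = 1 → ∀ ρ : ℝ, 0 < ρ → 0 ≤ distCompl Ω (x + ρ • e') ∧
      |distCompl Ω (x + ρ • e') - δ| ≤ ρ ∧
      δ + inner ℝ n e' * ρ - C₀ * ρ ^ 2 ≤ distCompl Ω (x + ρ • e') ∧
      (0 < distCompl Ω (x + ρ • e') →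
        distCompl Ω (x + ρ • e') ≤ δ + inner ℝ n e' * ρ + C₀ * ρ ^ 2) := by
    intro e' he' ρ hρ
    have hnorm : ‖ρ • e'‖ = ρ := by rw [norm_smul, he', mul_one, Real.norm_of_nonneg hρ.le]
    have h1 := hpin (ρ • e')
    rw [hnorm, real_inner_smul_right, mul_comm ρ] at h1
    refine ⟨distCompl_nonneg _ _, ?_, h1⟩
    have := abs_distCompl_sub_le Ω (x + ρ • e') x
    rwa [add_sub_cancel_left, hnorm] at this
  have he' : ‖-e‖ = 1 := by rwa [norm_neg]
  obtain ⟨i1, h1⟩ := hK δ r r₁ a _ hδ hδ1 ha1 hr hrδ hr₁ (measurable_distCompl_add_smul Ω x e)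
    (hray e he)
  have ha' : inner ℝ n (-e) = -a := inner_neg_right _ _
  obtain ⟨i2, h2⟩ := hK δ r r₁ (-a) _ hδ hδ1 (by rwa [abs_neg]) hr hrδ hr₁
    (measurable_distCompl_add_smul Ω x (-e)) (ha' ▸ hray (-e) he')
  have hpoint : ∀ ρ ∈ Ioi (0 : ℝ), ρ ^ (d - 1) * G (ρ • e) = indicator (Ico r r₁)
      (fun ρ => (rayTerm s σ δ (distCompl Ω (x + ρ • e)) ρ
        + rayTerm s σ δ (distCompl Ω (x + ρ • -e)) ρ) / 2) ρ := by
    intro ρ hρ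
    have hnorm : ‖ρ • e‖ = ρ := by rw [norm_smul, he, mul_one, Real.norm_of_nonneg (le_of_lt hρ)]
    have hiff : ρ • e ∈ A ↔ ρ ∈ Ico r r₁ := by simp [hA, hnorm]
    by_cases hmem : ρ ∈ Ico r r₁
    · rw [hG, indicator_of_mem (hiff.2 hmem), indicator_of_mem hmem,
        ← pow_mul_powTerm_eq_rayTerm hd Ω s σ x he hρ,
        ← pow_mul_powTerm_eq_rayTerm hd Ω s σ x he' hρ, ← smul_neg]
      ring
    · rw [hG, indicator_of_notMem (fun h => hmem (hiff.1 h)), indicator_of_notMem hmem, mul_zero]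
  have hset : Ioi (0 : ℝ) ∩ Ico r r₁ = Ico r r₁ :=
    inter_eq_right.2 fun ρ hρ => hr.trans_le hρ.1
  rw [setIntegral_congr_fun measurableSet_Ioi hpoint, setIntegral_indicator measurableSet_Ico,
    hset, integral_Ico_eq_integral_Ioo, integral_div, integral_add i1 i2]
  rw [rayOdd_neg] at h2
  linarith

/-! ### The barrier -/

noncomputable section

/-- The profile of the barrier as a function of the distance: `2 t ^ p - t ^ (p + e)` for
`t ≤ 1`, where it is a concave function of `t ^ p`. Freezing the second factor beyond `t = 1` keeps it
comparable to `t ^ p`. -/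
def barrierProfile (p e t : ℝ) : ℝ := t ^ p * (2 - min t 1 ^ e)

end

theorem rpow_le_barrierProfile {p e t : ℝ} (he : 0 ≤ e) (ht : 0 ≤ t) :
    t ^ p ≤ barrierProfile p e t := by
  have h1 : min t 1 ^ e ≤ 1 := Real.rpow_le_one (le_min ht zero_le_one) (min_le_right _ _) he
  have h2 : 0 ≤ t ^ p := Real.rpow_nonneg ht p
  rw [barrierProfile]
  nlinarith

theorem barrierProfile_le {p e t : ℝ} (ht : 0 ≤ t) : barrierProfile p e t ≤ 2 * t ^ p := by
  have h1 : 0 ≤ min t 1 ^ e := Real.rpow_nonneg (le_min ht zero_le_one) e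
  have h2 : 0 ≤ t ^ p := Real.rpow_nonneg ht p
  rw [barrierProfile]
  nlinarith

theorem barrierProfile_of_le_one {p e t : ℝ} (hp : 0 < p) (he : 0 < e) (ht : 0 ≤ t) (ht1 : t ≤ 1) :
    barrierProfile p e t = 2 * t ^ p - t ^ (p + e) := by
  rw [barrierProfile, min_eq_left ht1, Real.rpow_add_of_nonneg ht hp.le he.le]
  ring

theorem continuous_barrierProfile {p e : ℝ} (hp : 0 ≤ p) (he : 0 ≤ e) :
    Continuous (barrierProfile p e) :=
  (continuous_id.rpow_const fun _ => Or.inr hp).mul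
    (continuous_const.sub ((continuous_id.min continuous_const).rpow_const fun _ => Or.inr he))

/-- The increment of the profile, written as the linear part in `t ^ p` plus the gap between a
convex power and its tangent. -/
theorem barrierProfile_sub {p e a b : ℝ} (hp : 0 < p) (he : 0 < e) (ha : 0 < a) (ha1 : a ≤ 1)
    (hb : 0 ≤ b) (hb1 : b ≤ 1) :
    barrierProfile p e a - barrierProfile p e b
      = (2 - (p + e) / p * a ^ e) * (a ^ p - b ^ p) +
        a ^ (p + e) * (((b / a) ^ p) ^ ((p + e) / p) - 1 - (p + e) / p * ((b / a) ^ p - 1)) := by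
  rw [barrierProfile_of_le_one hp he ha.le ha1, barrierProfile_of_le_one hp he hb hb1,
    ← Real.rpow_mul (by positivity), mul_div_cancel₀ _ hp.ne', Real.div_rpow hb ha.le,
    Real.div_rpow hb ha.le, Real.rpow_add ha]
  have h1 : 0 < a ^ p := Real.rpow_pos_of_pos ha p
  have h2 : 0 < a ^ e := Real.rpow_pos_of_pos ha e
  field_simp
  ring

theorem abs_barrierProfile_taylor_le {p e a b : ℝ} (hp : 0 < p) (he : 0 < e) (hpe : p + e ≤ 1)
    (ha : 0 < a) (ha1 : a ≤ 1) (hb : 0 < b) (hb1 : b ≤ 1) :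
    |barrierProfile p e b - barrierProfile p e a
      - (2 * (p * a ^ (p - 1)) - (p + e) * a ^ (p + e - 1)) * (b - a)|
      ≤ (2 * a ^ (p - 2) + a ^ (p + e - 2)) * (b - a) ^ 2 := by
  rw [barrierProfile_of_le_one hp he ha.le ha1, barrierProfile_of_le_one hp he hb.le hb1]
  have h1 := abs_le.1 (abs_rpow_sub_taylor_le hp.le (by linarith) ha hb)
  have h2 := abs_le.1 (abs_rpow_sub_taylor_le (by linarith : 0 ≤ p + e) hpe ha hb)
  rw [abs_le]
  constructor <;> linarith [h1.1, h1.2, h2.1, h2.2]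

/-! ### The operator applied to the barrier -/

/-- In a ball of radius comparable to `δ` on the inner side of `x`, the distance exceeds `δ` by a
fixed factor. -/
theorem distCompl_ge_of_mem_inner_ball {d : ℕ} {Ω : Set (Eucl d)} {σ C₀ : ℝ} (hσ : 0 < σ)
    (hσ1 : σ ≤ 1) (hC₀ : 0 < C₀) {x n h : Eucl d} (hn : ‖n‖ = 1) (hpin : DistPinched Ω C₀ x n)
    (hδ : 0 < distCompl Ω x) (hCδ : C₀ * distCompl Ω x ≤ 4 / 9)
    (hh : h ∈ Metric.ball ((σ * distCompl Ω x / 4) • n) (σ * distCompl Ω x / 8)) :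
    σ * distCompl Ω x / 8 < ‖h‖ ∧ ‖h‖ < σ * distCompl Ω x / 2 ∧
      1 + σ / 16 ≤ distCompl Ω (x + h) / distCompl Ω x := by
  set δ := distCompl Ω x
  have hσδ : 0 < σ * δ := mul_pos hσ hδ
  rw [Metric.mem_ball, dist_eq_norm] at hh
  have hnorm : ‖(σ * δ / 4) • n‖ = σ * δ / 4 := by
    rw [norm_smul, hn, mul_one, Real.norm_of_nonneg (by positivity)]
  have h1 := abs_le.1 (abs_norm_sub_norm_le h ((σ * δ / 4) • n))
  rw [hnorm] at h1
  refine ⟨by linarith, by linarith, ?_⟩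
  have hinner : σ * δ / 8 ≤ inner ℝ n h := by
    have e : inner ℝ n h = inner ℝ n (h - (σ * δ / 4) • n) + σ * δ / 4 := by
      rw [inner_sub_right, real_inner_smul_right, real_inner_self_eq_norm_sq, hn]; ring
    have h2 := abs_le.1 (abs_real_inner_le_norm n (h - (σ * δ / 4) • n))
    rw [hn, one_mul] at h2
    linarith
  have h3 := (hpin h).1
  have h4 : ‖h‖ ^ 2 ≤ (3 * (σ * δ) / 8) ^ 2 := by
    gcongr; linarith
  have h5 : C₀ * ‖h‖ ^ 2 ≤ σ * δ / 16 := by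
    calc C₀ * ‖h‖ ^ 2 ≤ C₀ * (3 * (σ * δ) / 8) ^ 2 := by gcongr
      _ = 9 / 64 * (C₀ * δ) * σ * (σ * δ) := by ring
      _ ≤ 9 / 64 * (4 / 9) * 1 * (σ * δ) := by gcongr
      _ = σ * δ / 16 := by ring
  rw [le_div_iff₀ hδ]
  linarith

/-- What the strict concavity of the profile contributes to the operator: the gap between the
convex power `t ^ (p + e)` of `t ^ p` and its tangent, against the kernel. -/
noncomputable def gapTerm {d : ℕ} (Ω : Set (Eucl d)) (s σ e : ℝ) (x h : Eucl d) : ℝ :=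
  distCompl Ω x ^ (2 * s - 1 + e) *
    (((distCompl Ω (x + h) / distCompl Ω x) ^ (2 * s - 1)) ^ ((2 * s - 1 + e) / (2 * s - 1)) - 1
      - (2 * s - 1 + e) / (2 * s - 1) *
        ((distCompl Ω (x + h) / distCompl Ω x) ^ (2 * s - 1) - 1)) *
    horizonKernel Ω s σ x (x + h)

theorem gapTerm_nonneg {d : ℕ} (Ω : Set (Eucl d)) {s : ℝ} (σ : ℝ) {e : ℝ} (hs : 1 / 2 < s)
    (he : 0 < e) (x h : Eucl d) : 0 ≤ gapTerm Ω s σ e x h := by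
  have hp : 0 < 2 * s - 1 := by linarith
  have hκ1 : 1 ≤ (2 * s - 1 + e) / (2 * s - 1) := by rw [le_div_iff₀ hp]; linarith
  have hδ := distCompl_nonneg Ω x
  refine mul_nonneg (mul_nonneg (by positivity) (rpow_tangent_gap_nonneg hκ1 ?_))
    (horizonKernel_add_nonneg Ω s σ x h)
  exact Real.rpow_nonneg (div_nonneg (distCompl_nonneg _ _) hδ) _

/-- The gap contributes a positive multiple of `δ ^ (e - 1)`. -/
theorem exists_le_integral_gapTerm {d : ℕ} (hd : 1 ≤ d) {s σ C₀ e : ℝ} (hs : 1 / 2 < s)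
    (hσ : 0 < σ) (hσ1 : σ ≤ 1) (hC₀ : 0 < C₀) (he : 0 < e) :
    ∃ c : ℝ, 0 < c ∧ ∀ (Ω : Set (Eucl d)) (x n : Eucl d) (r r₁ : ℝ), ‖n‖ = 1 →
      DistPinched Ω C₀ x n → 0 < distCompl Ω x → C₀ * distCompl Ω x ≤ 4 / 9 →
      r < σ * distCompl Ω x / 8 → distCompl Ω x < r₁ →
      IntegrableOn (gapTerm Ω s σ e x) {h | r ≤ ‖h‖ ∧ ‖h‖ < r₁} →
      c * distCompl Ω x ^ (e - 1) ≤ ∫ h in {h | r ≤ ‖h‖ ∧ ‖h‖ < r₁}, gapTerm Ω s σ e x h := by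
  have : Nonempty (Fin d) := ⟨⟨0, hd⟩⟩
  have hp : 0 < 2 * s - 1 := by linarith
  set κ : ℝ := (2 * s - 1 + e) / (2 * s - 1) with hκ
  have hκ1 : 1 < κ := by rw [hκ, lt_div_iff₀ hp]; linarith
  set w₀ : ℝ := (1 + σ / 16) ^ (2 * s - 1) with hw₀
  have hw₀1 : 1 < w₀ := Real.one_lt_rpow (by linarith) hp
  set c₂ : ℝ := w₀ ^ κ - 1 - κ * (w₀ - 1) with hc₂
  have hc₂0 : 0 < c₂ := rpow_tangent_gap_pos hκ1 hw₀1
  set V : ℝ := (volume : Measure (Eucl d)).real (Metric.ball 0 1) with hV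
  have hV0 : 0 < V := ENNReal.toReal_pos
    (Metric.measure_ball_pos _ _ one_pos).ne' measure_ball_lt_top.ne
  refine ⟨c₂ / 2 * (σ / 8) ^ d * V, by positivity, ?_⟩
  intro Ω x n r r₁ hn hpin hδ hCδ hrδ hδr hint
  set δ := distCompl Ω x with hδdef
  have hσδ : 0 < σ * δ := mul_pos hσ hδ
  have hσδ' : σ * δ ≤ δ := by nlinarith
  set A : Set (Eucl d) := {h | r ≤ ‖h‖ ∧ ‖h‖ < r₁} with hA
  have hAm : MeasurableSet A :=
    (measurableSet_le measurable_const measurable_norm).inter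
      (measurableSet_lt measurable_norm measurable_const)
  set B : Set (Eucl d) := Metric.ball ((σ * δ / 4) • n) (σ * δ / 8) with hB
  set m : ℝ := δ ^ (2 * s - 1 + e) * c₂ * (δ ^ (-(d : ℝ) - 2 * s) / 2) with hm
  have hgainB : ∀ h ∈ B, m ≤ gapTerm Ω s σ e x h := by
    intro h hh
    obtain ⟨b1, b2, b3⟩ := distCompl_ge_of_mem_inner_ball hσ hσ1 hC₀ hn hpin hδ hCδ hh
    have hpos : 0 < ‖h‖ := lt_trans (by positivity) b1
    have b4 : w₀ ≤ (distCompl Ω (x + h) / δ) ^ (2 * s - 1) := by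
      rw [hw₀]; gcongr
    have b5 := rpow_tangent_gap_mono hκ1.le hw₀1.le b4
    have b6 : δ ^ (-(d : ℝ) - 2 * s) / 2 ≤ horizonKernel Ω s σ x (x + h) := by
      have b7 : δ ^ (-(d : ℝ) - 2 * s) ≤ ‖h‖ ^ (-(d : ℝ) - 2 * s) := by
        refine Real.rpow_le_rpow_of_nonpos hpos (by linarith) ?_
        have : (0 : ℝ) ≤ d := Nat.cast_nonneg d
        linarith
      rw [horizonKernel_add, if_pos (by linarith)]
      have b8 : 0 ≤ δ ^ (-(d : ℝ) - 2 * s) := by positivity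
      split_ifs <;> linarith
    exact mul_le_mul (mul_le_mul_of_nonneg_left b5 (by positivity)) b6 (by positivity)
      (mul_nonneg (by positivity) (hc₂0.le.trans b5))
  have hmB : m * (volume : Measure (Eucl d)).real B
      = c₂ / 2 * (σ / 8) ^ d * V * δ ^ (e - 1) := by
    have hvol : (volume : Measure (Eucl d)).real B = (σ / 8) ^ d * δ ^ (d : ℝ) * V := by
      rw [hB, measureReal_def, Measure.addHaar_ball _ _ (by positivity : 0 ≤ σ * δ / 8),
        finrank_euclideanSpace, Fintype.card_fin, ENNReal.toReal_mul,
        ENNReal.toReal_ofReal (by positivity), Real.rpow_natCast, ← mul_pow, hV, measureReal_def]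
      ring
    have hpow : δ ^ (2 * s - 1 + e) * δ ^ (-(d : ℝ) - 2 * s) * δ ^ (d : ℝ) = δ ^ (e - 1) := by
      rw [← Real.rpow_add hδ, ← Real.rpow_add hδ]; ring_nf
    rw [hvol, hm, ← hpow]
    ring
  have hBA : B ⊆ A := fun h hh => by
    obtain ⟨b1, b2, -⟩ := distCompl_ge_of_mem_inner_ball hσ hσ1 hC₀ hn hpin hδ hCδ hh
    exact ⟨by linarith, by linarith⟩
  rw [← hmB]
  calc m * (volume : Measure (Eucl d)).real B = ∫ _h in B, m := by
        rw [setIntegral_const, smul_eq_mul, mul_comm]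
    _ ≤ ∫ h in B, gapTerm Ω s σ e x h :=
        setIntegral_mono_on (integrableOn_const measure_ball_lt_top.ne) (hint.mono_set hBA)
          measurableSet_ball hgainB
    _ ≤ _ := setIntegral_mono_set hint
        (Eventually.of_forall fun h => gapTerm_nonneg Ω σ hs he x h) hBA.eventuallyLE

theorem abs_integral_compl_ball_le {d : ℕ} (hd : 1 ≤ d) {s r₁ M : ℝ} (hs : 0 < s) (hr₁ : 0 < r₁)
    (hM : 0 ≤ M) {f : Eucl d → ℝ} (hfM : ∀ h, |f h| ≤ M * ‖h‖ ^ (-(d : ℝ) - 2 * s)) :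
    |∫ h in (Metric.ball 0 r₁)ᶜ, f h|
      ≤ M * ∫ h : Eucl d, indicator (Ici r₁) (fun ρ => ρ ^ (-(d : ℝ) - 2 * s)) ‖h‖ := by
  have hi := (integrable_indicator_norm_rpow_far hd hs hr₁).const_mul M
  rw [← integral_const_mul]
  calc |∫ h in (Metric.ball (0 : Eucl d) r₁)ᶜ, f h| ≤ ∫ h in (Metric.ball (0 : Eucl d) r₁)ᶜ,
        M * indicator (Ici r₁) (fun ρ => ρ ^ (-(d : ℝ) - 2 * s)) ‖h‖ := by
        rw [← Real.norm_eq_abs]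
        refine norm_integral_le_of_norm_le hi.integrableOn ?_
        filter_upwards [ae_restrict_mem measurableSet_ball.compl] with h hh
        rw [indicator_of_mem (show ‖h‖ ∈ Ici r₁ by simpa using hh)]
        exact hfM h
    _ ≤ ∫ h : Eucl d, M * indicator (Ici r₁) (fun ρ => ρ ^ (-(d : ℝ) - 2 * s)) ‖h‖ := by
        refine setIntegral_le_integral hi (Eventually.of_forall fun h => ?_)
        exact mul_nonneg hM (indicator_apply_nonneg fun _ => Real.rpow_nonneg (norm_nonneg h) _)

/-- Second order Taylor estimate for the symmetric difference of the barrier at `x`. -/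
theorem exists_barrier_symm_diff_le {d : ℕ} {Ω : Set (Eucl d)} {p C₀ e r₁ : ℝ} (hp : 0 < p)
    (he : 0 < e) (hpe : p + e ≤ 1) {x n : Eucl d} {u : Eucl d → ℝ}
    (hpin : DistPinched Ω C₀ x n) (hδ : 0 < distCompl Ω x) (hδr : distCompl Ω x < r₁)
    (hr₁ : r₁ ≤ 1 / 2)
    (hub : ∀ h, ‖h‖ < r₁ → u (x + h) = barrierProfile p e (distCompl Ω (x + h))) :
    ∃ M₁, ∀ h, ‖h‖ < distCompl Ω x / 2 → |u (x + h) + u (x - h) - 2 * u x| ≤ M₁ * ‖h‖ ^ 2 := by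
  have hux : u x = barrierProfile p e (distCompl Ω x) := by
    simpa using hub 0 (by simpa using hδ.trans hδr)
  have hδh : ∀ h, |distCompl Ω (x + h) - distCompl Ω x| ≤ ‖h‖ := fun h => by
    have := abs_distCompl_sub_le Ω (x + h) x
    rwa [add_sub_cancel_left] at this
  set δ := distCompl Ω x with hδdef
  set L := 2 * (p * δ ^ (p - 1)) - (p + e) * δ ^ (p + e - 1) with hL
  set Q := 2 * δ ^ (p - 2) + δ ^ (p + e - 2) with hQ
  have hQ0 : 0 ≤ Q := by positivity
  have key : ∀ h, ‖h‖ < δ / 2 →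
      |u (x + h) - u x - L * (distCompl Ω (x + h) - δ)| ≤ Q * ‖h‖ ^ 2 := by
    intro h hh
    have h1 := abs_le.1 (hδh h)
    rw [hub h (by linarith), hux]
    refine (abs_barrierProfile_taylor_le hp he hpe hδ (by linarith) (by linarith)
      (by linarith)).trans ?_
    rw [← sq_abs (distCompl Ω (x + h) - δ)]
    exact mul_le_mul_of_nonneg_left (pow_le_pow_left₀ (abs_nonneg _) (hδh h) 2) hQ0
  refine ⟨2 * Q + |L| * (2 * C₀), fun h hh => ?_⟩
  have k1 := abs_le.1 (key h hh)
  have k2 := abs_le.1 (key (-h) (by rwa [norm_neg]))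
  have p1 := hpin h
  have p2 := hpin (-h)
  have q1 := abs_le.1 (hδh h)
  have q2 := abs_le.1 (hδh (-h))
  rw [norm_neg, inner_neg_right] at p2
  rw [norm_neg] at q2 k2
  rw [← sub_eq_add_neg x h] at p2 q2 k2
  rw [← hδdef] at p1 p2
  have p3 := p1.2 (by linarith)
  have p4 := p2.2 (by linarith [norm_nonneg h])
  have k3 : |L * (distCompl Ω (x + h) + distCompl Ω (x - h) - 2 * δ)|
      ≤ |L| * (2 * C₀ * ‖h‖ ^ 2) := by
    rw [abs_mul]
    refine mul_le_mul_of_nonneg_left ?_ (abs_nonneg L)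
    rw [abs_le]
    constructor <;> linarith [p1.1, p2.1]
  have k4 := abs_le.1 k3
  rw [abs_le]
  constructor <;> linarith [k1.1, k1.2, k2.1, k2.2, k4.1, k4.2]

theorem compl_ball_eq_annulus_union {d : ℕ} {r r₁ : ℝ} (hr : r ≤ r₁) :
    (Metric.ball (0 : Eucl d) r)ᶜ = {h | r ≤ ‖h‖ ∧ ‖h‖ < r₁} ∪ (Metric.ball 0 r₁)ᶜ := by
  ext h
  simp only [mem_compl_iff, mem_ball_zero_iff, not_lt, mem_union, mem_ofPred_eq]
  constructor
  · intro h1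
    rcases lt_or_ge ‖h‖ r₁ with h2 | h2
    · exact Or.inl ⟨h1, h2⟩
    · exact Or.inr h2
  · rintro (h1 | h1)
    · exact h1.1
    · linarith

/-- Lower bound for the truncated operator applied to the barrier. By concavity of the profile in
`t ^ p` it is at least a multiple in `[0, 2]` of the operator applied to `d_Ω ^ p` plus the
contribution of the gap. -/
theorem exists_le_integral_barrier {d : ℕ} (hd : 1 ≤ d) {s σ C₀ γ e M r₁ : ℝ}
    (hs : 1 / 2 < s) (hs1 : s < 1) (hσ : 0 < σ) (hσ1 : σ ≤ 1) (hC₀ : 0 < C₀) (he : 0 < e)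
    (hes : e ≤ 2 * s - 1) (hγ : γ ≤ 2 * s - 1) (hγ2 : γ ≤ 1 / 2)
    (hM : 0 ≤ M) (hr₁ : 0 < r₁) (hr₁' : r₁ ≤ 1 / 2) :
    ∃ c : ℝ, 0 < c ∧ ∃ K : ℝ, 0 ≤ K ∧ ∀ (Ω : Set (Eucl d)) (x n : Eucl d) (u : Eucl d → ℝ),
      Measurable u → ‖n‖ = 1 → DistPinched Ω C₀ x n → 0 < distCompl Ω x →
      distCompl Ω x < r₁ → C₀ * distCompl Ω x ≤ 4 / 9 →
      (∀ y ∈ Ω, |u x - u y| ≤ M) →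
      (∀ h, ‖h‖ < r₁ → u (x + h) = barrierProfile (2 * s - 1) e (distCompl Ω (x + h))) →
      ∀ r, 0 < r → r < σ * distCompl Ω x / 8 →
        c * distCompl Ω x ^ (e - 1) - K * distCompl Ω x ^ (γ - 1) - K
          - K * (r ^ (2 - 2 * s) * distCompl Ω x ^ (2 * s - 3))
        ≤ ∫ h in (Metric.ball 0 r)ᶜ, (u x - u (x + h)) * horizonKernel Ω s σ x (x + h) := by
  obtain ⟨K, hK0, S, hS0, hKS⟩ := exists_le_integral_powTerm hd hs hs1 hσ hσ1 hC₀ hγ hγ2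
  obtain ⟨c, hc, hgap⟩ := exists_le_integral_gapTerm hd hs hσ hσ1 hC₀ he
  have hs0 : 0 < s := by linarith
  have hp : 0 < 2 * s - 1 := by linarith
  set J : ℝ := ∫ h : Eucl d, indicator (Ici r₁) (fun ρ => ρ ^ (-(d : ℝ) - 2 * s)) ‖h‖ with hJ
  have hJ0 : 0 ≤ J := integral_nonneg fun h =>
    indicator_apply_nonneg fun _ => Real.rpow_nonneg (norm_nonneg h) _
  refine ⟨c, hc, 2 * (K * S) + 2 * S + M * J, by positivity, ?_⟩
  intro Ω x n u hu hn hpin hδ hδr hCδ huM hub r hr hrδ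
  have hσδ' : σ * distCompl Ω x ≤ distCompl Ω x := by nlinarith
  have hσδ0 : 0 < σ * distCompl Ω x := mul_pos hσ hδ
  have hux : u x = barrierProfile (2 * s - 1) e (distCompl Ω x) := by
    simpa using hub 0 (by simpa using hr₁)
  set f : Eucl d → ℝ := fun h => (u x - u (x + h)) * horizonKernel Ω s σ x (x + h) with hf
  have hfm : Measurable f :=
    (measurable_const.sub (hu.comp (measurable_const_add x))).mul
      (measurable_horizonKernel_add Ω s σ x)
  have hfM : ∀ h, |f h| ≤ M * ‖h‖ ^ (-(d : ℝ) - 2 * s) :=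
    abs_operatorTerm_le hσ1 hM huM
  obtain ⟨hgi, hgle⟩ := hKS Ω x n r r₁ hn hpin hδ (by linarith) hr (by linarith) (by linarith)
  have hgapr := hgap Ω x n r r₁ hn hpin hδ hCδ hrδ hδr
  set A : Set (Eucl d) := {h | r ≤ ‖h‖ ∧ ‖h‖ < r₁} with hA
  have hAm : MeasurableSet A :=
    (measurableSet_le measurable_const measurable_norm).inter
      (measurableSet_lt measurable_norm measurable_const)
  have hfA : IntegrableOn f A :=
    integrableOn_of_le_norm_rpow hd hs0 hr hAm (fun h hh => hh.1) hfm fun h _ => hfM h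
  have hfar : IntegrableOn f (Metric.ball 0 r₁)ᶜ :=
    integrableOn_of_le_norm_rpow hd hs0 hr₁ measurableSet_ball.compl
      (fun h hh => by simpa using hh) hfm fun h _ => hfM h
  have hdisj : Disjoint A (Metric.ball (0 : Eucl d) r₁)ᶜ :=
    disjoint_left.2 fun h h1 h2 => h2 (by simpa using h1.2)
  rw [compl_ball_eq_annulus_union (by linarith : r ≤ r₁),
    setIntegral_union hdisj measurableSet_ball.compl hfA hfar]
  have hJle := (abs_le.1 (abs_integral_compl_ball_le hd hs0 hr₁ hM hfM)).1
  rw [← hJ] at hJle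
  set g : Eucl d → ℝ := fun h => (distCompl Ω x ^ (2 * s - 1) -
    distCompl Ω (x + h) ^ (2 * s - 1)) * horizonKernel Ω s σ x (x + h) with hg
  obtain ⟨lam, hlam⟩ : ∃ lam, lam = 2 - (2 * s - 1 + e) / (2 * s - 1) * distCompl Ω x ^ e :=
    ⟨_, rfl⟩
  have hδe : distCompl Ω x ^ e ≤ 1 := Real.rpow_le_one hδ.le (by linarith) he.le
  have hδe0 : 0 < distCompl Ω x ^ e := Real.rpow_pos_of_pos hδ e
  have hκ0 : 0 ≤ (2 * s - 1 + e) / (2 * s - 1) := by positivity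
  have hκ2 : (2 * s - 1 + e) / (2 * s - 1) ≤ 2 := by rw [div_le_iff₀ hp]; linarith
  have hlam0 : 0 ≤ lam := by rw [hlam]; nlinarith
  have hlam2 : lam ≤ 2 := by rw [hlam]; nlinarith
  have hgain : ∀ h ∈ A, f h - lam * g h = gapTerm Ω s σ e x h := by
    intro h hh
    have h1 := abs_le.1 (abs_distCompl_sub_le Ω (x + h) x)
    rw [add_sub_cancel_left] at h1
    have h2 := hh.2
    simp only [hf, hg]
    rw [hub h hh.2, hux, barrierProfile_sub hp he hδ (by linarith) (distCompl_nonneg _ _)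
      (by linarith), gapTerm, hlam]
    ring
  have hi : IntegrableOn (fun h => f h - lam * g h) A := hfA.sub (hgi.const_mul lam)
  have hgapint := hgapr (hi.congr_fun hgain hAm)
  rw [← setIntegral_congr_fun hAm hgain, integral_sub hfA (hgi.const_mul lam),
    integral_const_mul] at hgapint
  set P := distCompl Ω x ^ (γ - 1) with hP
  set T := r ^ (2 - 2 * s) * distCompl Ω x ^ (2 * s - 3) with hT
  have hP0 : 0 ≤ P := Real.rpow_nonneg hδ.le _
  have hT0 : 0 ≤ T := by positivity
  have h5 : -(2 * ((T + K * P) * S)) ≤ lam * ∫ h in A, g h := by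
    have hE0 : 0 ≤ (T + K * P) * S := by positivity
    calc -(2 * ((T + K * P) * S)) ≤ lam * -((T + K * P) * S) := by nlinarith
      _ ≤ _ := mul_le_mul_of_nonneg_left hgle hlam0
  have z1 : 0 ≤ (2 * S + M * J) * P := by positivity
  have z2 : 0 ≤ 2 * (K * S) + 2 * S := by positivity
  have z3 : 0 ≤ (2 * (K * S) + M * J) * T := by positivity
  linarith

/-- The operator applied to the barrier exists and is at least `c δ ^ (e - 1)` up to errors of
lower order; the barrier enters only through its values near `x` and a bound for its oscillation. -/
theorem exists_barrier_operator_lower_bound {d : ℕ} (hd : 1 ≤ d) {s σ C₀ γ e M r₁ : ℝ}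
    (hs : 1 / 2 < s) (hs1 : s < 1) (hσ : 0 < σ) (hσ1 : σ ≤ 1) (hC₀ : 0 < C₀) (he : 0 < e)
    (hes : e ≤ 2 * s - 1) (hes1 : 2 * s - 1 + e ≤ 1) (hγ : γ ≤ 2 * s - 1) (hγ2 : γ ≤ 1 / 2)
    (hM : 0 ≤ M) (hr₁ : 0 < r₁) (hr₁' : r₁ ≤ 1 / 2) :
    ∃ c : ℝ, 0 < c ∧ ∃ K : ℝ, 0 ≤ K ∧ ∀ (Ω : Set (Eucl d)) (x n : Eucl d) (u : Eucl d → ℝ),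
      IsOpen Ω → Measurable u → ‖n‖ = 1 → DistPinched Ω C₀ x n → 0 < distCompl Ω x →
      distCompl Ω x < r₁ → C₀ * distCompl Ω x ≤ 4 / 9 → (∀ y ∈ Ω, |u x - u y| ≤ M) →
      (∀ h, ‖h‖ < r₁ → u (x + h) = barrierProfile (2 * s - 1) e (distCompl Ω (x + h))) →
      ∃ v, HasOperatorValue Ω s σ u x v ∧
        c * distCompl Ω x ^ (e - 1) - K * distCompl Ω x ^ (γ - 1) - K ≤ v := by
  obtain ⟨c, hc, K, hK, hbound⟩ := exists_le_integral_barrier hd hs hs1 hσ hσ1 hC₀ he hes hγ hγ2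
    hM hr₁ hr₁'
  refine ⟨c, hc, K, hK, ?_⟩
  intro Ω x n u hΩ hu hn hpin hδ hδr hCδ huM hub
  obtain ⟨M₁, hM₁⟩ := exists_barrier_symm_diff_le (by linarith) he hes1 hpin hδ hδr hr₁' hub
  obtain ⟨v, hv, hvlim⟩ := exists_hasOperatorValue hd (by linarith : 0 < s) hs1 hσ hσ1 hΩ hu hδ
    huM hM (half_pos hδ) hM₁
  refine ⟨v, hv, ?_⟩
  have hcont : Continuous fun r : ℝ => c * distCompl Ω x ^ (e - 1) -
      K * distCompl Ω x ^ (γ - 1) - K - K * (r ^ (2 - 2 * s) * distCompl Ω x ^ (2 * s - 3)) :=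
    continuous_const.sub (continuous_const.mul
      ((continuous_id.rpow_const fun _ => Or.inr (by linarith)).mul continuous_const))
  have hle := le_of_tendsto_of_tendsto ((hcont.tendsto 0).mono_left nhdsWithin_le_nhds) hvlim (by
    filter_upwards [Ioo_mem_nhdsGT (by positivity : 0 < σ * distCompl Ω x / 8)] with r hr
    exact hbound Ω x n u hu hn hpin hδ hδr hCδ huM hub r hr.1 hr.2)
  rw [Real.zero_rpow (by linarith)] at hle
  linarith

/-! ### Integrability of negative powers of the distance -/

/-- Moving from a point of `Ω` near the boundary in the direction of the graph increases the
distance to the complement linearly. -/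
theorem exists_cone_of_mem_frontier {d : ℕ} {Ω : Set (Eucl d)} (hΩ : IsC11Domain Ω)
    (hne : Ω ≠ univ) {z : Eucl d} (hz : z ∈ frontier Ω) :
    ∃ r : ℝ, 0 < r ∧ ∃ c : ℝ, 0 < c ∧ ∃ n : Eucl d, ‖n‖ = 1 ∧
      ∀ y ∈ Ω ∩ Metric.ball z r, ∀ t ∈ Icc 0 r, c * t ≤ distCompl Ω (y + t • n) := by
  obtain ⟨r, hr, n, hn, γ, ⟨hγ, -⟩, hgraph⟩ := hΩ.2.2 z hz
  set π : Eucl d → Eucl d := fun x => x - (inner ℝ n x : ℝ) • n with hπ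
  have hπc : Continuous π := by fun_prop
  have hπlip : ∀ a b, ‖π a - π b‖ ≤ 2 * ‖a - b‖ := by
    intro a b
    have e : π a - π b = (a - b) - (inner ℝ n (a - b) : ℝ) • n := by
      simp only [hπ, inner_sub_right, sub_smul]; abel
    have h1 : ‖(inner ℝ n (a - b) : ℝ) • n‖ ≤ ‖a - b‖ := by
      rw [norm_smul, hn, mul_one]
      simpa [hn] using norm_inner_le_norm (𝕜 := ℝ) n (a - b)
    rw [e]
    linarith [norm_sub_le (a - b) ((inner ℝ n (a - b) : ℝ) • n)]
  have hπn : ∀ (y : Eucl d) (t : ℝ), π (y + t • n) = π y := by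
    intro y t
    simp only [hπ, inner_add_right, real_inner_smul_right, real_inner_self_eq_norm_sq, hn, add_smul]
    simp
  obtain ⟨K, U, hU, hK⟩ := (hγ.contDiffAt (x := π z)).exists_lipschitzOnWith
  obtain ⟨r', hr', hball⟩ := Metric.mem_nhds_iff.1 (hπc.continuousAt.preimage_mem_nhds hU)
  set c : ℝ := 1 / (1 + 2 * K) with hc
  have hK0 : (0 : ℝ) ≤ K := K.2
  have hc0 : 0 < c := by positivity
  have hc1 : c ≤ 1 := by rw [hc, div_le_one (by positivity)]; linarith
  have hcK : c + 2 * K * c = 1 := by rw [hc]; field_simp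
  refine ⟨min r r' / 3, by positivity, c, hc0, n, hn, ?_⟩
  rintro y ⟨hyΩ, hyz⟩ t ⟨ht0, ht1⟩
  refine (Metric.le_infDist (nonempty_compl.2 hne)).2 fun w hw => ?_
  by_contra! hlt
  have hm1 := min_le_left r r'
  have hm2 := min_le_right r r'
  have hwz : dist w z < min r r' := by
    have h1 : dist (y + t • n) y = t := by
      rw [dist_eq_norm, add_sub_cancel_left, norm_smul, hn, mul_one, Real.norm_of_nonneg ht0]
    have h2 := dist_triangle w (y + t • n) z
    have h3 := dist_triangle (y + t • n) y z
    rw [dist_comm w (y + t • n)] at h2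
    have h4 : c * t ≤ t := by nlinarith
    have h5 := Metric.mem_ball.1 hyz
    linarith
  have hyz' : dist y z < min r r' := by
    have h5 := Metric.mem_ball.1 hyz
    have : 0 < min r r' := lt_min hr hr'
    linarith
  have hy2 : γ (π y) < inner ℝ n y := by
    have : y ∈ Ω ∩ Metric.ball z r := ⟨hyΩ, Metric.mem_ball.2 (by linarith)⟩
    rw [hgraph] at this
    exact this.1
  have hw2 : inner ℝ n w ≤ γ (π w) := by
    by_contra! h
    have : w ∈ {x | γ (x - (inner ℝ n x : ℝ) • n) < (inner ℝ n x : ℝ)} ∩ Metric.ball z r :=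
      ⟨h, Metric.mem_ball.2 (by linarith)⟩
    rw [← hgraph] at this
    exact hw this.1
  have hwy : ‖w - (y + t • n)‖ < c * t := by rwa [← dist_eq_norm, dist_comm]
  have hinner : inner ℝ n y + t - c * t < inner ℝ n w := by
    have h1 := (abs_le.1 (abs_real_inner_le_norm n (w - (y + t • n)))).1
    rw [hn, one_mul, inner_sub_right, inner_add_right, real_inner_smul_right,
      real_inner_self_eq_norm_sq, hn] at h1
    linarith
  have hγlip : γ (π w) - γ (π y) ≤ K * (2 * (c * t)) := by
    have h1 := hK.dist_le_mul (π w) (hball (Metric.mem_ball.2 (by linarith))) (π y)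
      (hball (Metric.mem_ball.2 (by linarith)))
    rw [Real.dist_eq, dist_eq_norm] at h1
    have h2 := hπlip w (y + t • n)
    rw [hπn] at h2
    calc γ (π w) - γ (π y) ≤ K * ‖π w - π y‖ := (le_abs_self _).trans h1
      _ ≤ K * (2 * (c * t)) := by gcongr; linarith
  have : t = c * t + K * (2 * (c * t)) := by linear_combination -t * hcK
  linarith

theorem lintegral_Ioc_rpow_neg_lt_top {c β : ℝ} (hc : 0 < c) (hβ : β < 1) (r : ℝ) :
    ∫⁻ t : ℝ, indicator (Ioc 0 r) (fun t => ENNReal.ofReal ((c * t) ^ (-β))) t < ⊤ := by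
  rw [lintegral_indicator measurableSet_Ioc]
  have h1 : IntegrableOn (fun t : ℝ => (c * t) ^ (-β)) (Ioc 0 r) := by
    have h2 : IntegrableOn (fun t : ℝ => c ^ (-β) * t ^ (-β)) (Ioc 0 r) :=
      (intervalIntegral.intervalIntegrable_rpow' (a := 0) (b := r)
        (by linarith : -1 < -β)).1.const_mul (c ^ (-β))
    exact h2.congr_fun (fun t ht => (Real.mul_rpow hc.le ht.1.le).symm) measurableSet_Ioc
  exact h1.lintegral_lt_top

/-- Negative powers of the distance are locally integrable at the boundary: averaging over
translations in the inner direction reduces the claim to a one-dimensional integral. -/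
theorem exists_lintegral_distCompl_rpow_lt_top {d : ℕ} {Ω : Set (Eucl d)} (hΩ : IsC11Domain Ω)
    (hne : Ω ≠ univ) {β : ℝ} (hβ0 : 0 < β) (hβ : β < 1) {z : Eucl d} (hz : z ∈ frontier Ω) :
    ∃ r : ℝ, 0 < r ∧ ∫⁻ y in Metric.ball z r, ENNReal.ofReal (distCompl Ω y ^ (-β)) < ⊤ := by
  obtain ⟨r, hr, c, hc, n, hn, hcone⟩ := exists_cone_of_mem_frontier hΩ hne hz
  refine ⟨r, hr, ?_⟩
  set g : Eucl d → ENNReal :=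
    indicator (Metric.ball z r) fun y => ENNReal.ofReal (distCompl Ω y ^ (-β)) with hg
  have hgm : Measurable g :=
    (((continuous_distCompl Ω).measurable.pow_const _).ennreal_ofReal).indicator measurableSet_ball
  set H : ℝ → ENNReal := indicator (Ioc 0 r) fun t => ENNReal.ofReal ((c * t) ^ (-β)) with hH
  have hHfin : ∫⁻ t, H t < ⊤ := lintegral_Ioc_rpow_neg_lt_top hc hβ r
  have hg0 : ∀ y, g y ≠ 0 → y ∈ Ω ∩ Metric.ball z r := by
    intro y hy
    by_contra h
    refine hy ?_
    by_cases h1 : y ∈ Metric.ball z r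
    · have h2 : y ∉ Ω := fun h2 => h ⟨h2, h1⟩
      rw [hg, indicator_of_mem h1, distCompl_eq_zero h2, Real.zero_rpow (by linarith),
        ENNReal.ofReal_zero]
    · exact indicator_of_notMem h1 _
  -- the integral over a segment in direction `n`
  have hseg : ∀ y, ∫⁻ t in Icc 0 r, g (y + t • n)
      ≤ indicator (Metric.ball z (2 * r)) (fun _ => ∫⁻ t, H t) y := by
    intro y
    set T : Set ℝ := {t | t ∈ Icc 0 r ∧ y + t • n ∈ Ω ∩ Metric.ball z r} with hT
    by_cases hTe : T.Nonempty
    · obtain ⟨t', ht', ht''⟩ := hTe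
      have hy : y ∈ Metric.ball z (2 * r) := by
        have h1 : dist y (y + t' • n) = t' := by
          rw [dist_eq_norm, sub_add_cancel_left, norm_neg, norm_smul, hn, mul_one,
            Real.norm_of_nonneg ht'.1]
        have h2 := Metric.mem_ball.1 ht''.2
        rw [Metric.mem_ball]
        linarith [dist_triangle y (y + t' • n) z, ht'.2]
      rw [indicator_of_mem hy]
      have hTbdd : BddBelow T := ⟨0, fun t ht => ht.1.1⟩
      have h0 : 0 ≤ sInf T := le_csInf ⟨t', ht', ht''⟩ fun t ht => ht.1.1
      have hdist : ∀ t ∈ T, c * (t - sInf T) ≤ distCompl Ω (y + t • n) := by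
        intro t ht
        have h1 : t - distCompl Ω (y + t • n) / c ≤ sInf T := by
          refine le_csInf ⟨t', ht', ht''⟩ fun τ hτ => ?_
          have hnn : 0 ≤ distCompl Ω (y + t • n) / c := div_nonneg (distCompl_nonneg _ _) hc.le
          rcases le_total t τ with h | h
          · linarith
          · have h2 := hcone _ hτ.2 (t - τ) ⟨by linarith, by linarith [ht.1.2, hτ.1.1]⟩
            rw [add_assoc, ← add_smul, add_sub_cancel] at h2
            have h3 : t - τ ≤ distCompl Ω (y + t • n) / c := by
              rw [le_div_iff₀ hc]; linarith
            linarith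
        have h4 : t - sInf T ≤ distCompl Ω (y + t • n) / c := by linarith
        rw [le_div_iff₀ hc] at h4
        linarith
      calc ∫⁻ t in Icc 0 r, g (y + t • n) ≤ ∫⁻ t in Icc 0 r, H (t - sInf T) := by
            refine lintegral_mono_ae ?_
            filter_upwards [ae_restrict_mem measurableSet_Icc,
              ae_restrict_of_ae (Measure.ae_ne volume (sInf T))] with t ht hne'
            by_cases hgt : g (y + t • n) = 0
            · rw [hgt]; exact zero_le
            · have htT : t ∈ T := ⟨ht, hg0 _ hgt⟩
              have h1 : 0 < t - sInf T :=
                sub_pos.2 (lt_of_le_of_ne (csInf_le hTbdd htT) (Ne.symm hne'))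
              rw [hg, indicator_of_mem htT.2.2, hH,
                indicator_of_mem (show t - sInf T ∈ Ioc 0 r from ⟨h1, by linarith [ht.2]⟩)]
              exact ENNReal.ofReal_le_ofReal (Real.rpow_le_rpow_of_nonpos (by positivity)
                (hdist t htT) (by linarith))
        _ ≤ ∫⁻ t, H (t - sInf T) := setLIntegral_le_lintegral _ _
        _ = ∫⁻ t, H t := lintegral_sub_right_eq_self H _
    · have hzero : ∀ t ∈ Icc 0 r, g (y + t • n) = 0 := by
        intro t ht
        by_contra h
        exact hTe ⟨t, ht, hg0 _ h⟩
      rw [setLIntegral_congr_fun measurableSet_Icc hzero]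
      simp
  have htonelli : ∫⁻ t in Icc 0 r, ∫⁻ y, g (y + t • n)
      = ∫⁻ y, ∫⁻ t in Icc 0 r, g (y + t • n) := by
    refine lintegral_lintegral_swap ?_
    exact (hgm.comp (measurable_snd.add (measurable_fst.smul_const n))).aemeasurable
  have htrans : ∫⁻ t in Icc 0 r, ∫⁻ y, g (y + t • n) = (∫⁻ y, g y) * ENNReal.ofReal r := by
    simp only [lintegral_add_right_eq_self]
    rw [setLIntegral_const, Real.volume_Icc, sub_zero]
  have hfin : (∫⁻ y, g y) * ENNReal.ofReal r < ⊤ := by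
    rw [← htrans, htonelli]
    refine (lintegral_mono hseg).trans_lt ?_
    rw [lintegral_indicator measurableSet_ball, setLIntegral_const]
    exact ENNReal.mul_lt_top hHfin measure_ball_lt_top
  rw [← lintegral_indicator measurableSet_ball]
  by_contra! h
  rw [top_le_iff] at h
  rw [h, ENNReal.top_mul (by simpa using hr)] at hfin
  exact lt_irrefl _ hfin

theorem lintegral_closedBall_distCompl_rpow_lt_top {d : ℕ} {Ω : Set (Eucl d)}
    (hΩ : IsC11Domain Ω) (hne : Ω ≠ univ) {β : ℝ} (hβ0 : 0 < β) (hβ : β < 1) (R : ℝ) :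
    ∫⁻ y in Metric.closedBall 0 R, ENNReal.ofReal (distCompl Ω y ^ (-β)) < ⊤ := by
  set ν : Measure (Eucl d) :=
    volume.withDensity fun y => ENNReal.ofReal (distCompl Ω y ^ (-β)) with hν
  rw [← withDensity_apply _ measurableSet_closedBall]
  refine (isCompact_closedBall (0 : Eucl d) R).measure_lt_top_of_nhdsWithin fun z _ => ?_
  suffices h : ∃ r : ℝ, 0 < r ∧
      ∫⁻ y in Metric.ball z r, ENNReal.ofReal (distCompl Ω y ^ (-β)) < ⊤ by
    obtain ⟨r, hr, hfin⟩ := h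
    refine ⟨Metric.ball z r, mem_nhdsWithin_of_mem_nhds (Metric.ball_mem_nhds z hr), ?_⟩
    rwa [withDensity_apply _ measurableSet_ball]
  have hcont : ContinuousAt (distCompl Ω) z := (continuous_distCompl Ω).continuousAt
  by_cases hz : z ∈ Ω
  · have hpos := (distCompl_pos_iff hΩ.1 hne).2 hz
    obtain ⟨r, hr, hball⟩ := Metric.mem_nhds_iff.1
      (hcont.preimage_mem_nhds (Ioi_mem_nhds (half_lt_self hpos)))
    refine ⟨r, hr, ?_⟩
    calc ∫⁻ y in Metric.ball z r, ENNReal.ofReal (distCompl Ω y ^ (-β))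
        ≤ ∫⁻ _y in Metric.ball z r, ENNReal.ofReal ((distCompl Ω z / 2) ^ (-β)) := by
          refine setLIntegral_mono measurable_const fun y hy => ?_
          exact ENNReal.ofReal_le_ofReal (Real.rpow_le_rpow_of_nonpos (by positivity)
            (le_of_lt (hball hy)) (by linarith))
      _ < ⊤ := by
          rw [setLIntegral_const]
          exact ENNReal.mul_lt_top ENNReal.ofReal_lt_top measure_ball_lt_top
  · by_cases hzc : z ∈ closure Ω
    · exact exists_lintegral_distCompl_rpow_lt_top hΩ hne hβ0 hβ
        (by rw [hΩ.1.frontier_eq]; exact ⟨hzc, hz⟩)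
    · obtain ⟨r, hr, hball⟩ := Metric.mem_nhds_iff.1 (isClosed_closure.isOpen_compl.mem_nhds hzc)
      refine ⟨r, hr, ?_⟩
      rw [setLIntegral_congr_fun (g := fun _ => 0) measurableSet_ball fun y hy => ?_]
      · simp
      · have hy' : y ∉ Ω := fun h => hball hy (subset_closure h)
        simp only [distCompl_eq_zero hy']
        rw [Real.zero_rpow (by linarith), ENNReal.ofReal_zero]

/-! ### Sobolev regularity of the barrier -/

theorem integrable_two_sub_norm_rpow {d : ℕ} (hd : 1 ≤ d) {β M : ℝ} (hβ : β < 1) (hM : 0 < M) :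
    Integrable fun x : Eucl d => indicator (Iio 2) (fun ρ => (M * (2 - ρ)) ^ (-β)) ‖x‖ := by
  refine integrable_radial hd ?_
  have h0 : IntervalIntegrable (fun ρ : ℝ => (2 - ρ) ^ (-β)) volume 0 2 := by
    have := (intervalIntegral.intervalIntegrable_rpow' (a := 0) (b := 2)
      (by linarith : -1 < -β)).comp_sub_left 2
    simpa using this.symm
  have h1' : IntegrableOn (fun ρ : ℝ => M ^ (-β) * (2 - ρ) ^ (-β)) (Ioc 0 2) :=
    Integrable.const_mul h0.1 _
  have h1 := h1'.mono_set Ioo_subset_Ioc_self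
  have h2 : IntegrableOn (fun ρ : ℝ => ρ ^ (d - 1) * (M ^ (-β) * (2 - ρ) ^ (-β))) (Ioo 0 2) := by
    refine Integrable.bdd_mul (c := 2 ^ (d - 1)) h1 (by fun_prop) ?_
    filter_upwards [ae_restrict_mem measurableSet_Ioo] with ρ hρ
    rw [Real.norm_of_nonneg (pow_nonneg hρ.1.le _)]
    exact pow_le_pow_left₀ hρ.1.le hρ.2.le _
  refine ((h2.integrable_indicator measurableSet_Ioo).integrableOn (s := Ioi 0)).congr_fun
    (fun ρ hρ => ?_) measurableSet_Ioi
  by_cases h : ρ < 2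
  · simp only [indicator_of_mem (show ρ ∈ Ioo (0 : ℝ) 2 from ⟨hρ, h⟩),
      indicator_of_mem (show ρ ∈ Iio 2 from h)]
    rw [Real.mul_rpow hM.le (by linarith)]
  · simp [indicator_of_notMem (show ρ ∉ Ioo (0 : ℝ) 2 from fun h' => h h'.2),
      indicator_of_notMem (show ρ ∉ Iio 2 from h)]

noncomputable section

/-- The distance to the complement of `Ω`, cut off so as to vanish outside the ball of radius `2`.
For `M` large it agrees with the distance in the unit ball. -/
def cutDist {d : ℕ} (Ω : Set (Eucl d)) (M : ℝ) (x : Eucl d) : ℝ :=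
  min (distCompl Ω x) (M * max (2 - ‖x‖) 0)

end

theorem cutDist_nonneg {d : ℕ} (Ω : Set (Eucl d)) {M : ℝ} (hM : 0 ≤ M) (x : Eucl d) :
    0 ≤ cutDist Ω M x :=
  le_min (distCompl_nonneg Ω x) (mul_nonneg hM (le_max_right _ _))

theorem continuous_cutDist {d : ℕ} (Ω : Set (Eucl d)) (M : ℝ) : Continuous (cutDist Ω M) := by
  have := continuous_distCompl Ω
  unfold cutDist
  fun_prop

theorem cutDist_eq_zero {d : ℕ} (Ω : Set (Eucl d)) (M : ℝ) {x : Eucl d} (hx : 2 ≤ ‖x‖) :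
    cutDist Ω M x = 0 := by
  rw [cutDist, max_eq_right (by linarith), mul_zero]
  exact min_eq_right (distCompl_nonneg Ω x)

theorem cutDist_le {d : ℕ} (Ω : Set (Eucl d)) {M : ℝ} (hM : 0 ≤ M) (x : Eucl d) :
    cutDist Ω M x ≤ 2 * M := by
  refine (min_le_right _ _).trans ?_
  have : max (2 - ‖x‖) 0 ≤ 2 := max_le (by linarith [norm_nonneg x]) (by norm_num)
  nlinarith

theorem abs_cutDist_sub_le {d : ℕ} (Ω : Set (Eucl d)) {M : ℝ} (hM : 1 ≤ M) (x y : Eucl d) :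
    |cutDist Ω M x - cutDist Ω M y| ≤ M * ‖x - y‖ := by
  refine (abs_min_sub_min_le_max _ _ _ _).trans (max_le ?_ ?_)
  · refine (abs_distCompl_sub_le Ω x y).trans ?_
    nlinarith [norm_nonneg (x - y)]
  · rw [← mul_sub, abs_mul, abs_of_nonneg (by linarith : 0 ≤ M)]
    refine mul_le_mul_of_nonneg_left ((abs_max_sub_max_le_abs _ _ _).trans ?_) (by linarith)
    rw [sub_sub_sub_cancel_left, norm_sub_rev]
    exact abs_norm_sub_norm_le y x

theorem lintegral_cutDist_rpow_lt_top {d : ℕ} (hd : 1 ≤ d) {Ω : Set (Eucl d)}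
    (hΩ : IsC11Domain Ω) (hne : Ω ≠ univ) {β M : ℝ} (hβ0 : 0 < β) (hβ : β < 1) (hM : 0 < M) :
    ∫⁻ x, ENNReal.ofReal (cutDist Ω M x ^ (-β)) < ⊤ := by
  have h1 := lintegral_closedBall_distCompl_rpow_lt_top hΩ hne hβ0 hβ 2
  have h2 := (integrable_two_sub_norm_rpow hd hβ hM).lintegral_lt_top
  rw [← lintegral_indicator measurableSet_closedBall] at h1
  have hm : Measurable fun x : Eucl d =>
      ENNReal.ofReal (indicator (Iio 2) (fun ρ => (M * (2 - ρ)) ^ (-β)) ‖x‖) := by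
    have hF : Measurable (indicator (Iio (2 : ℝ)) fun ρ => (M * (2 - ρ)) ^ (-β)) :=
      Measurable.indicator (by fun_prop) measurableSet_Iio
    exact (hF.comp measurable_norm).ennreal_ofReal
  refine (lintegral_mono fun x => ?_).trans_lt
    ((lintegral_add_right _ hm).trans_lt (ENNReal.add_lt_top.2 ⟨h1, h2⟩))
  rcases lt_or_ge ‖x‖ 2 with hx | hx
  · rw [indicator_of_mem (show x ∈ Metric.closedBall (0 : Eucl d) 2 by simpa using hx.le),
      indicator_of_mem (show ‖x‖ ∈ Iio 2 from hx), cutDist, max_eq_left (by linarith)]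
    rcases min_choice (distCompl Ω x) (M * (2 - ‖x‖)) with h | h <;> rw [h]
    · exact le_self_add
    · exact le_add_self
  · rw [cutDist_eq_zero Ω M hx, Real.zero_rpow (by linarith), ENNReal.ofReal_zero]
    exact zero_le

/-- The Gagliardo kernel against the square of a difference truncated at height `D`. -/
theorem exists_lintegral_min_sq_div_le {d : ℕ} (hd : 1 ≤ d) {s : ℝ} (hs : 0 < s) (hs1 : s < 1) :
    ∃ C : ℝ, 0 ≤ C ∧ ∀ D : ℝ, 0 < D →
      ∫⁻ h : Eucl d, ENNReal.ofReal (min ‖h‖ D ^ 2 / ‖h‖ ^ ((d : ℝ) + 2 * s))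
        ≤ ENNReal.ofReal (C * D ^ (2 - 2 * s)) := by
  have hN : Nonempty (Fin d) := ⟨⟨0, hd⟩⟩
  set F : ℝ → ℝ := fun ρ => indicator (Iio 1) (fun ρ => ρ ^ (-(d : ℝ) + (2 - 2 * s))) ρ
    + indicator (Ici 1) (fun ρ => ρ ^ (-(d : ℝ) - 2 * s)) ρ with hF
  have hFi : Integrable fun h : Eucl d => F ‖h‖ :=
    (integrable_indicator_norm_rpow_near hd hs1 1).add
      (integrable_indicator_norm_rpow_far hd hs one_pos)
  have hF0 : ∀ ρ, 0 ≤ ρ → 0 ≤ F ρ := fun ρ hρ =>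
    add_nonneg (indicator_apply_nonneg fun _ => Real.rpow_nonneg hρ _)
      (indicator_apply_nonneg fun _ => Real.rpow_nonneg hρ _)
  refine ⟨∫ h : Eucl d, F ‖h‖, integral_nonneg fun h => hF0 _ (norm_nonneg h), fun D hD => ?_⟩
  -- rescaling by `D`
  have hpt : ∀ h : Eucl d, min ‖h‖ D ^ 2 / ‖h‖ ^ ((d : ℝ) + 2 * s)
      ≤ D ^ (2 - (d : ℝ) - 2 * s) * F ‖D⁻¹ • h‖ := by
    intro h
    rcases eq_or_ne h 0 with rfl | h0
    · have h1 : (0 : ℝ) < d + 2 * s := by positivity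
      rw [norm_zero, Real.zero_rpow h1.ne', div_zero]
      exact mul_nonneg (by positivity) (hF0 _ (norm_nonneg _))
    have hpos : 0 < ‖h‖ := norm_pos_iff.2 h0
    have hn : ‖D⁻¹ • h‖ = ‖h‖ / D := by
      rw [norm_smul, Real.norm_of_nonneg (by positivity), inv_mul_eq_div]
    rw [hn, hF]
    have hdiv : ∀ a : ℝ, a / ‖h‖ ^ ((d : ℝ) + 2 * s) = a * ‖h‖ ^ (-(d : ℝ) - 2 * s) := fun a => by
      rw [show -(d : ℝ) - 2 * s = -((d : ℝ) + 2 * s) by ring, Real.rpow_neg hpos.le]; rfl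
    rw [hdiv]
    rcases lt_or_ge ‖h‖ D with hlt | hge
    · have hm : ‖h‖ / D < 1 := (div_lt_one hD).2 hlt
      simp only [indicator_of_mem (show ‖h‖ / D ∈ Iio 1 from hm),
        indicator_of_notMem (show ‖h‖ / D ∉ Ici 1 from not_le.2 hm), add_zero]
      rw [min_eq_left hlt.le, Real.div_rpow hpos.le hD.le, ← Real.rpow_two, ← Real.rpow_add hpos,
        show 2 + (-(d : ℝ) - 2 * s) = -(d : ℝ) + (2 - 2 * s) by ring,
        show 2 - (d : ℝ) - 2 * s = -(d : ℝ) + (2 - 2 * s) by ring]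
      have : 0 < D ^ (-(d : ℝ) + (2 - 2 * s)) := by positivity
      field_simp
      exact le_rfl
    · have hm : 1 ≤ ‖h‖ / D := (one_le_div hD).2 hge
      simp only [indicator_of_notMem (show ‖h‖ / D ∉ Iio 1 from not_lt.2 hm),
        indicator_of_mem (show ‖h‖ / D ∈ Ici 1 from hm), zero_add]
      rw [min_eq_right hge, Real.div_rpow hpos.le hD.le,
        show 2 - (d : ℝ) - 2 * s = 2 + (-(d : ℝ) - 2 * s) by ring, Real.rpow_add hD, Real.rpow_two]
      have : 0 < D ^ (-(d : ℝ) - 2 * s) := by positivity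
      field_simp
      exact le_rfl
  have hint : Integrable fun h : Eucl d => F ‖D⁻¹ • h‖ :=
    hFi.comp_smul (inv_ne_zero hD.ne')
  have hval : ∫ h : Eucl d, F ‖D⁻¹ • h‖ = D ^ (d : ℝ) * ∫ h : Eucl d, F ‖h‖ := by
    rw [Measure.integral_comp_inv_smul_of_nonneg volume (fun h : Eucl d => F ‖h‖) hD.le,
      finrank_euclideanSpace, Fintype.card_fin, smul_eq_mul, Real.rpow_natCast]
  calc _ ≤ ∫⁻ h : Eucl d, ENNReal.ofReal (D ^ (2 - (d : ℝ) - 2 * s) * F ‖D⁻¹ • h‖) :=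
        lintegral_mono fun h => ENNReal.ofReal_le_ofReal (hpt h)
    _ = ENNReal.ofReal (∫ h : Eucl d, D ^ (2 - (d : ℝ) - 2 * s) * F ‖D⁻¹ • h‖) := by
        rw [ofReal_integral_eq_lintegral_ofReal (hint.const_mul _)]
        exact Eventually.of_forall fun h => mul_nonneg (by positivity) (hF0 _ (norm_nonneg _))
    _ = _ := by
        rw [integral_const_mul, hval, ← mul_assoc, ← Real.rpow_add hD, mul_comm]
        congr 3
        ring

/-- A function whose increments are controlled by `ρ(x) ^ (p-1) min(|x-y|, ρ(x))`, with `p = 2s-1`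
and `ρ` the larger of the two values at `x` and `y`, has finite Gagliardo seminorm as soon as
`ρ ^ (2s-2)` is integrable. -/
theorem gagliardo_lt_top {d : ℕ} (hd : 1 ≤ d) {s L : ℝ} (hs : 1 / 2 < s) (hs1 : s < 1)
    {ρ w : Eucl d → ℝ} (hρ : Measurable ρ) (hρ0 : ∀ x, 0 ≤ ρ x)
    (hfin : ∫⁻ x, ENNReal.ofReal (ρ x ^ (-(2 - 2 * s))) < ⊤)
    (hw : ∀ x y, ρ y ≤ ρ x → |w x - w y| ≤ L * (ρ x ^ (2 * s - 2) * min ‖x - y‖ (ρ x))) :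
    ∫⁻ x, ∫⁻ y, ENNReal.ofReal ((w x - w y) ^ 2 / ‖x - y‖ ^ ((d : ℝ) + 2 * s)) < ⊤ := by
  obtain ⟨C, hC0, hC⟩ := exists_lintegral_min_sq_div_le hd (by linarith : 0 < s) hs1
  set G : Eucl d → Eucl d → ENNReal := fun x y =>
    ENNReal.ofReal ((L * ρ x ^ (2 * s - 2)) ^ 2) *
      ENNReal.ofReal (min ‖x - y‖ (ρ x) ^ 2 / ‖x - y‖ ^ ((d : ℝ) + 2 * s)) with hG
  have hGm : Measurable (Function.uncurry G) := by
    have h1 : Measurable fun q : Eucl d × Eucl d => ρ q.1 := hρ.comp measurable_fst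
    have h2 : Measurable fun q : Eucl d × Eucl d => ‖q.1 - q.2‖ :=
      (measurable_fst.sub measurable_snd).norm
    exact (((h1.pow_const _).const_mul L).pow_const 2).ennreal_ofReal.mul
      (((h2.min h1).pow_const 2).div (h2.pow_const _)).ennreal_ofReal
  have hhalf : ∀ x y, ρ y ≤ ρ x →
      ENNReal.ofReal ((w x - w y) ^ 2 / ‖x - y‖ ^ ((d : ℝ) + 2 * s)) ≤ G x y := by
    intro x y hxy
    simp only [hG]
    rw [← ENNReal.ofReal_mul (sq_nonneg _), ← mul_div_assoc, ← mul_pow]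
    refine ENNReal.ofReal_le_ofReal (div_le_div_of_nonneg_right ?_ (by positivity))
    rw [← sq_abs, mul_assoc]
    exact pow_le_pow_left₀ (abs_nonneg _) (hw x y hxy) 2
  have hpt : ∀ x y, ENNReal.ofReal ((w x - w y) ^ 2 / ‖x - y‖ ^ ((d : ℝ) + 2 * s))
      ≤ G x y + G y x := by
    intro x y
    rcases le_total (ρ y) (ρ x) with h | h
    · exact (hhalf x y h).trans le_self_add
    · have := hhalf y x h
      rw [← neg_sub, neg_sq, norm_sub_rev] at this
      exact this.trans le_add_self
  have hinner : ∀ x, ∫⁻ y, G x y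
      ≤ ENNReal.ofReal (L ^ 2 * C) * ENNReal.ofReal (ρ x ^ (-(2 - 2 * s))) := by
    intro x
    rcases (hρ0 x).eq_or_lt with h0 | hpos
    · have : ∀ y, G x y = 0 := fun y => by
        simp only [hG, ← h0]
        rw [Real.zero_rpow (by linarith)]
        simp
      simp [this]
    · rw [hG, lintegral_const_mul' _ _ ENNReal.ofReal_ne_top]
      have htr : ∫⁻ y, ENNReal.ofReal (min ‖x - y‖ (ρ x) ^ 2 / ‖x - y‖ ^ ((d : ℝ) + 2 * s))
          = ∫⁻ h : Eucl d, ENNReal.ofReal (min ‖h‖ (ρ x) ^ 2 / ‖h‖ ^ ((d : ℝ) + 2 * s)) :=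
        lintegral_sub_left_eq_self
          (fun h : Eucl d => ENNReal.ofReal (min ‖h‖ (ρ x) ^ 2 / ‖h‖ ^ ((d : ℝ) + 2 * s))) x
      rw [htr]
      refine (mul_le_mul_right (hC (ρ x) hpos) _).trans ?_
      rw [← ENNReal.ofReal_mul (sq_nonneg _), ← ENNReal.ofReal_mul (by positivity)]
      refine ENNReal.ofReal_le_ofReal (le_of_eq ?_)
      have e : ρ x ^ (-(2 - 2 * s)) = ρ x ^ (2 * s - 2) * ρ x ^ (2 * s - 2) * ρ x ^ (2 - 2 * s) := by
        rw [← Real.rpow_add hpos, ← Real.rpow_add hpos]; ring_nf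
      rw [e]
      ring
  have hsum : ∫⁻ x, ∫⁻ y, G x y < ⊤ := by
    refine (lintegral_mono hinner).trans_lt ?_
    rw [lintegral_const_mul' _ _ ENNReal.ofReal_ne_top]
    exact ENNReal.mul_lt_top ENNReal.ofReal_lt_top hfin
  have hGy : Measurable fun x => ∫⁻ y, G x y := hGm.lintegral_prod_right'
  calc _ ≤ ∫⁻ x, ∫⁻ y, (G x y + G y x) := lintegral_mono fun x => lintegral_mono fun y => hpt x y
    _ = (∫⁻ x, ∫⁻ y, G x y) + ∫⁻ x, ∫⁻ y, G y x := by
        rw [← lintegral_add_left hGy]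
        refine lintegral_congr fun x => ?_
        exact lintegral_add_left (hGm.comp measurable_prodMk_left) _
    _ = (∫⁻ x, ∫⁻ y, G x y) + ∫⁻ x, ∫⁻ y, G x y := by
        congr 1
        exact lintegral_lintegral_swap (hGm.comp measurable_swap).aemeasurable
    _ < ⊤ := ENNReal.add_lt_top.2 ⟨hsum, hsum⟩

theorem abs_barrierProfile_sub_le {p e a b : ℝ} (hp0 : 0 < p) (hp1 : p ≤ 1) (he0 : 0 < e)
    (he1 : e ≤ 1) (ha : 0 < a) (hb : 0 ≤ b) (hba : b ≤ a) :
    |barrierProfile p e a - barrierProfile p e b| ≤ 4 * (a ^ (p - 1) * (a - b)) := by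
  have h1 := rpow_sub_rpow_le_mul_sub hp0.le hp1 hb ha hba
  have h2 : b ^ p ≤ a ^ p := Real.rpow_le_rpow hb hba hp0.le
  have hA0 : 0 < min a 1 := lt_min ha one_pos
  have hB0 : 0 ≤ min b 1 := le_min hb zero_le_one
  have hBA : min b 1 ≤ min a 1 := min_le_min_right 1 hba
  have h3 : min b 1 ^ e ≤ min a 1 ^ e := Real.rpow_le_rpow hB0 hBA he0.le
  have h4 : min a 1 ^ e ≤ 1 := Real.rpow_le_one hA0.le (min_le_right _ _) he0.le
  have h4' : 0 ≤ min b 1 ^ e := Real.rpow_nonneg hB0 e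
  have h5 := rpow_sub_rpow_le_mul_sub he0.le he1 hB0 hA0 hBA
  -- the truncated power has relative increment at most `(a - b) / a`
  have h6 : a * (min a 1 ^ e - min b 1 ^ e) ≤ a - b := by
    have e1 : min a 1 ^ (e - 1) * min a 1 = min a 1 ^ e := by
      rw [Real.rpow_sub_one hA0.ne']; field_simp
    have e2 : a * (min a 1 - min b 1) ≤ min a 1 * (a - b) := by
      rcases le_total a 1 with h | h
      · rw [min_eq_left h, min_eq_left (hba.trans h)]
      · rw [min_eq_right h]
        rcases le_total b 1 with h' | h'
        · rw [min_eq_left h']; nlinarith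
        · rw [min_eq_right h']; linarith
    have e3 : 0 < min a 1 ^ (e - 1) := Real.rpow_pos_of_pos hA0 _
    calc a * (min a 1 ^ e - min b 1 ^ e) ≤ a * (min a 1 ^ (e - 1) * (min a 1 - min b 1)) := by gcongr
      _ = min a 1 ^ (e - 1) * (a * (min a 1 - min b 1)) := by ring
      _ ≤ min a 1 ^ (e - 1) * (min a 1 * (a - b)) := by gcongr
      _ = min a 1 ^ e * (a - b) := by rw [← e1]; ring
      _ ≤ 1 * (a - b) := by gcongr
      _ = a - b := one_mul _
  have e4 : a ^ (p - 1) * a = a ^ p := by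
    rw [Real.rpow_sub_one ha.ne']; field_simp
  have h7 : a ^ p * (min a 1 ^ e - min b 1 ^ e) ≤ a ^ (p - 1) * (a - b) := by
    rw [← e4, mul_assoc]
    gcongr
  have h8 : 0 ≤ a ^ (p - 1) * (a - b) := mul_nonneg (by positivity) (by linarith)
  have h9 : 0 ≤ b ^ p := Real.rpow_nonneg hb p
  have h10 : 0 ≤ a ^ p * (min a 1 ^ e - min b 1 ^ e) := mul_nonneg (by positivity) (by linarith)
  have e5 : barrierProfile p e a - barrierProfile p e b
      = (a ^ p - b ^ p) * (2 - min b 1 ^ e) - a ^ p * (min a 1 ^ e - min b 1 ^ e) := by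
    rw [barrierProfile, barrierProfile]; ring
  have h11 : 0 ≤ (a ^ p - b ^ p) * (2 - min b 1 ^ e) :=
    mul_nonneg (by linarith) (by linarith)
  have h12 : (a ^ p - b ^ p) * (2 - min b 1 ^ e) ≤ (a ^ p - b ^ p) * 2 :=
    mul_le_mul_of_nonneg_left (by linarith) (by linarith)
  rw [e5, abs_le]
  constructor <;> linarith

/-- The barrier belongs to `H^s_loc`. -/
theorem memHsLoc_barrier {d : ℕ} (hd : 1 ≤ d) {Ω : Set (Eucl d)} (hΩ : IsC11Domain Ω)
    (hne : Ω ≠ univ) {s e M : ℝ} (hs : 1 / 2 < s) (hs1 : s < 1) (he0 : 0 < e) (he1 : e ≤ 1)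
    (hM : 1 ≤ M) :
    MemHsLoc univ s fun x => barrierProfile (2 * s - 1) e (cutDist Ω M x) := by
  intro ψ hψ hψc _
  have hp0 : 0 < 2 * s - 1 := by linarith
  set u : Eucl d → ℝ := fun x => barrierProfile (2 * s - 1) e (cutDist Ω M x) with hu
  have huc : Continuous u :=
    (continuous_barrierProfile hp0.le he0.le).comp (continuous_cutDist Ω M)
  constructor
  · rw [Measure.restrict_univ]
    exact (huc.mul hψ.continuous).memLp_of_hasCompactSupport hψc.mul_left
  · simp only [Measure.restrict_univ]
    obtain ⟨B, hB⟩ := hψc.exists_bound_of_continuous hψ.continuous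
    obtain ⟨K, hK⟩ := ContDiff.lipschitzWith_of_hasCompactSupport hψc hψ (by simp)
    have hB0 : 0 ≤ B := (norm_nonneg _).trans (hB 0)
    have hK0 : (0 : ℝ) ≤ K := K.2
    have hM0 : 0 < M := by linarith
    refine gagliardo_lt_top (L := 4 * M * B + 2 * (2 * M * K + 2 * B)) hd hs hs1
      (continuous_cutDist Ω M).measurable (cutDist_nonneg Ω hM0.le)
      (lintegral_cutDist_rpow_lt_top hd hΩ hne (by linarith) (by linarith) hM0) ?_
    intro x y hxy
    have hx0 := cutDist_nonneg Ω hM0.le x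
    have hy0 := cutDist_nonneg Ω hM0.le y
    have hprof0 : barrierProfile (2 * s - 1) e 0 = 0 := by
      rw [barrierProfile, Real.zero_rpow hp0.ne', zero_mul]
    rcases hx0.eq_or_lt with h0 | hpos
    · have hy : cutDist Ω M y = 0 := le_antisymm (hxy.trans h0.symm.le) hy0
      simp only [hu, hy, ← h0, hprof0, zero_mul, sub_self, abs_zero]
      rw [Real.zero_rpow (by linarith), zero_mul, mul_zero]
    have hlip := abs_cutDist_sub_le Ω hM x y
    have hle := cutDist_le Ω hM0.le x
    have hub := barrierProfile_le (p := 2 * s - 1) (e := e) hx0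
    have hu0 := (Real.rpow_nonneg hx0 (2 * s - 1)).trans
      (rpow_le_barrierProfile (p := 2 * s - 1) he0.le hx0)
    have hinc := abs_barrierProfile_sub_le hp0 (by linarith) he0 he1 hpos hy0 hxy
    have hψxy : |ψ x - ψ y| ≤ K * ‖x - y‖ := by
      have := hK.dist_le_mul x y
      rwa [Real.dist_eq, dist_eq_norm] at this
    have hψy : |ψ y| ≤ B := hB y
    have hψx : |ψ x| ≤ B := hB x
    change |u x * ψ x - u y * ψ y| ≤ _
    change |u x - u y| ≤ _ at hinc
    change u x ≤ _ at hub
    change 0 ≤ u x at hu0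
    rw [abs_of_nonneg (by linarith : 0 ≤ cutDist Ω M x - cutDist Ω M y)] at hlip
    rw [show 2 * s - 1 - 1 = 2 * s - 2 by ring] at hinc
    have epow : cutDist Ω M x ^ (2 * s - 1) = cutDist Ω M x ^ (2 * s - 2) * cutDist Ω M x := by
      rw [← Real.rpow_add_one hpos.ne']; ring_nf
    rw [epow] at hub
    generalize cutDist Ω M x = a at *
    generalize cutDist Ω M y = b at *
    have hP : 0 < a ^ (2 * s - 2) := Real.rpow_pos_of_pos hpos _
    generalize a ^ (2 * s - 2) = P at *
    have hN : 0 ≤ ‖x - y‖ := norm_nonneg _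
    generalize ‖x - y‖ = N at *
    have hm0 : 0 ≤ min N a := le_min hN hx0
    have hab : a - b ≤ M * min N a := by
      rcases min_choice N a with h | h <;> rw [h]
      · exact hlip
      · nlinarith
    have hψm : a * |ψ x - ψ y| ≤ (2 * M * K + 2 * B) * min N a := by
      rcases min_choice N a with h | h <;> rw [h]
      · have : a * |ψ x - ψ y| ≤ 2 * M * (K * N) :=
          mul_le_mul hle hψxy (abs_nonneg _) (by linarith)
        nlinarith [mul_nonneg hB0 hN]
      · have h2 : |ψ x - ψ y| ≤ 2 * B := by
          have := abs_sub (ψ x) (ψ y)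
          linarith
        have h3 : a * |ψ x - ψ y| ≤ a * (2 * B) := mul_le_mul_of_nonneg_left h2 hx0
        have h4 : 0 ≤ M * K * a := by positivity
        nlinarith
    calc |u x * ψ x - u y * ψ y| = |(u x - u y) * ψ y + u x * (ψ x - ψ y)| := by ring_nf
      _ ≤ |u x - u y| * |ψ y| + u x * |ψ x - ψ y| := by
          refine (abs_add_le _ _).trans ?_
          rw [abs_mul, abs_mul, abs_of_nonneg hu0]
      _ ≤ 4 * (P * (M * min N a)) * B + 2 * (P * a) * |ψ x - ψ y| := by
          gcongr
          exact hinc.trans (by gcongr)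
      _ = 4 * (P * (M * min N a)) * B + 2 * P * (a * |ψ x - ψ y|) := by ring
      _ ≤ 4 * (P * (M * min N a)) * B + 2 * P * ((2 * M * K + 2 * B) * min N a) := by gcongr
      _ = (4 * M * B + 2 * (2 * M * K + 2 * B)) * (P * min N a) := by ring

/-! ### Conclusion -/

theorem cutDist_eq_distCompl {d : ℕ} (Ω : Set (Eucl d)) {x : Eucl d} (hx : ‖x‖ ≤ 1) :
    cutDist Ω (1 + distCompl Ω 0) x = distCompl Ω x := by
  have h0 := distCompl_nonneg Ω (0 : Eucl d)
  have h1 := (abs_le.1 (abs_distCompl_sub_le Ω x 0)).2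
  rw [sub_zero] at h1
  rw [cutDist, max_eq_left (by linarith)]
  refine min_eq_left ?_
  nlinarith

/-- Near the boundary the power `δ ^ (e - 1)` dominates all the error terms. -/
theorem rpow_le_of_small {c K e ε δ : ℝ} (hK : 0 ≤ K) (he : 2 * e ≤ ε)
    (he2 : 2 * e ≤ 1 / 2) (hδ : 0 < δ) (hδ1 : δ ≤ 1) (hsmall : (2 * K + 1) * δ ^ e ≤ c) :
    δ ^ (-1 + ε) ≤ c * δ ^ (e - 1) - K * δ ^ (2 * e - 1) - K := by
  have h1 : δ ^ (2 * e - 1) = δ ^ (e - 1) * δ ^ e := by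
    rw [← Real.rpow_add hδ]; ring_nf
  have h2 : 1 ≤ δ ^ (2 * e - 1) := Real.one_le_rpow_of_pos_of_le_one_of_nonpos hδ hδ1 (by linarith)
  have h3 : δ ^ (-1 + ε) ≤ δ ^ (2 * e - 1) :=
    Real.rpow_le_rpow_of_exponent_ge hδ hδ1 (by linarith)
  have h4 : 0 < δ ^ (e - 1) := Real.rpow_pos_of_pos hδ _
  have h5 : (2 * K + 1) * δ ^ (2 * e - 1) ≤ c * δ ^ (e - 1) := by
    rw [h1]
    nlinarith
  nlinarith

theorem mainTheorem6 (d : ℕ) (hd : 1 ≤ d) (s σ r₀ ε : ℝ) (hs : s ∈ Set.Ioo (1 / 2 : ℝ) 1)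
    (hσ : σ ∈ Set.Ioc (0 : ℝ) 1) (hr₀ : 0 < r₀) (hε : 0 < ε) :
    ∃ C : ℝ, 1 < C ∧ ∃ η : ℝ, 0 < η ∧
      ∀ Ω : Set (Eucl d), IsC11Domain Ω → Ω ≠ Set.univ → TwoSidedBallCondition Ω r₀ →
        ∃ φ : Eucl d → ℝ, MemHsLoc Set.univ s φ ∧
          (∀ x ∈ Metric.ball (0 : Eucl d) (4 / 5), 0 < distCompl Ω x → distCompl Ω x < η →
            ∃ v : ℝ, HasOperatorValue Ω s σ φ x v ∧ distCompl Ω x ^ (-1 + ε) ≤ v) ∧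
          (∀ x ∈ Metric.ball (0 : Eucl d) 1,
            distCompl Ω x ^ (2 * s - 1) ≤ φ x ∧ φ x ≤ C * distCompl Ω x ^ (2 * s - 1)) ∧
          (∀ x ∉ Metric.ball (0 : Eucl d) 2, φ x = 0) := by
  obtain ⟨hs, hs1⟩ := hs
  obtain ⟨hσ, hσ1⟩ := hσ
  have hp0 : 0 < 2 * s - 1 := by linarith
  -- the errors are of order `δ ^ (2 * e - 1)`; both powers in the barrier have to be concave
  obtain ⟨e, he0, heε, hep, he2, hep1⟩ : ∃ e : ℝ, 0 < e ∧ 2 * e ≤ ε ∧ 2 * e ≤ 2 * s - 1 ∧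
      2 * e ≤ 1 / 2 ∧ 2 * s - 1 + e ≤ 1 := by
    set m := min (min ε (2 * s - 1)) (min (1 / 2) (2 - 2 * s)) with hm
    have h0 : 0 < m := lt_min (lt_min hε hp0) (lt_min (by norm_num) (by linarith))
    have h1 : m ≤ ε := (min_le_left _ _).trans (min_le_left _ _)
    have h2 : m ≤ 2 * s - 1 := (min_le_left _ _).trans (min_le_right _ _)
    have h3 : m ≤ 1 / 2 := (min_le_right _ _).trans (min_le_left _ _)
    have h4 : m ≤ 2 - 2 * s := (min_le_right _ _).trans (min_le_right _ _)
    exact ⟨m / 2, by linarith, by linarith, by linarith, by linarith, by linarith⟩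
  obtain ⟨c, hc, K, hK, hop⟩ := exists_barrier_operator_lower_bound (C₀ := 1 / r₀) (γ := 2 * e)
    (M := 8) (r₁ := 1 / 10) hd hs hs1 hσ hσ1 (by positivity) he0 (by linarith) hep1 hep he2
    (by norm_num) (by norm_num) (by norm_num)
  have hη1 : 0 < (c / (2 * K + 1)) ^ (1 / e) := by positivity
  refine ⟨2, one_lt_two, min (min (1 / 10) (4 * r₀ / 9)) ((c / (2 * K + 1)) ^ (1 / e)),
    lt_min (lt_min (by norm_num) (by positivity)) hη1, fun Ω hΩ hne hball => ?_⟩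
  have hd0 := distCompl_nonneg Ω (0 : Eucl d)
  set R := 1 + distCompl Ω (0 : Eucl d) with hR
  have hR1 : 1 ≤ R := by linarith
  set φ : Eucl d → ℝ := fun x => barrierProfile (2 * s - 1) e (cutDist Ω R x) with hφ
  have hφm : Measurable φ :=
    ((continuous_barrierProfile hp0.le he0.le).comp (continuous_cutDist Ω R)).measurable
  have hφin : ∀ x : Eucl d, ‖x‖ ≤ 1 → φ x = barrierProfile (2 * s - 1) e (distCompl Ω x) :=
    fun x hx => by simp only [hφ, hR, cutDist_eq_distCompl Ω hx]
  have hφout : ∀ x : Eucl d, 2 ≤ ‖x‖ → φ x = 0 := fun x hx => by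
    simp only [hφ, cutDist_eq_zero Ω R hx]
    rw [barrierProfile, Real.zero_rpow hp0.ne', zero_mul]
  have hφ0 : ∀ x, 0 ≤ φ x := fun x =>
    (Real.rpow_nonneg (cutDist_nonneg Ω (by linarith) x) _).trans
      (rpow_le_barrierProfile he0.le (cutDist_nonneg Ω (by linarith) x))
  refine ⟨φ, memHsLoc_barrier hd hΩ hne hs hs1 he0 (by linarith) hR1, ?_, ?_, ?_⟩
  · intro x hx hδ hδη
    rw [mem_ball_zero_iff] at hx
    have hδ1 : distCompl Ω x < 1 / 10 := hδη.trans_le ((min_le_left _ _).trans (min_le_left _ _))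
    have hδr : distCompl Ω x < 4 * r₀ / 9 :=
      hδη.trans_le ((min_le_left _ _).trans (min_le_right _ _))
    have hδc : distCompl Ω x < (c / (2 * K + 1)) ^ (1 / e) := hδη.trans_le (min_le_right _ _)
    obtain ⟨n, hn, hpin⟩ := exists_normal_distCompl_pinched hΩ.1 hne hr₀ hball hx hδ
      (by linarith) (by linarith)
    -- the distance is at most `4` in the ball of radius `2`, which bounds the barrier
    have hφ8 : ∀ y, φ y ≤ 8 := by
      intro y
      rcases le_or_gt 2 ‖y‖ with hy | hy
      · rw [hφout y hy]; norm_num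
      have h1 := (abs_le.1 (abs_distCompl_sub_le Ω y x)).2
      have h2 : ‖y - x‖ ≤ ‖y‖ + ‖x‖ := norm_sub_le y x
      have h3 : cutDist Ω R y ≤ 4 := (min_le_left _ _).trans (by linarith)
      have h4 := cutDist_nonneg Ω (by linarith : 0 ≤ R) y
      calc φ y ≤ 2 * cutDist Ω R y ^ (2 * s - 1) := barrierProfile_le h4
        _ ≤ 2 * 4 ^ (2 * s - 1) := by gcongr
        _ ≤ 2 * (4 : ℝ) ^ (1 : ℝ) := by gcongr <;> linarith
        _ = 8 := by norm_num
    obtain ⟨v, hv, hle⟩ := hop Ω x n φ hΩ.1 hφm hn hpin hδ hδ1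
      (by rw [one_div, inv_mul_le_iff₀ hr₀]; linarith)
      (fun y _ => abs_le.2 ⟨by linarith [hφ0 x, hφ8 y], by linarith [hφ0 y, hφ8 x]⟩)
      (fun h hh => hφin _ ((norm_add_le x h).trans (by linarith)))
    refine ⟨v, hv, le_trans ?_ hle⟩
    refine rpow_le_of_small hK heε he2 hδ (by linarith) ?_
    have h1 : distCompl Ω x ^ e ≤ c / (2 * K + 1) := by
      have := Real.rpow_le_rpow hδ.le hδc.le he0.le
      rwa [← Real.rpow_mul (by positivity), one_div_mul_cancel he0.ne', Real.rpow_one] at this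
    rwa [le_div_iff₀' (by linarith)] at h1
  · intro x hx
    rw [mem_ball_zero_iff] at hx
    rw [hφin x hx.le]
    exact ⟨rpow_le_barrierProfile he0.le (distCompl_nonneg Ω x),
      barrierProfile_le (distCompl_nonneg Ω x)⟩
  · intro x hx
    rw [mem_ball_zero_iff, not_lt] at hx
    exact hφout x hx
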